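/- **Proposition 5.1.** Let $\gamma>1$, $\theta=\frac{\gamma-1}{2}$, $\kappa=\frac{(\gamma-1)^2}{4\gamma}$, $p(\rho)=\kappa\rho^\gamma$, $e(\rho)=\frac{\kappa}{\gamma-1}\rho^\gamma$ and $e^*(\rho,\bar\rho)=e(\rho)-e(\bar\rho)-e'(\bar\rho)(\rho-\bar\rho)$. Let $\rho^\pm>0$ and $u^\pm\in\mathbb R$, and let $\bar\rho,\bar u$ be smooth monotone functions on $\mathbb R$ with $(\bar\rho,\bar u)=(\rho^\pm,u^\pm)$ for $\pm x\ge L_0$, for some $L_0>0$. Write $\mathbb R^2_+=[0,\infty)\times\mathbb R$ for the set of points $(t,x)$. Let $\varepsilon>0$ run through a sequence tending to $0$ and, for each $\varepsilon$, let $(\rho^\varepsilon,u^\varepsilon)$ be a smooth solution on $\mathbb R^2_+$ of the Navier–Stokes equations $$\rho_t+(\rho u)_x=0,\qquad (\rho u)_t+(\rho u^2+p(\rho))_x=\varepsilon u_{xx},$$ with initial data $(\rho_0^\varepsilon,u_0^\varepsilon)$, such that $\rho^\varepsilon(t,x)\ge c_\varepsilon(t)$ for some $c_\varepsilon(t)>0$,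 and $(\rho^\varepsilon,u^\varepsilon)(t,x)\to(\rho^\pm,u^\pm)$ as $x\to\pm\infty$, uniformly for $t$ in bounded intervals. Assume that there are constants $E_0,E_1,M_0$ independent of $\varepsilon$ with $$\int_{\mathbb R}\Big(\tfrac12\rho_0^\varepsilon|u_0^\varepsilon-\bar u|^2+e^*(\rho_0^\varepsilon,\bar\rho)\Big)dx\le E_0,\qquad \varepsilon^2\int_{\mathbb R}\frac{|\rho^\varepsilon_{0,x}|^2}{(\rho_0^\varepsilon)^3}\,dx\le E_1,\qquad \int_{\mathbb R}\rho_0^\varepsilon|u_0^\varepsilon-\bar u|\,dx\le M_0 .$$ Let $\mathbb H=\{(\rho,u):\rho>0\}$ and $\bar{\mathbb H}=\{(\rho,u):\rho\ge0\}$. Let $\bar{\mathcal H}$ be the compactification of $\mathbb H$ whose continuous functions correspond to the functions $\phi\in C(\bar{\mathbb H})$ that are constant on $\{\rho=0\}$ and for which $\lim_{s\to\infty}\phi(s\rho,su)$ exists uniformly for $(\rho,u)\in\mathbb S^1\cap\bar{\mathbb H}$ and is continuous there. (Equivalently, add to $\bar{\mathbb H}$ the half-circle of directions at infinity and collapse the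 closure of $\{\rho=0\}$ to a point.) Let $V\subset\bar{\mathcal H}$ be the closure of the image of $\{\rho=0\}$. Let $\nu=(\nu_{t,x})$ be a Young measure of the sequence $(\rho^\varepsilon,u^\varepsilon)$, that is, a weakly measurable family of Borel probability measures on $\bar{\mathcal H}$, indexed by $(t,x)\in\mathbb R^2_+$, such that for all $\phi\in C(\bar{\mathcal H})$ $$\phi(\rho^\varepsilon,u^\varepsilon)\overset{*}{\rightharpoonup}\int_{\bar{\mathcal H}}\phi\,d\nu_{t,x}\qquad\text{in }L^\infty(\mathbb R^2_+).$$ Then the following hold. (i) For all $T>0$ and all compact $K\subset\mathbb R$, the function $\rho^{\gamma+1}+\rho|u|^3$ is $\nu_{t,x}$-integrable on $\mathbb H$ for a.e. $(t,x)$ and $$\int_{\mathbb H}\big(\rho^{\gamma+1}+\rho|u|^3\big)\,d\nu_{t,x}\in L^1([0,T]\times K).$$ (ii) Let $\phi:\bar{\mathbb H}\to\mathbb R$ be continuous, zero on $\{\rho=0\}$, with $\operatorname{supp}\phi\subset\{(\rho,u):\rho^\theta+u\ge-c,\ u-\rho^\theta\le c\}$ for some $c>0$, and with $|\phi(\rho,u)|\le\rho^{\beta(\gamma+1)}$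 for all $(\rho,u)$ with $\rho$ large, for some $\beta\in(0,1)$. Then $\phi$ is $\nu_{t,x}$-integrable on $\mathbb H$ for a.e. $(t,x)$, and $$\phi(\rho^\varepsilon,u^\varepsilon)\rightharpoonup\int_{\mathbb H}\phi\,d\nu_{t,x}\qquad\text{weakly in }L^1_{loc}(\mathbb R^2_+),$$ i.e. weakly in $L^1(Q)$ for every compact $Q\subset\mathbb R^2_+$. (iii) $\nu_{t,x}\big(\bar{\mathcal H}\setminus(\mathbb H\cup V)\big)=0$ for a.e. $(t,x)$. -/

import Mathlib

open Set Filter Topology MeasureTheory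
open scoped ContDiff ENNReal NNReal

noncomputable section

namespace IsentropicLimit

/-! ## The gas -/

/-- The exponent `θ = (γ - 1) / 2`. -/
def theta (γ : ℝ) : ℝ := (γ - 1) / 2

/-- The constant `κ = (γ - 1)² / (4 γ)`. -/
def kappa (γ : ℝ) : ℝ := (γ - 1) ^ 2 / (4 * γ)

/-- The pressure `p(ρ) = κ ρ ^ γ`. -/
def pressure (γ r : ℝ) : ℝ := kappa γ * r ^ γ

/-- The internal energy `e(ρ) = κ / (γ - 1) ρ ^ γ`. -/
def internalEnergy (γ r : ℝ) : ℝ := kappa γ / (γ - 1) * r ^ γ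

/-- The relative internal energy `e*(ρ, ρ̄) = e(ρ) - e(ρ̄) - e'(ρ̄) (ρ - ρ̄)`. -/
def relativeEnergy (γ r rbar : ℝ) : ℝ :=
  internalEnergy γ r - internalEnergy γ rbar
    - deriv (internalEnergy γ) rbar * (r - rbar)

/-! ## The Navier-Stokes equations -/

/-- The physical domain `[0, ∞) × ℝ` of points `(t, x)`. -/
def spaceTime : Set (ℝ × ℝ) := Ici (0 : ℝ) ×ˢ (univ : Set ℝ)

/-- The limits `ρ⁻, u⁻` at `x = -∞` and `ρ⁺, u⁺` at `x = +∞`. -/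
structure EndStates where
  rhoL : ℝ
  uL : ℝ
  rhoR : ℝ
  uR : ℝ

/-- `(ρ̄, ū)` is a pair of smooth monotone functions (each of them nondecreasing or
nonincreasing) that equals the end states outside of `(-L₀, L₀)`. -/
structure IsReferenceProfile (s : EndStates) (rhobar ubar : ℝ → ℝ) : Prop where
  smooth_rho : ContDiff ℝ ∞ rhobar
  smooth_u : ContDiff ℝ ∞ ubar
  monotone_rho : Monotone rhobar ∨ Antitone rhobar
  monotone_u : Monotone ubar ∨ Antitone ubar
  eq_ends : ∃ L₀ : ℝ, 0 < L₀ ∧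
    (∀ x, L₀ ≤ x → rhobar x = s.rhoR ∧ ubar x = s.uR) ∧
    (∀ x, x ≤ -L₀ → rhobar x = s.rhoL ∧ ubar x = s.uL)

/-- `(ρ, u)` is a global smooth solution on `[0, ∞) × ℝ` of
`ρ_t + (ρ u)_x = 0`, `(ρ u)_t + (ρ u² + p(ρ))_x = ε u_xx`
with initial data `(ρ₀, u₀)`, density bounded below by a positive function of time, and the
given end states at `x = ±∞`, attained uniformly on bounded time intervals. -/
structure IsNSSolution (γ ε : ℝ) (s : EndStates) (rho0 u0 : ℝ → ℝ) (rho u : ℝ → ℝ → ℝ) :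
    Prop where
  smooth_rho : ContDiffOn ℝ ∞ (fun p : ℝ × ℝ => rho p.1 p.2) spaceTime
  smooth_u : ContDiffOn ℝ ∞ (fun p : ℝ × ℝ => u p.1 p.2) spaceTime
  lower_bound : ∃ c : ℝ → ℝ, ∀ t, 0 ≤ t → 0 < c t ∧ ∀ x, c t ≤ rho t x
  mass : ∀ t x, 0 < t →
    deriv (fun τ => rho τ x) t + deriv (fun y => rho t y * u t y) x = 0
  momentum : ∀ t x, 0 < t →
    deriv (fun τ => rho τ x * u τ x) t
        + deriv (fun y => rho t y * u t y ^ 2 + pressure γ (rho t y)) x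
      = ε * deriv (deriv (fun y => u t y)) x
  initial_rho : ∀ x, rho 0 x = rho0 x
  initial_u : ∀ x, u 0 x = u0 x
  rho_right : ∀ T : ℝ, TendstoUniformlyOn (fun x t => rho t x) (fun _ => s.rhoR) atTop (Icc 0 T)
  rho_left : ∀ T : ℝ, TendstoUniformlyOn (fun x t => rho t x) (fun _ => s.rhoL) atBot (Icc 0 T)
  u_right : ∀ T : ℝ, TendstoUniformlyOn (fun x t => u t x) (fun _ => s.uR) atTop (Icc 0 T)
  u_left : ∀ T : ℝ, TendstoUniformlyOn (fun x t => u t x) (fun _ => s.uL) atBot (Icc 0 T)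

/-- The total relative mechanical energy
`∫ (½ ρ₀ |u₀ - ū|² + e*(ρ₀, ρ̄)) dx` of a state, as a number in `[0, ∞]`
(the integrand is nonnegative for positive densities). -/
def totalEnergy (γ : ℝ) (rhobar ubar rho0 u0 : ℝ → ℝ) : ℝ≥0∞ :=
  ∫⁻ x, ENNReal.ofReal
    (1 / 2 * rho0 x * |u0 x - ubar x| ^ 2 + relativeEnergy γ (rho0 x) (rhobar x))

/-- The bounds on the initial data, with constants `E₀, E₁, M₀`. -/
structure InitialBounds (γ ε : ℝ) (rhobar ubar : ℝ → ℝ) (E₀ E₁ M₀ : ℝ≥0) (rho0 u0 : ℝ → ℝ) :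
    Prop where
  energy : totalEnergy γ rhobar ubar rho0 u0 ≤ E₀
  gradient : ENNReal.ofReal (ε ^ 2) *
    ∫⁻ x, ENNReal.ofReal (|deriv rho0 x| ^ 2 / rho0 x ^ 3) ≤ E₁
  momentum : ∫⁻ x, ENNReal.ofReal (rho0 x * |u0 x - ubar x|) ≤ M₀

/-! ## The phase space and its compactification

The compactification of the half-plane `{ρ > 0}` is obtained in two steps: the closed half-plane
`{ρ ≥ 0}` is mapped radially into the closed half-disc, whose semicircle carries the directions
at infinity, and then the diameter (the vacuum) is pinched to one point. The theorem
`mem_barC_iff` below says that its continuous functions are the functions on the closed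
half-plane that are continuous, constant on the vacuum, and have radial limits at infinity
depending continuously on the direction. -/

/-- The open half-plane `{ρ > 0}` of states `(ρ, u)`. -/
def halfPlane : Set (ℝ × ℝ) := {q | 0 < q.1}

/-- The closed half-plane `{ρ ≥ 0}`. -/
def closedHalfPlane : Set (ℝ × ℝ) := {q | 0 ≤ q.1}

/-- The closed Euclidean half-disc `{(a, b) : a ≥ 0, a² + b² ≤ 1}`. -/
def halfDisc : Set (ℝ × ℝ) := {z | 0 ≤ z.1 ∧ z.1 ^ 2 + z.2 ^ 2 ≤ 1}

/-- The closed half-circle of directions, `S¹ ∩ {ρ ≥ 0}`. -/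
def halfCircle : Set (ℝ × ℝ) := {z | 0 ≤ z.1 ∧ z.1 ^ 2 + z.2 ^ 2 = 1}

/-- Radial compression of the plane into the disc, `q ↦ q / (1 + |q|)`. -/
def compress (q : ℝ × ℝ) : ℝ × ℝ :=
  (q.1 / (1 + √(q.1 ^ 2 + q.2 ^ 2)), q.2 / (1 + √(q.1 ^ 2 + q.2 ^ 2)))

/-- The map `(a, b) ↦ (a, a b)`, which sends the line `a = 0` to one point and is injective
off that line. -/
def pinch (z : ℝ × ℝ) : ℝ × ℝ := (z.1, z.1 * z.2)

theorem compress_mem {q : ℝ × ℝ} (hq : 0 ≤ q.1) : compress q ∈ halfDisc := by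
  have h0 : 0 ≤ √(q.1 ^ 2 + q.2 ^ 2) := Real.sqrt_nonneg _
  refine ⟨div_nonneg hq (by linarith), ?_⟩
  have h1 : √(q.1 ^ 2 + q.2 ^ 2) ^ 2 = q.1 ^ 2 + q.2 ^ 2 := Real.sq_sqrt (by positivity)
  simp only [compress, div_pow]
  rw [← add_div, div_le_one (by positivity)]
  nlinarith

/-- The compactification: the half-disc with its diameter pinched to a point. -/
abbrev BarH : Type := pinch '' halfDisc

/-- The canonical map of the closed half-plane into the compactification. (Pairs with `ρ < 0`,
which are not states, are sent to the vacuum, to have a total function.) -/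
def embed (q : ℝ × ℝ) : BarH :=
  ⟨pinch (compress (max q.1 0, q.2)), mem_image_of_mem _ (compress_mem (le_max_right _ _))⟩

/-- The open half-plane as a subset of the compactification. -/
def openPart : Set BarH := embed '' halfPlane

/-- The vacuum `V`: the closure of `{ρ = 0}` in the compactification. -/
def vacuum : Set BarH := closure (embed '' {q | q.1 = 0})

/-- The restriction to the open half-plane of a measure on the compactification. -/
def restrictH (μ : Measure BarH) : Measure halfPlane :=
  μ.comap (fun q : halfPlane => embed q)

/-- The space of continuous functions on the closed half-plane that are constant on `{ρ = 0}`
and have a radial limit at infinity, uniform in and continuous with respect to the direction. -/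
def barC : Set (ℝ × ℝ → ℝ) :=
  {φ | ContinuousOn φ closedHalfPlane ∧ (∃ a, ∀ u, φ (0, u) = a) ∧
    ∃ g : ℝ × ℝ → ℝ, ContinuousOn g halfCircle ∧
      TendstoUniformlyOn (fun (s : ℝ) d => φ (s * d.1, s * d.2)) g atTop halfCircle}

theorem continuous_compress : Continuous compress := by
  unfold compress
  have h : ∀ q : ℝ × ℝ, 1 + √(q.1 ^ 2 + q.2 ^ 2) ≠ 0 := fun q => by positivity
  exact ((by fun_prop : Continuous fun q : ℝ × ℝ => q.1).div (by fun_prop) h).prodMk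
    ((by fun_prop : Continuous fun q : ℝ × ℝ => q.2).div (by fun_prop) h)

theorem continuous_pinch : Continuous pinch := by
  unfold pinch; fun_prop

theorem continuous_embed : Continuous embed :=
  Continuous.subtype_mk
    (continuous_pinch.comp (continuous_compress.comp (by fun_prop))) _

theorem norm_compress (q : ℝ × ℝ) :
    √((compress q).1 ^ 2 + (compress q).2 ^ 2)
      = √(q.1 ^ 2 + q.2 ^ 2) / (1 + √(q.1 ^ 2 + q.2 ^ 2)) := by
  have h0 : 0 ≤ √(q.1 ^ 2 + q.2 ^ 2) := Real.sqrt_nonneg _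
  have h1 : √(q.1 ^ 2 + q.2 ^ 2) ^ 2 = q.1 ^ 2 + q.2 ^ 2 := Real.sq_sqrt (by positivity)
  rw [Real.sqrt_eq_iff_mul_self_eq (by positivity) (by positivity)]
  simp only [compress, div_pow, ← add_div, ← pow_two, h1]

/-- The inverse `z ↦ z / (1 - |z|)` of `compress` on the open disc. -/
def expand (z : ℝ × ℝ) : ℝ × ℝ :=
  (z.1 / (1 - √(z.1 ^ 2 + z.2 ^ 2)), z.2 / (1 - √(z.1 ^ 2 + z.2 ^ 2)))

theorem expand_compress (q : ℝ × ℝ) : expand (compress q) = q := by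
  have h0 : 0 ≤ √(q.1 ^ 2 + q.2 ^ 2) := Real.sqrt_nonneg _
  have h2 : 1 - √(q.1 ^ 2 + q.2 ^ 2) / (1 + √(q.1 ^ 2 + q.2 ^ 2))
      = 1 / (1 + √(q.1 ^ 2 + q.2 ^ 2)) := by
    field_simp; ring
  unfold expand
  rw [norm_compress, h2]
  ext <;> simp only [compress] <;> field_simp

theorem embed_injOn : InjOn embed halfPlane := by
  intro q hq q' hq' h
  have hq1 : 0 < q.1 := hq
  have hq1' : 0 < q'.1 := hq'
  have h1 : pinch (compress q) = pinch (compress q') := by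
    have := congrArg Subtype.val h
    simpa [embed, max_eq_left hq1.le, max_eq_left hq1'.le] using this
  have hpos : 0 < (compress q).1 := by
    have : 0 ≤ √(q.1 ^ 2 + q.2 ^ 2) := Real.sqrt_nonneg _
    simp only [compress]; positivity
  simp only [pinch, Prod.mk.injEq] at h1
  have h2 : compress q = compress q' := by
    refine Prod.ext h1.1 ?_
    have := h1.2
    rw [← h1.1] at this
    exact mul_left_cancel₀ hpos.ne' this
  rw [← expand_compress q, h2, expand_compress]

/-- The open half-plane sits in the compactification as a measurable set, so that `restrictH` is
the restriction of the measure in the usual sense. -/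
theorem measurableEmbedding_embed :
    MeasurableEmbedding (fun q : halfPlane => embed q) := by
  have : IsOpen halfPlane := isOpen_lt continuous_const continuous_fst
  have := this.polishSpace
  refine (continuous_embed.comp continuous_subtype_val).measurableEmbedding ?_
  intro q q' h
  exact Subtype.ext (embed_injOn q.2 q'.2 h)

theorem isCompact_halfDisc : IsCompact halfDisc := by
  refine Metric.isCompact_of_isClosed_isBounded ?_ ?_
  · exact (isClosed_le continuous_const continuous_fst).inter
      (isClosed_le (by fun_prop : Continuous fun z : ℝ × ℝ => z.1 ^ 2 + z.2 ^ 2) continuous_const)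
  · refine (Metric.isBounded_closedBall (x := (0 : ℝ × ℝ)) (r := 1)).subset ?_
    rintro ⟨a, b⟩ ⟨_, h⟩
    simp only at h
    simp only [mem_closedBall_zero_iff, Prod.norm_def, Real.norm_eq_abs, sup_le_iff]
    exact ⟨abs_le_one_iff_mul_self_le_one.2 (by nlinarith),
      abs_le_one_iff_mul_self_le_one.2 (by nlinarith)⟩

instance compactSpace_barH : CompactSpace BarH :=
  isCompact_iff_compactSpace.1 (isCompact_halfDisc.image continuous_pinch)

/-- The quotient map of the half-disc onto the compactification. -/
def pinchMap (z : halfDisc) : BarH := ⟨pinch z, mem_image_of_mem _ z.2⟩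

theorem isQuotientMap_pinchMap : IsQuotientMap pinchMap := by
  have : CompactSpace halfDisc := isCompact_iff_compactSpace.1 isCompact_halfDisc
  refine IsQuotientMap.of_surjective_continuous ?_
    (Continuous.subtype_mk (continuous_pinch.comp continuous_subtype_val) _)
  rintro ⟨_, z, hz, rfl⟩
  exact ⟨⟨z, hz⟩, rfl⟩

theorem embed_eq {q : ℝ × ℝ} (hq : q ∈ closedHalfPlane) :
    embed q = pinchMap ⟨compress q, compress_mem hq⟩ := by
  have : 0 ≤ q.1 := hq
  simp [embed, pinchMap, max_eq_left this]

theorem continuousOn_extend {φ g : ℝ × ℝ → ℝ} (hφ : ContinuousOn φ closedHalfPlane)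
    (hg : ContinuousOn g halfCircle)
    (hlim : TendstoUniformlyOn (fun (s : ℝ) d => φ (s * d.1, s * d.2)) g atTop halfCircle) :
    ContinuousOn (fun z : ℝ × ℝ => if z.1 ^ 2 + z.2 ^ 2 < 1 then φ (expand z) else g z)
      halfDisc := by
  have hN : Continuous fun z : ℝ × ℝ => √(z.1 ^ 2 + z.2 ^ 2) := by fun_prop
  intro z₀ hz₀
  by_cases h : z₀.1 ^ 2 + z₀.2 ^ 2 < 1
  · have hlt : √(z₀.1 ^ 2 + z₀.2 ^ 2) < 1 := by
      rw [Real.sqrt_lt' one_pos]; simpa using h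
    have hopen : IsOpen {z : ℝ × ℝ | z.1 ^ 2 + z.2 ^ 2 < 1} :=
      isOpen_lt (by fun_prop : Continuous fun z : ℝ × ℝ => z.1 ^ 2 + z.2 ^ 2) continuous_const
    have he : ContinuousAt expand z₀ := by
      unfold expand
      have : 1 - √(z₀.1 ^ 2 + z₀.2 ^ 2) ≠ 0 := by linarith
      have hN1 : Continuous fun z : ℝ × ℝ => 1 - √(z.1 ^ 2 + z.2 ^ 2) := by fun_prop
      exact (continuous_fst.continuousAt.div hN1.continuousAt this).prodMk
        (continuous_snd.continuousAt.div hN1.continuousAt this)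
    have hmaps : ∀ z ∈ halfDisc ∩ {z : ℝ × ℝ | z.1 ^ 2 + z.2 ^ 2 < 1},
        expand z ∈ closedHalfPlane := by
      rintro z ⟨hz, hz1⟩
      have : √(z.1 ^ 2 + z.2 ^ 2) < 1 := by
        rw [Real.sqrt_lt' one_pos]; simpa using hz1
      exact div_nonneg hz.1 (by linarith)
    have hc : ContinuousWithinAt (fun z => φ (expand z))
        (halfDisc ∩ {z : ℝ × ℝ | z.1 ^ 2 + z.2 ^ 2 < 1}) z₀ :=
      (hφ _ (hmaps z₀ ⟨hz₀, h⟩)).comp he.continuousWithinAt hmaps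
    have hc2 := hc.congr (g := fun z : ℝ × ℝ =>
      if z.1 ^ 2 + z.2 ^ 2 < 1 then φ (expand z) else g z)
      (fun z hz => if_pos hz.2) (if_pos h)
    exact (continuousWithinAt_inter (hopen.mem_nhds h)).1 hc2
  · have h1 : z₀.1 ^ 2 + z₀.2 ^ 2 = 1 := le_antisymm hz₀.2 (not_lt.1 h)
    have hz₀c : z₀ ∈ halfCircle := ⟨hz₀.1, h1⟩
    rw [Metric.continuousWithinAt_iff']
    intro ε hε
    simp only [h1, lt_irrefl, if_false]
    have hN0 : √(z₀.1 ^ 2 + z₀.2 ^ 2) = 1 := by rw [h1, Real.sqrt_one]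
    -- the direction of `z`
    have hdir : Tendsto (fun z : ℝ × ℝ =>
        (z.1 / √(z.1 ^ 2 + z.2 ^ 2), z.2 / √(z.1 ^ 2 + z.2 ^ 2))) (𝓝[halfDisc] z₀)
        (𝓝[halfCircle] z₀) := by
      refine tendsto_nhdsWithin_iff.2 ⟨?_, ?_⟩
      · have hne : √(z₀.1 ^ 2 + z₀.2 ^ 2) ≠ 0 := by rw [hN0]; exact one_ne_zero
        have hc : ContinuousAt (fun z : ℝ × ℝ =>
            (z.1 / √(z.1 ^ 2 + z.2 ^ 2), z.2 / √(z.1 ^ 2 + z.2 ^ 2))) z₀ :=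
          (continuous_fst.continuousAt.div hN.continuousAt hne).prodMk
            (continuous_snd.continuousAt.div hN.continuousAt hne)
        have := hc.tendsto.mono_left (nhdsWithin_le_nhds (s := halfDisc))
        simpa [hN0] using this
      · have hpos : ∀ᶠ z in 𝓝[halfDisc] z₀, 0 < √(z.1 ^ 2 + z.2 ^ 2) :=
          nhdsWithin_le_nhds (hN.continuousAt.eventually_const_lt (by simp only [hN0]; exact one_pos))
        filter_upwards [hpos, self_mem_nhdsWithin] with z hz hzD
        refine ⟨div_nonneg hzD.1 hz.le, ?_⟩
        have hsq : √(z.1 ^ 2 + z.2 ^ 2) ^ 2 = z.1 ^ 2 + z.2 ^ 2 := Real.sq_sqrt (by positivity)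
        simp only [div_pow, ← add_div, hsq]
        rw [← hsq]
        exact div_self (by positivity)
    have hgd := (hg z₀ hz₀c).tendsto.comp hdir
    have hgd' := (Metric.tendsto_nhds.1 hgd) (ε / 2) (half_pos hε)
    have hgz : ∀ᶠ z in 𝓝[halfDisc] z₀, z ∈ halfCircle → dist (g z) (g z₀) < ε := by
      have h3 := (Metric.tendsto_nhds.1 (hg z₀ hz₀c).tendsto) ε hε
      exact nhdsWithin_le_nhds (eventually_nhdsWithin_iff.1 h3)
    obtain ⟨S, hS⟩ := eventually_atTop.1 (Metric.tendstoUniformlyOn_iff.1 hlim (ε / 2)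
      (half_pos hε))
    have hbig : ∀ᶠ z in 𝓝[halfDisc] z₀,
        |S| / (1 + |S|) < √(z.1 ^ 2 + z.2 ^ 2) := by
      refine nhdsWithin_le_nhds (hN.continuousAt.eventually_const_lt ?_)
      simp only [hN0]
      rw [div_lt_one (by positivity)]
      linarith
    filter_upwards [hgd', hgz, hbig, self_mem_nhdsWithin,
      (tendsto_nhdsWithin_iff.1 hdir).2] with z h1 h2 h3 hzD hzd
    split_ifs with hlt
    · have hr : √(z.1 ^ 2 + z.2 ^ 2) < 1 := by
        rw [Real.sqrt_lt' one_pos]; simpa using hlt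
      have hr0 : 0 < √(z.1 ^ 2 + z.2 ^ 2) := lt_of_le_of_lt (by positivity) h3
      set r := √(z.1 ^ 2 + z.2 ^ 2) with hrdef
      have hs : S ≤ r / (1 - r) := by
        refine (le_abs_self S).trans ?_
        rw [le_div_iff₀ (by linarith)]
        rw [div_lt_iff₀ (by positivity)] at h3
        nlinarith
      have h4 := hS _ hs _ hzd
      have h5 : expand z = (r / (1 - r) * (z.1 / r), r / (1 - r) * (z.2 / r)) := by
        have : 1 - r ≠ 0 := by linarith
        simp only [expand, ← hrdef]
        ext <;> field_simp
      rw [h5]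
      rw [dist_comm] at h4
      have h6 := dist_triangle (φ (r / (1 - r) * (z.1 / r), r / (1 - r) * (z.2 / r)))
        (g (z.1 / r, z.2 / r)) (g z₀)
      simp only [Function.comp] at h1
      linarith
    · exact h2 ⟨hzD.1, le_antisymm hzD.2 (not_lt.1 hlt)⟩

theorem norm_sq_compress_lt (q : ℝ × ℝ) : (compress q).1 ^ 2 + (compress q).2 ^ 2 < 1 := by
  have h0 : 0 ≤ √(q.1 ^ 2 + q.2 ^ 2) := Real.sqrt_nonneg _
  have : √((compress q).1 ^ 2 + (compress q).2 ^ 2) < 1 := by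
    rw [norm_compress, div_lt_one (by positivity)]; linarith
  rw [Real.sqrt_lt' one_pos] at this
  simpa using this

/-- The continuous functions on the compactification are exactly the functions in `barC`. -/
theorem mem_barC_iff (φ : ℝ × ℝ → ℝ) :
    φ ∈ barC ↔ ∃ f : C(BarH, ℝ), ∀ q ∈ closedHalfPlane, f (embed q) = φ q := by
  constructor
  · rintro ⟨hφ, ⟨a, ha⟩, g, hg, hlim⟩
    have hcont := continuousOn_iff_continuous_domRestrict.1 (continuousOn_extend hφ hg hlim)
    set F : C(halfDisc, ℝ) := ⟨_, hcont⟩ with hF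
    have hFval : ∀ z : halfDisc, F z = if z.1.1 ^ 2 + z.1.2 ^ 2 < 1 then φ (expand z) else g z :=
      fun z => rfl
    have hga : ∀ b : ℝ, (0, b) ∈ halfCircle → g (0, b) = a := by
      intro b hb
      have h1 := hlim.tendsto_at hb
      simp only [mul_zero, ha] at h1
      exact tendsto_nhds_unique h1 tendsto_const_nhds
    have hF0 : ∀ z : halfDisc, z.1.1 = 0 → F z = a := by
      rintro ⟨⟨x, b⟩, hz⟩ hx
      simp only at hx
      subst hx
      rw [hFval]
      split_ifs with h
      · simp only [expand, zero_div, ha]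
      · exact hga b ⟨le_rfl, le_antisymm hz.2 (not_lt.1 h)⟩
    have hfac : Function.FactorsThrough F pinchMap := by
      intro z z' h
      have h1 : pinch z = pinch z' := congrArg Subtype.val h
      simp only [pinch, Prod.mk.injEq] at h1
      by_cases h0 : z.1.1 = 0
      · rw [hF0 z h0, hF0 z' (h1.1 ▸ h0)]
      · congr 1
        refine Subtype.ext (Prod.ext h1.1 ?_)
        have := h1.2
        rw [← h1.1] at this
        exact mul_left_cancel₀ h0 this
    refine ⟨isQuotientMap_pinchMap.lift (f := ⟨pinchMap, isQuotientMap_pinchMap.continuous⟩)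
      F hfac, fun q hq => ?_⟩
    have h1 := isQuotientMap_pinchMap.lift_comp
      (f := ⟨pinchMap, isQuotientMap_pinchMap.continuous⟩) F hfac
    have h2 := DFunLike.congr_fun h1 ⟨compress q, compress_mem hq⟩
    simp only [ContinuousMap.comp_apply, ContinuousMap.coe_mk] at h2
    rw [embed_eq hq, h2, hFval, if_pos (norm_sq_compress_lt q), expand_compress]
  · rintro ⟨f, hf⟩
    refine ⟨?_, ⟨f (embed (0, 0)), fun u => ?_⟩, ?_⟩
    · exact (f.continuous.comp continuous_embed).continuousOn.congr fun q hq => (hf q hq).symm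
    · rw [← hf (0, u) (le_refl (0 : ℝ))]
      congr 1
      apply Subtype.ext
      simp [embed, pinch, compress]
    · have hsub : halfCircle ⊆ halfDisc := fun z hz => ⟨hz.1, hz.2.le⟩
      obtain ⟨G, hG⟩ : ∃ G : ℝ × ℝ → ℝ, ∀ z : halfDisc, G z = f (pinchMap z) :=
        open Classical in ⟨fun z => if h : z ∈ halfDisc then f (pinchMap ⟨z, h⟩) else 0,
          fun z => by simp [z.2]⟩
      have hGc : ContinuousOn G halfDisc := by
        rw [continuousOn_iff_continuous_domRestrict]
        exact (f.continuous.comp isQuotientMap_pinchMap.continuous).congr fun z => (hG z).symm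
      have hGu : UniformContinuousOn G halfDisc :=
        isCompact_halfDisc.uniformContinuousOn_of_continuous hGc
      refine ⟨G, hGc.mono hsub, ?_⟩
      rw [Metric.tendstoUniformlyOn_iff]
      intro ε hε
      obtain ⟨δ, hδ, hGδ⟩ := Metric.uniformContinuousOn_iff.1 hGu ε hε
      filter_upwards [eventually_gt_atTop (0 : ℝ), eventually_gt_atTop (1 / δ)] with s hs hsδ d hd
      have hmem : (s * d.1, s * d.2) ∈ closedHalfPlane := mul_nonneg hs.le hd.1
      rw [← hf _ hmem, embed_eq hmem, ← hG]
      refine hGδ _ (hsub hd) _ (compress_mem hmem) ?_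
      have hr : √((s * d.1) ^ 2 + (s * d.2) ^ 2) = s := by
        have h1 : (s * d.1) ^ 2 + (s * d.2) ^ 2 = s ^ 2 := by
          rw [mul_pow, mul_pow, ← mul_add, hd.2, mul_one]
        rw [h1, Real.sqrt_sq hs.le]
      have key : ∀ x : ℝ, x ^ 2 ≤ 1 → dist x (s * x / (1 + s)) < δ := by
        intro x hx
        have h1 : x - s * x / (1 + s) = x / (1 + s) := by field_simp; ring
        rw [Real.dist_eq, h1, abs_div, abs_of_pos (by positivity : 0 < 1 + s),
          div_lt_iff₀ (by positivity)]
        have h2 : |x| ≤ 1 := abs_le_one_iff_mul_self_le_one.2 (by nlinarith)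
        rw [div_lt_iff₀ hδ] at hsδ
        nlinarith
      rw [Prod.dist_eq, max_lt_iff]
      simp only [compress, hr]
      exact ⟨key _ (by nlinarith [hd.2]), key _ (by nlinarith [hd.2])⟩

/-- The half-plane is dense in its compactification. -/
theorem denseRange_embed : closure (embed '' closedHalfPlane) = univ := by
  refine eq_univ_of_forall fun y => ?_
  obtain ⟨z, rfl⟩ := isQuotientMap_pinchMap.surjective y
  have hmem : ∀ r ∈ Ioo (0 : ℝ) 1, ((r * z.1.1, r * z.1.2) : ℝ × ℝ) ∈ halfDisc := by
    intro r hr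
    refine ⟨mul_nonneg hr.1.le z.2.1, ?_⟩
    have := z.2.2
    have h2 : r ^ 2 ≤ 1 := by nlinarith [hr.1, hr.2]
    simp only [mul_pow, ← mul_add]
    exact mul_le_one₀ h2 (by positivity) this
  have hlim : Tendsto (fun r : ℝ => pinch (r * z.1.1, r * z.1.2)) (𝓝[<] 1)
      (𝓝 (pinch z.1)) := by
    have hc : Continuous (fun r : ℝ => pinch (r * z.1.1, r * z.1.2)) :=
      continuous_pinch.comp (by fun_prop)
    simpa using hc.continuousAt.tendsto.mono_left (nhdsWithin_le_nhds (a := (1 : ℝ)) (s := Iio 1))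
  rw [closure_subtype]
  refine mem_closure_of_tendsto hlim ?_
  filter_upwards [Ioo_mem_nhdsLT (zero_lt_one' ℝ)] with r hr
  set w : ℝ × ℝ := (r * z.1.1, r * z.1.2) with hw
  have hwN : √(w.1 ^ 2 + w.2 ^ 2) < 1 := by
    rw [Real.sqrt_lt' one_pos]
    have := z.2.2
    simp only [hw, mul_pow, ← mul_add]
    have h2 : r ^ 2 < 1 := by nlinarith [hr.1, hr.2]
    nlinarith [sq_nonneg r, sq_nonneg z.1.1, sq_nonneg z.1.2]
  have hw1 : 0 ≤ w.1 := (hmem r hr).1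
  have hx : expand w ∈ closedHalfPlane := div_nonneg hw1 (by linarith)
  refine ⟨embed (expand w), mem_image_of_mem _ hx, ?_⟩
  rw [embed_eq hx]
  have hce : compress (expand w) = w := by
    set n := √(w.1 ^ 2 + w.2 ^ 2) with hn
    have h1n : 0 < 1 - n := by linarith
    have hsqrt : √((expand w).1 ^ 2 + (expand w).2 ^ 2) = n / (1 - n) := by
      simp only [expand, div_pow, ← add_div]
      rw [Real.sqrt_div (by positivity), ← hn, Real.sqrt_sq h1n.le]
    have h2 : 1 + n / (1 - n) = 1 / (1 - n) := by field_simp; ring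
    unfold compress
    rw [hsqrt, h2]
    ext <;> simp only [expand, ← hn] <;> field_simp
  simp [pinchMap, hce]

/-! ## Young measures and weak convergence -/

/-- `ν` is a Young measure of the sequence `(ρₙ, uₙ)` of functions on `[0, ∞) × ℝ`: it is a
weakly measurable family of probability measures on the compactification, and for every
continuous `f` on the compactification `f(ρₙ, uₙ)` converges to `∫ f dν` weakly-star in
`L^∞([0, ∞) × ℝ)`. -/
structure IsYoungMeasure (rho u : ℕ → ℝ → ℝ → ℝ) (ν : ℝ × ℝ → ProbabilityMeasure BarH) :
    Prop where
  weakly_measurable : ∀ f : C(BarH, ℝ),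
    AEStronglyMeasurable (fun p => ∫ z, f z ∂(ν p : Measure BarH)) (volume.restrict spaceTime)
  tendsto : ∀ f : C(BarH, ℝ), ∀ g : ℝ × ℝ → ℝ, IntegrableOn g spaceTime →
    Tendsto (fun n => ∫ p in spaceTime, f (embed (rho n p.1 p.2, u n p.1 p.2)) * g p) atTop
      (𝓝 (∫ p in spaceTime, (∫ z, f z ∂(ν p : Measure BarH)) * g p))

/-- Weak convergence `Fₙ ⇀ F` in `L¹_loc([0, ∞) × ℝ)`: all functions are integrable on the compact
subsets `K` of `[0, ∞) × ℝ`, and on each `K` there is convergence against all `g` in `L^∞(K)`. -/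
structure TendstoWeaklyL1Loc (F : ℕ → ℝ × ℝ → ℝ) (F₀ : ℝ × ℝ → ℝ) : Prop where
  integrable : ∀ n, ∀ K ⊆ spaceTime, IsCompact K → IntegrableOn (F n) K
  integrable_limit : ∀ K ⊆ spaceTime, IsCompact K → IntegrableOn F₀ K
  tendsto : ∀ K ⊆ spaceTime, IsCompact K → ∀ g : ℝ × ℝ → ℝ, MemLp g ∞ (volume.restrict K) →
    Tendsto (fun n => ∫ p in K, F n p * g p) atTop (𝓝 (∫ p in K, F₀ p * g p))

/-- The test functions: continuous on `{ρ ≥ 0}`, zero on `{ρ = 0}`, supported in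
`{ρ^θ + u ≥ -c, u - ρ^θ ≤ c}`, and of growth `|φ| ≤ ρ^(β (γ + 1))`, `β ∈ (0, 1)`, for large `ρ`. -/
structure IsTestFunction (γ : ℝ) (φ : ℝ × ℝ → ℝ) : Prop where
  continuousOn : ContinuousOn φ closedHalfPlane
  zero_boundary : ∀ u, φ (0, u) = 0
  support : ∃ c : ℝ, 0 < c ∧ ∀ q ∈ closedHalfPlane, φ q ≠ 0 →
    -c ≤ q.1 ^ theta γ + q.2 ∧ q.2 - q.1 ^ theta γ ≤ c
  growth : ∃ β ∈ Ioo (0 : ℝ) 1, ∃ R : ℝ, ∀ q ∈ closedHalfPlane, R ≤ q.1 →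
    |φ q| ≤ q.1 ^ (β * (γ + 1))

end IsentropicLimit

end

open IsentropicLimit

/-! The heart of the matter is a bound for ρ^(γ+1) + ρ|u|³ in L¹ of every compact set, uniform in
the viscosity; the three assertions on the Young measure then follow by truncation. The bound rests
on three identities for the Navier-Stokes flow.

Energy. Put z = ερ_x/ρ². By the equation of mass, z_t + u z_x = -εu_xx/ρ, so that u + z is
transported without viscosity. Adding the relative energies of u - ū and of u - ū + z gives one
balance whose dissipation is εu_x² + θ²ερ^(γ-3)ρ_x² (`exists_energyBounds`). Nothing is known a
priori about integrability on the line. The balance is therefore localized by a cutoff whose fronts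
retreat faster than the fluid moves, which gives the convective terms a sign. The other flux terms
are small near the end states, and the slope O(1/R) of the cutoff compensates the length O(R) of the
strip, so the constants depend neither on R nor on the non-uniform bound of the velocity that fixes
the speed of the fronts.

Density. Multiplying the equation of mass by the localized momentum potential ∫ρuζ cancels the terms
ρ²u² and leaves ρp(ρ) = κρ^(γ+1) (`exists_density_bound`).

Velocity. The entropy generated by ψ(s) = s√(1+s²) has a flux that dominates ρ|u|³ up to moments
bounded by the energy, while ψ'' is bounded, so that the viscous production stays below the
dissipation. The balance is multiplied by a weight whose slope is minus a tent on the region of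
interest and which extends far to the left. The entropy is therefore taken relative to the left end
state, which makes it comparable to the relative energy. One term contains εu² without a factor ρ.
It is controlled because every long interval contains a point where density and velocity are under
control, from which u is recovered by integrating u_x (`exists_velocity_bound`,
`exists_velocity_moment_bound`).

Limit. Truncations of the moment are continuous on the compactification, so weak-star convergence
and monotone convergence transfer the bound to ν, which is (i). A test function as in (ii) is
approximated by its truncations with an error δ(1 + moment), uniformly in the sequence
(`IsTestFunction.exists_cutoff`); its support keeps u bounded where ρ is bounded, and its growth is
strictly below ρ^(γ+1). For (iii), a point at infinity off the vacuum is approached only with ρ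
comparable to |(ρ,u)|, hence with ρ → ∞, where the bounded moment leaves no mass
(`exists_far_function`). -/

noncomputable section

namespace IsentropicLimit

/-! ## Partial derivatives on the closed half space -/

/-- The partial derivative in time of a function on `spaceTime`. -/
def partialT (f : ℝ × ℝ → ℝ) (p : ℝ × ℝ) : ℝ := fderivWithin ℝ f spaceTime p (1, 0)

/-- The partial derivative in space of a function on `spaceTime`. -/
def partialX (f : ℝ × ℝ → ℝ) (p : ℝ × ℝ) : ℝ := fderivWithin ℝ f spaceTime p (0, 1)

theorem uniqueDiffOn_spaceTime : UniqueDiffOn ℝ spaceTime :=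
  (uniqueDiffOn_Ici 0).prod uniqueDiffOn_univ

theorem spaceTime_mem_nhds {t x : ℝ} (ht : 0 < t) : spaceTime ∈ 𝓝 (t, x) :=
  prod_mem_nhds (Ici_mem_nhds ht) univ_mem

theorem mem_spaceTime {t x : ℝ} (ht : 0 ≤ t) : (t, x) ∈ spaceTime := ⟨ht, mem_univ _⟩

section Partials

variable {f : ℝ × ℝ → ℝ} (hf : ContDiffOn ℝ ∞ f spaceTime)
include hf

theorem contDiffOn_partialX : ContDiffOn ℝ ∞ (partialX f) spaceTime :=
  (hf.fderivWithin (m := ∞) uniqueDiffOn_spaceTime (by simp)).clm_apply contDiffOn_const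

theorem contDiffOn_partialT : ContDiffOn ℝ ∞ (partialT f) spaceTime :=
  (hf.fderivWithin (m := ∞) uniqueDiffOn_spaceTime (by simp)).clm_apply contDiffOn_const

/-- Horizontal lines stay inside the closed half space, so the space derivative is two-sided even at
t = 0. Time derivatives are two-sided only for t > 0. -/
theorem hasDerivAt_partialX {t : ℝ} (ht : 0 ≤ t) (x : ℝ) :
    HasDerivAt (fun y => f (t, y)) (partialX f (t, x)) x := by
  have h := ((hf.differentiableOn (by simp)) (t, x) (mem_spaceTime ht)).hasFDerivWithinAt
  have hl : HasDerivAt (fun y : ℝ => ((t, y) : ℝ × ℝ)) (0, 1) x :=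
    (hasDerivAt_const x t).prodMk (hasDerivAt_id x)
  have := h.comp_hasDerivWithinAt (s := univ) x hl.hasDerivWithinAt
    (fun y _ => mem_spaceTime ht)
  exact hasDerivWithinAt_univ.1 this

theorem hasDerivAt_partialT {t : ℝ} (ht : 0 < t) (x : ℝ) :
    HasDerivAt (fun τ => f (τ, x)) (partialT f (t, x)) t := by
  have h := (((hf.differentiableOn (by simp)) (t, x)
    (mem_spaceTime ht.le)).hasFDerivWithinAt).hasFDerivAt (spaceTime_mem_nhds ht)
  have hl : HasDerivAt (fun y : ℝ => ((y, x) : ℝ × ℝ)) (1, 0) t :=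
    (hasDerivAt_id t).prodMk (hasDerivAt_const t x)
  exact h.comp_hasDerivAt t hl

/-- Symmetry of the second derivative at interior points. It turns the x-derivative of the equation
of mass into an evolution equation for ρ_x, on which the gradient estimate depends. -/
theorem partialT_partialX {t : ℝ} (ht : 0 < t) (x : ℝ) :
    partialT (partialX f) (t, x) = partialX (partialT f) (t, x) := by
  have hm : (t, x) ∈ spaceTime := mem_spaceTime ht.le
  have hd : DifferentiableWithinAt ℝ (fderivWithin ℝ f spaceTime) spaceTime (t, x) :=
    (hf.fderivWithin (m := ∞) uniqueDiffOn_spaceTime (by simp)).differentiableOn (by simp) _ hm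
  have hs := uniqueDiffOn_spaceTime (t, x) hm
  have hsymm : IsSymmSndFDerivWithinAt ℝ f spaceTime (t, x) := by
    refine (hf (t, x) hm).isSymmSndFDerivWithinAt ?_ uniqueDiffOn_spaceTime ?_ hm
    · simp only [minSmoothness_of_isRCLikeNormedField]
      exact WithTop.coe_le_coe.2 (le_top : (2 : ℕ∞) ≤ ⊤)
    · exact subset_closure (mem_interior_iff_mem_nhds.2 (spaceTime_mem_nhds ht))
  have key : ∀ v w : ℝ × ℝ, fderivWithin ℝ (fun p => fderivWithin ℝ f spaceTime p v) spaceTime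
      (t, x) w = fderivWithin ℝ (fderivWithin ℝ f spaceTime) spaceTime (t, x) w v := by
    intro v w
    rw [fderivWithin_clm_apply hs hd (differentiableWithinAt_const v)]
    simp
  change fderivWithin ℝ (fun p => fderivWithin ℝ f spaceTime p (0, 1)) spaceTime (t, x) (1, 0)
    = fderivWithin ℝ (fun p => fderivWithin ℝ f spaceTime p (1, 0)) spaceTime (t, x) (0, 1)
  rw [key, key]
  exact hsymm.eq _ _

omit hf in
-- Freezing the time at 0 for t < 0 gives a function continuous on the whole plane, so that no later
-- integral has to respect the boundary t = 0. The equations themselves are used only for t > 0.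
theorem continuous_freeze (hf : ContinuousOn f spaceTime) :
    Continuous fun p : ℝ × ℝ => f (max p.1 0, p.2) :=
  hf.comp_continuous (by fun_prop) fun p => mem_spaceTime (le_max_right _ _)

end Partials

/-! ## Flows -/

/-- A solution of the Navier-Stokes equations in nonconservative form, together with its space
derivatives. All functions are defined for all times (they are frozen for negative times). -/
structure Flow (γ ε : ℝ) (r u rx ux rxx uxx : ℝ → ℝ → ℝ) : Prop where
  cont_r : Continuous fun p : ℝ × ℝ => r p.1 p.2
  cont_u : Continuous fun p : ℝ × ℝ => u p.1 p.2
  cont_rx : Continuous fun p : ℝ × ℝ => rx p.1 p.2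
  cont_ux : Continuous fun p : ℝ × ℝ => ux p.1 p.2
  cont_rxx : Continuous fun p : ℝ × ℝ => rxx p.1 p.2
  cont_uxx : Continuous fun p : ℝ × ℝ => uxx p.1 p.2
  pos : ∀ t x, 0 < r t x
  hrx : ∀ t x, HasDerivAt (fun y => r t y) (rx t x) x
  hux : ∀ t x, HasDerivAt (fun y => u t y) (ux t x) x
  hrxx : ∀ t x, HasDerivAt (fun y => rx t y) (rxx t x) x
  huxx : ∀ t x, HasDerivAt (fun y => ux t y) (uxx t x) x
  hrt : ∀ t x, 0 < t → HasDerivAt (fun τ => r τ x) (-(rx t x * u t x + r t x * ux t x)) t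
  hut : ∀ t x, 0 < t → HasDerivAt (fun τ => u τ x)
    (ε * uxx t x / r t x - u t x * ux t x - theta γ ^ 2 * r t x ^ (γ - 2) * rx t x) t
  hrxt : ∀ t x, 0 < t → HasDerivAt (fun τ => rx τ x)
    (-(rxx t x * u t x + 2 * rx t x * ux t x + r t x * uxx t x)) t

/-- The normalization of κ makes p'(ρ) = θ²ρ^(2θ), so that the sound speed is θρ^θ. -/
theorem kappa_mul {γ : ℝ} (hγ : 1 < γ) : kappa γ * γ = theta γ ^ 2 := by
  unfold kappa theta; field_simp; ring

theorem kappa_pos {γ : ℝ} (hγ : 1 < γ) : 0 < kappa γ := by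
  have : 0 < γ - 1 := by linarith
  unfold kappa; positivity

theorem theta_pos {γ : ℝ} (hγ : 1 < γ) : 0 < theta γ := by unfold theta; linarith

theorem hasDerivAt_pressure {γ : ℝ} (hγ : 1 < γ) {f : ℝ → ℝ} {f' x : ℝ}
    (hf : HasDerivAt f f' x) :
    HasDerivAt (fun y => pressure γ (f y)) (theta γ ^ 2 * f x ^ (γ - 1) * f') x := by
  have h := (hf.rpow_const (p := γ) (Or.inr hγ.le)).const_mul (kappa γ)
  refine h.congr_deriv ?_
  rw [← kappa_mul hγ]; ring

/-- The frozen extension of a function on the closed half space. -/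
def freeze (f : ℝ × ℝ → ℝ) (t x : ℝ) : ℝ := f (max t 0, x)

theorem freeze_of_nonneg (f : ℝ × ℝ → ℝ) {t : ℝ} (ht : 0 ≤ t) (x : ℝ) :
    freeze f t x = f (t, x) := by simp [freeze, max_eq_left ht]

/-- Since ρ > 0, the equation of mass and division by ρ turn the momentum equation into one for u;
differentiating the equation of mass in x gives the one for ρ_x. -/
theorem IsNSSolution.flow {γ ε : ℝ} (hγ : 1 < γ) {s : EndStates} {rho0 u0 : ℝ → ℝ}
    {rho u : ℝ → ℝ → ℝ} (h : IsNSSolution γ ε s rho0 u0 rho u) :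
    ∃ r v rx ux rxx uxx : ℝ → ℝ → ℝ, Flow γ ε r v rx ux rxx uxx ∧
      (∀ t x, 0 ≤ t → r t x = rho t x) ∧ (∀ t x, 0 ≤ t → v t x = u t x) := by
  set R : ℝ × ℝ → ℝ := fun p => rho p.1 p.2 with hR
  set U : ℝ × ℝ → ℝ := fun p => u p.1 p.2 with hU
  have sR : ContDiffOn ℝ ∞ R spaceTime := h.smooth_rho
  have sU : ContDiffOn ℝ ∞ U spaceTime := h.smooth_u
  have sRx := contDiffOn_partialX sR
  have sUx := contDiffOn_partialX sU
  have sRxx := contDiffOn_partialX sRx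
  have sUxx := contDiffOn_partialX sUx
  have hpos : ∀ t x, 0 ≤ t → 0 < R (t, x) := by
    obtain ⟨c, hc⟩ := h.lower_bound
    exact fun t x ht => (hc t ht).1.trans_le ((hc t ht).2 x)
  have hfx : ∀ {f : ℝ × ℝ → ℝ}, ContDiffOn ℝ ∞ f spaceTime → ∀ t x,
      HasDerivAt (fun y => freeze f t y) (freeze (partialX f) t x) x :=
    fun hf t x => hasDerivAt_partialX hf (le_max_right _ _) x
  have hft : ∀ {f : ℝ × ℝ → ℝ}, ContDiffOn ℝ ∞ f spaceTime → ∀ t x, 0 < t →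
      HasDerivAt (fun τ => freeze f τ x) (partialT f (t, x)) t := by
    intro f hf t x ht
    refine (hasDerivAt_partialT hf ht x).congr_of_eventuallyEq ?_
    filter_upwards [Ioi_mem_nhds ht] with τ hτ
    exact freeze_of_nonneg f (le_of_lt hτ) x
  -- the equations
  have mass : ∀ t x, 0 < t → partialT R (t, x)
      = -(partialX R (t, x) * U (t, x) + R (t, x) * partialX U (t, x)) := by
    intro t x ht
    have h1 := h.mass t x ht
    have e1 := (hasDerivAt_partialT sR ht x).deriv
    have e2 := ((hasDerivAt_partialX sR ht.le x).fun_mul (hasDerivAt_partialX sU ht.le x)).deriv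
    simp only [hR, hU] at e1 e2 ⊢
    rw [e1, e2] at h1
    linarith
  have mom : ∀ t x, 0 < t → partialT U (t, x) = ε * partialX (partialX U) (t, x) / R (t, x)
      - U (t, x) * partialX U (t, x)
      - theta γ ^ 2 * R (t, x) ^ (γ - 2) * partialX R (t, x) := by
    intro t x ht
    have h1 := h.momentum t x ht
    have e1 := ((hasDerivAt_partialT sR ht x).fun_mul (hasDerivAt_partialT sU ht x)).deriv
    have dR := hasDerivAt_partialX sR ht.le x
    have dU := hasDerivAt_partialX sU ht.le x
    have e2 := ((dR.fun_mul (dU.fun_pow 2)).fun_add (hasDerivAt_pressure hγ dR)).deriv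
    have e3 : (deriv fun y => u t y) = fun y => partialX U (t, y) :=
      funext fun y => (hasDerivAt_partialX sU ht.le y).deriv
    have e4 := (hasDerivAt_partialX sUx ht.le x).deriv
    have hp := hpos t x ht.le
    have hm := mass t x ht
    have hrp : R (t, x) ^ (γ - 1) = R (t, x) ^ (γ - 2) * R (t, x) := by
      rw [← Real.rpow_add_one hp.ne']; congr 1; ring
    rw [e3, e4] at h1
    rw [hrp] at e2
    simp only [hR, hU] at e1 e2 hm hp ⊢
    rw [e1, e2, hm] at h1
    field_simp
    push_cast at h1
    linarith
  have mixed : ∀ t x, 0 < t → partialT (partialX R) (t, x)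
      = -(partialX (partialX R) (t, x) * U (t, x) + 2 * partialX R (t, x) * partialX U (t, x)
        + R (t, x) * partialX (partialX U) (t, x)) := by
    intro t x ht
    rw [partialT_partialX sR ht]
    have d1 := hasDerivAt_partialX (contDiffOn_partialT sR) ht.le x
    have d2 := (((hasDerivAt_partialX sRx ht.le x).fun_mul (hasDerivAt_partialX sU ht.le x)).fun_add
      ((hasDerivAt_partialX sR ht.le x).fun_mul (hasDerivAt_partialX sUx ht.le x))).fun_neg
    have e : (fun y => partialT R (t, y)) = fun y =>
        -(partialX R (t, y) * U (t, y) + R (t, y) * partialX U (t, y)) :=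
      funext fun y => mass t y ht
    rw [e] at d1
    rw [d1.unique d2]
    ring
  refine ⟨freeze R, freeze U, freeze (partialX R), freeze (partialX U),
    freeze (partialX (partialX R)), freeze (partialX (partialX U)), ?_,
    fun t x ht => freeze_of_nonneg R ht x, fun t x ht => freeze_of_nonneg U ht x⟩
  exact
    { cont_r := continuous_freeze sR.continuousOn
      cont_u := continuous_freeze sU.continuousOn
      cont_rx := continuous_freeze sRx.continuousOn
      cont_ux := continuous_freeze sUx.continuousOn
      cont_rxx := continuous_freeze sRxx.continuousOn
      cont_uxx := continuous_freeze sUxx.continuousOn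
      pos := fun t x => hpos _ x (le_max_right _ _)
      hrx := hfx sR
      hux := hfx sU
      hrxx := hfx sRx
      huxx := hfx sUx
      hrt := fun t x ht => (hft sR t x ht).congr_deriv (by
        simp only [freeze_of_nonneg _ ht.le]; exact mass t x ht)
      hut := fun t x ht => (hft sU t x ht).congr_deriv (by
        simp only [freeze_of_nonneg _ ht.le]; exact mom t x ht)
      hrxt := fun t x ht => (hft sRx t x ht).congr_deriv (by
        simp only [freeze_of_nonneg _ ht.le]; exact mixed t x ht) }

/-! ## Integration over strips -/

theorem hasDerivAt_intervalIntegral_of_continuous {F F' : ℝ → ℝ → ℝ} {a b t : ℝ} {s : Set ℝ}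
    (hs : s ∈ 𝓝 t) (hF : Continuous fun p : ℝ × ℝ => F p.1 p.2)
    (hF' : Continuous fun p : ℝ × ℝ => F' p.1 p.2)
    (hd : ∀ τ ∈ s, ∀ y, HasDerivAt (fun τ => F τ y) (F' τ y) τ) :
    HasDerivAt (fun τ => ∫ y in a..b, F τ y) (∫ y in a..b, F' t y) t := by
  obtain ⟨δ, hδ, hsub⟩ := Metric.nhds_basis_closedBall.mem_iff.1 hs
  obtain ⟨C, hC⟩ := ((isCompact_closedBall t δ).prod (isCompact_uIcc (a := a) (b := b))).bddAbove_image
    (f := fun p : ℝ × ℝ => ‖F' p.1 p.2‖) hF'.norm.continuousOn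
  refine (intervalIntegral.hasDerivAt_integral_of_dominated_loc_of_deriv_le
    (F := F) (F' := F') (bound := fun _ => C) (Metric.closedBall_mem_nhds t hδ) ?_ ?_ ?_ ?_ ?_ ?_).2
  · exact Eventually.of_forall fun τ => (by fun_prop : Continuous (F τ)).aestronglyMeasurable
  · exact (by fun_prop : Continuous (F t)).intervalIntegrable _ _
  · exact (by fun_prop : Continuous (F' t)).aestronglyMeasurable
  · exact Eventually.of_forall fun y hy τ hτ =>
      hC (mem_image_of_mem (fun p : ℝ × ℝ => ‖F' p.1 p.2‖) (mk_mem_prod hτ (uIoc_subset_uIcc hy)))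
  · exact intervalIntegrable_const
  · exact Eventually.of_forall fun y _ τ hτ => hd τ (hsub hτ) y

theorem continuous_integral_strip {F : ℝ → ℝ → ℝ} (hF : Continuous fun p : ℝ × ℝ => F p.1 p.2)
    (a b : ℝ) : Continuous fun t => ∫ x in a..b, F t x :=
  intervalIntegral.continuous_parametric_intervalIntegral_of_continuous' hF a b

/-- The integrated form of the differential inequality `P_t + Q_x ≤ S` on a strip, for a flux that
vanishes on its sides. -/
theorem integral_le_of_conservation {P Q Pt Qx S : ℝ → ℝ → ℝ} {T M : ℝ} (hT : 0 ≤ T) (hM : 0 ≤ M)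
    (cP : Continuous fun p : ℝ × ℝ => P p.1 p.2)
    (cPt : Continuous fun p : ℝ × ℝ => Pt p.1 p.2)
    (cQx : Continuous fun p : ℝ × ℝ => Qx p.1 p.2)
    (cS : Continuous fun p : ℝ × ℝ => S p.1 p.2)
    (hP : ∀ t x, 0 < t → HasDerivAt (fun τ => P τ x) (Pt t x) t)
    (hQ : ∀ t x, HasDerivAt (fun y => Q t y) (Qx t x) x)
    (hQl : ∀ t ∈ Icc 0 T, Q t (-M) = 0) (hQr : ∀ t ∈ Icc 0 T, Q t M = 0)
    (hle : ∀ t ∈ Icc 0 T, ∀ x ∈ Icc (-M) M, Pt t x + Qx t x ≤ S t x) :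
    ∫ x in -M..M, P T x ≤ (∫ x in -M..M, P 0 x) + ∫ t in 0..T, ∫ x in -M..M, S t x := by
  have hd : ∀ t ∈ Ioo 0 T, HasDerivAt (fun τ => ∫ x in -M..M, P τ x) (∫ x in -M..M, Pt t x) t :=
    fun t ht => hasDerivAt_intervalIntegral_of_continuous (Ioi_mem_nhds ht.1) cP cPt
      fun τ hτ y => hP τ y hτ
  have h1 := intervalIntegral.integral_eq_sub_of_hasDerivAt_of_le hT
    (continuous_integral_strip cP (-M) M).continuousOn hd
    ((continuous_integral_strip cPt (-M) M).intervalIntegrable _ _)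
  have h2 : ∀ t ∈ Icc 0 T, ∫ x in -M..M, Qx t x = 0 := by
    intro t ht
    rw [intervalIntegral.integral_eq_sub_of_hasDerivAt (f := fun y => Q t y)
      (fun x _ => hQ t x) ((by fun_prop : Continuous (Qx t)).intervalIntegrable _ _), hQl t ht,
      hQr t ht, sub_zero]
  have h3 : ∫ t in 0..T, ∫ x in -M..M, Pt t x ≤ ∫ t in 0..T, ∫ x in -M..M, S t x := by
    refine intervalIntegral.integral_mono_on hT
      ((continuous_integral_strip cPt (-M) M).intervalIntegrable _ _)
      ((continuous_integral_strip cS (-M) M).intervalIntegrable _ _) fun t ht => ?_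
    have i1 : IntervalIntegrable (Pt t) volume (-M) M :=
      (by fun_prop : Continuous (Pt t)).intervalIntegrable _ _
    have i2 : IntervalIntegrable (Qx t) volume (-M) M :=
      (by fun_prop : Continuous (Qx t)).intervalIntegrable _ _
    calc ∫ x in -M..M, Pt t x = ∫ x in -M..M, (Pt t x + Qx t x) := by
          rw [intervalIntegral.integral_add i1 i2, h2 t ht, add_zero]
      _ ≤ ∫ x in -M..M, S t x := intervalIntegral.integral_mono_on (by linarith) (i1.add i2)
          ((by fun_prop : Continuous (S t)).intervalIntegrable _ _) (hle t ht)
  linarith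

/-! ## The relative internal energy -/

theorem gamma_eq (γ : ℝ) : γ = 2 * theta γ + 1 := by unfold theta; ring

theorem rpow_gamma_sub_one {γ r : ℝ} (hr : 0 < r) : r ^ (γ - 1) = (r ^ theta γ) ^ 2 := by
  rw [← Real.rpow_natCast, ← Real.rpow_mul hr.le]; congr 1; unfold theta; push_cast; ring

theorem rpow_gamma {γ r : ℝ} (hr : 0 < r) : r ^ γ = r * (r ^ theta γ) ^ 2 := by
  rw [← rpow_gamma_sub_one hr, mul_comm, ← Real.rpow_add_one hr.ne']; congr 1; ring

theorem hasDerivAt_internalEnergy {γ : ℝ} (hγ : 1 < γ) {f : ℝ → ℝ} {f' x : ℝ}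
    (hf : HasDerivAt f f' x) :
    HasDerivAt (fun y => internalEnergy γ (f y)) (theta γ / 2 * f x ^ (γ - 1) * f') x := by
  have h := (hf.rpow_const (p := γ) (Or.inr hγ.le)).const_mul (kappa γ / (γ - 1))
  refine h.congr_deriv ?_
  have h1 := kappa_mul hγ
  have h2 : γ - 1 = 2 * theta γ := by unfold theta; ring
  have h3 := (theta_pos hγ).ne'
  have h4 : kappa γ / (γ - 1) * γ = theta γ / 2 := by
    rw [h2, div_mul_eq_mul_div, h1]; field_simp
  rw [← h4]; ring

theorem deriv_internalEnergy {γ : ℝ} (hγ : 1 < γ) (r : ℝ) :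
    deriv (internalEnergy γ) r = theta γ / 2 * r ^ (γ - 1) := by
  simpa using (hasDerivAt_internalEnergy hγ (hasDerivAt_id r)).deriv

theorem hasDerivAt_relativeEnergy {γ : ℝ} (hγ : 1 < γ) {f : ℝ → ℝ} {f' x b : ℝ}
    (hf : HasDerivAt f f' x) :
    HasDerivAt (fun y => relativeEnergy γ (f y) b)
      (theta γ / 2 * (f x ^ (γ - 1) - b ^ (γ - 1)) * f') x := by
  unfold relativeEnergy
  refine (((hasDerivAt_internalEnergy hγ hf).sub_const _).sub
    ((hf.sub_const b).const_mul _)).congr_deriv ?_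
  rw [deriv_internalEnergy hγ]; ring

theorem relativeEnergy_eq {γ : ℝ} (hγ : 1 < γ) {r b : ℝ} :
    relativeEnergy γ r b = kappa γ / (γ - 1) * (r ^ γ - b ^ γ - γ * b ^ (γ - 1) * (r - b)) := by
  unfold relativeEnergy internalEnergy
  have h1 := kappa_mul hγ
  have h2 : γ - 1 = 2 * theta γ := by unfold theta; ring
  have h3 := (theta_pos hγ).ne'
  have h4 : kappa γ / (γ - 1) * γ = theta γ / 2 := by
    rw [h2, div_mul_eq_mul_div, h1]; field_simp
  have := deriv_internalEnergy hγ b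
  unfold internalEnergy at this
  rw [this, ← h4]; ring

/-- With x = r^θ and y = b^θ, the bracket in the relative energy exceeds r(x - y)² by 2y times the
convexity defect of r^(θ+1) at b, and this defect is nonnegative by Bernoulli's inequality. -/
theorem le_relativeEnergy {γ : ℝ} (hγ : 1 < γ) {r b : ℝ} (hr : 0 < r) (hb : 0 < b) :
    kappa γ / (γ - 1) * (r * (r ^ theta γ - b ^ theta γ) ^ 2) ≤ relativeEnergy γ r b := by
  have hθ := theta_pos hγ
  rw [relativeEnergy_eq hγ]
  refine mul_le_mul_of_nonneg_left ?_ (div_nonneg (kappa_pos hγ).le (by linarith))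
  have h1 := one_add_mul_self_le_rpow_one_add (s := r / b - 1) (by
    have : 0 < r / b := by positivity
    linarith) (p := theta γ + 1) (by linarith)
  rw [add_sub_cancel, Real.div_rpow hr.le hb.le, Real.rpow_add_one hr.ne',
    Real.rpow_add_one hb.ne'] at h1
  rw [rpow_gamma (γ := γ) hr, rpow_gamma (γ := γ) hb, rpow_gamma_sub_one (γ := γ) hb]
  set x := r ^ theta γ
  set y := b ^ theta γ
  have hy : 0 < y := Real.rpow_pos_of_pos hb _
  rw [le_div_iff₀ (by positivity)] at h1
  have h2 : (1 + (theta γ + 1) * (r / b - 1)) * (y * b) = y * (b + (theta γ + 1) * (r - b)) := by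
    field_simp
  rw [h2] at h1
  have hg := gamma_eq γ
  have h3 := mul_le_mul_of_nonneg_left h1 hy.le
  have h4 : r * x ^ 2 - b * y ^ 2 - γ * y ^ 2 * (r - b) - r * (x - y) ^ 2
      = 2 * (y * (x * r) - y * (y * (b + (theta γ + 1) * (r - b)))) := by
    rw [show γ * y ^ 2 * (r - b) = (2 * theta γ + 1) * y ^ 2 * (r - b) by rw [← hg]]
    ring
  linarith

theorem relativeEnergy_nonneg {γ : ℝ} (hγ : 1 < γ) {r b : ℝ} (hr : 0 < r) (hb : 0 < b) :
    0 ≤ relativeEnergy γ r b :=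
  (mul_nonneg (div_nonneg (kappa_pos hγ).le (by linarith)) (by positivity)).trans
    (le_relativeEnergy hγ hr hb)

/-- Near the vacuum the relative energy is bounded below. -/
theorem relativeEnergy_lower {γ : ℝ} (hγ : 1 < γ) {r b : ℝ} (hr : 0 < r) (hb : 0 < b)
    (h : r ≤ b * ((γ - 1) / (2 * γ))) : kappa γ / 2 * b ^ γ ≤ relativeEnergy γ r b := by
  have h0 : 0 < γ - 1 := by linarith
  have hγ0 : 0 < γ := by linarith
  rw [relativeEnergy_eq hγ]
  have hbb : b ^ γ = b ^ (γ - 1) * b := by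
    rw [← Real.rpow_add_one hb.ne']; congr 1; ring
  have hr1 : 0 < r ^ γ := Real.rpow_pos_of_pos hr _
  have hb1 : 0 < b ^ (γ - 1) := Real.rpow_pos_of_pos hb _
  have h1 : γ * r ≤ b * (γ - 1) / 2 := by
    calc γ * r ≤ γ * (b * ((γ - 1) / (2 * γ))) := by gcongr
      _ = b * (γ - 1) / 2 := by field_simp
  -- At r = 0 the right side equals (γ-1)b^γ; the assumed smallness of r lets the linear term
  -- consume at most half of it.
  have h2 : b ^ γ * ((γ - 1) / 2) ≤ r ^ γ - b ^ γ - γ * b ^ (γ - 1) * (r - b) := by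
    rw [hbb]
    nlinarith [mul_le_mul_of_nonneg_left h1 hb1.le]
  calc kappa γ / 2 * b ^ γ = kappa γ / (γ - 1) * (b ^ γ * ((γ - 1) / 2)) := by field_simp
    _ ≤ _ := mul_le_mul_of_nonneg_left h2 (div_nonneg (kappa_pos hγ).le h0.le)

/-- The relative energy controls the pressure, uniformly for reference densities in a compact
subset of `(0, ∞)`. -/
theorem exists_rpow_le_relativeEnergy {γ : ℝ} (hγ : 1 < γ) (B : ℝ) :
    ∃ C : ℝ, 0 < C ∧ ∀ r b, 0 < r → 0 < b → b ≤ B →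
      r ^ γ ≤ C * (1 + relativeEnergy γ r b) := by
  have hθ := theta_pos hγ
  have h0 : 0 < γ - 1 := by linarith
  have hκ := kappa_pos hγ
  obtain ⟨N, hN⟩ : ∃ N : ℝ, N = (2 * |B| ^ theta γ) ^ (γ / theta γ) := ⟨_, rfl⟩
  have hN0 : 0 ≤ N := hN ▸ by positivity
  refine ⟨4 * ((γ - 1) / kappa γ) + N, by positivity, fun r b hr hb hbB => ?_⟩
  have hE := relativeEnergy_nonneg hγ hr hb
  have hle := le_relativeEnergy hγ hr hb
  have hx : 0 < r ^ theta γ := Real.rpow_pos_of_pos hr _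
  have hy : 0 < b ^ theta γ := Real.rpow_pos_of_pos hb _
  -- Far from b the distance of r^θ to b^θ is at least half of r^θ, so the relative energy dominates
  -- r^γ. Otherwise r^γ is at most the constant N.
  by_cases h : 2 * b ^ theta γ ≤ r ^ theta γ
  · have h1 : r ^ γ ≤ 4 * (r * (r ^ theta γ - b ^ theta γ) ^ 2) := by
      rw [rpow_gamma hr]
      have : (r ^ theta γ) ^ 2 ≤ 4 * (r ^ theta γ - b ^ theta γ) ^ 2 := by nlinarith
      nlinarith
    have h2 : r * (r ^ theta γ - b ^ theta γ) ^ 2 ≤ (γ - 1) / kappa γ * relativeEnergy γ r b := by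
      calc r * (r ^ theta γ - b ^ theta γ) ^ 2
          = (γ - 1) / kappa γ * (kappa γ / (γ - 1) * (r * (r ^ theta γ - b ^ theta γ) ^ 2)) := by
            field_simp
        _ ≤ _ := by gcongr
    have h3 : 0 ≤ (γ - 1) / kappa γ := by positivity
    nlinarith [mul_nonneg hN0 hE]
  · have h1 : r ^ theta γ ≤ 2 * |B| ^ theta γ := by
      refine (not_le.1 h).le.trans ?_
      have : b ^ theta γ ≤ |B| ^ theta γ :=
        Real.rpow_le_rpow hb.le (hbB.trans (le_abs_self B)) hθ.le
      linarith
    have h2 : r ^ γ ≤ N := by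
      have := Real.rpow_le_rpow hx.le h1 (by positivity : 0 ≤ γ / theta γ)
      rwa [← Real.rpow_mul hr.le, mul_div_cancel₀ _ hθ.ne', ← hN] at this
    have h3 : 0 ≤ (γ - 1) / kappa γ := by positivity
    nlinarith [mul_nonneg hN0 hE, mul_nonneg h3 hE]

theorem le_one_add_rpow {γ r : ℝ} (hγ : 1 ≤ γ) (hr : 0 ≤ r) : r ≤ 1 + r ^ γ := by
  have h0 := Real.rpow_nonneg hr γ
  rcases le_total r 1 with h | h
  · linarith
  · have := Real.rpow_le_rpow_of_exponent_le h hγ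
    rw [Real.rpow_one] at this
    linarith

/-! ## Reference profiles -/

theorem deriv_eq_zero_of_eq_const {f : ℝ → ℝ} {c x : ℝ} (h : f =ᶠ[𝓝 x] fun _ => c) :
    deriv f x = 0 := by rw [h.deriv_eq, deriv_const]

/-- A function that is continuous and constant near both ends is bounded. -/
theorem exists_bound_of_eq_ends {f : ℝ → ℝ} (hf : Continuous f) {L a b : ℝ}
    (hr : ∀ x, L ≤ x → f x = a) (hl : ∀ x, x ≤ -L → f x = b) : ∃ B, ∀ x, |f x| ≤ B := by
  obtain ⟨C, hC⟩ := (isCompact_Icc (a := -L) (b := L)).exists_bound_of_continuousOn hf.continuousOn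
  refine ⟨max C (max |a| |b|), fun x => ?_⟩
  by_cases h1 : L ≤ x
  · rw [hr x h1]; exact (le_max_left _ _).trans (le_max_right _ _)
  by_cases h2 : x ≤ -L
  · rw [hl x h2]; exact (le_max_right _ _).trans (le_max_right _ _)
  · exact (hC x ⟨(not_le.1 h2).le, (not_le.1 h1).le⟩).trans (le_max_left _ _)

/-- The quantitative content of `IsReferenceProfile`. -/
structure ProfileBounds (s : EndStates) (rb ub rbx ubx : ℝ → ℝ) (m B L : ℝ) : Prop where
  hm : 0 < m
  hB : 0 < B
  hL : 0 < L
  cont_rbx : Continuous rbx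
  cont_ubx : Continuous ubx
  hrb : ∀ x, HasDerivAt rb (rbx x) x
  hub : ∀ x, HasDerivAt ub (ubx x) x
  rb_lower : ∀ x, m ≤ rb x
  rb_upper : ∀ x, rb x ≤ B
  ub_le : ∀ x, |ub x| ≤ B
  rbx_le : ∀ x, |rbx x| ≤ B
  ubx_le : ∀ x, |ubx x| ≤ B
  right : ∀ x, L ≤ x → rb x = s.rhoR ∧ ub x = s.uR ∧ rbx x = 0 ∧ ubx x = 0
  left : ∀ x, x ≤ -L → rb x = s.rhoL ∧ ub x = s.uL ∧ rbx x = 0 ∧ ubx x = 0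

theorem ProfileBounds.cont_rb {s rb ub rbx ubx m B L} (h : ProfileBounds s rb ub rbx ubx m B L) :
    Continuous rb := continuous_iff_continuousAt.2 fun x => (h.hrb x).continuousAt

theorem ProfileBounds.cont_ub {s rb ub rbx ubx m B L} (h : ProfileBounds s rb ub rbx ubx m B L) :
    Continuous ub := continuous_iff_continuousAt.2 fun x => (h.hub x).continuousAt

theorem ProfileBounds.rb_pos {s rb ub rbx ubx m B L} (h : ProfileBounds s rb ub rbx ubx m B L)
    (x : ℝ) : 0 < rb x := h.hm.trans_le (h.rb_lower x)

theorem IsReferenceProfile.bounds {s : EndStates} {rb ub : ℝ → ℝ}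
    (h : IsReferenceProfile s rb ub) (hL : 0 < s.rhoL) (hR : 0 < s.rhoR) :
    ∃ rbx ubx : ℝ → ℝ, ∃ m B L : ℝ, ProfileBounds s rb ub rbx ubx m B L := by
  obtain ⟨L, hL0, hr, hl⟩ := h.eq_ends
  -- The enlargement by 1 puts x in the interior of the region where the profile is constant.
  have hpr : ∀ x, L + 1 ≤ x → deriv rb x = 0 ∧ deriv ub x = 0 := by
    intro x hx
    have : Ioi L ∈ 𝓝 x := Ioi_mem_nhds (by linarith)
    exact ⟨deriv_eq_zero_of_eq_const (by
      filter_upwards [this] with y hy using (hr y (le_of_lt hy)).1),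
      deriv_eq_zero_of_eq_const (by
      filter_upwards [this] with y hy using (hr y (le_of_lt hy)).2)⟩
  have hpl : ∀ x, x ≤ -(L + 1) → deriv rb x = 0 ∧ deriv ub x = 0 := by
    intro x hx
    have : Iio (-L) ∈ 𝓝 x := Iio_mem_nhds (by linarith)
    exact ⟨deriv_eq_zero_of_eq_const (by
      filter_upwards [this] with y hy using (hl y (le_of_lt hy)).1),
      deriv_eq_zero_of_eq_const (by
      filter_upwards [this] with y hy using (hl y (le_of_lt hy)).2)⟩
  have c1 : Continuous (deriv rb) := h.smooth_rho.continuous_deriv (by simp)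
  have c2 : Continuous (deriv ub) := h.smooth_u.continuous_deriv (by simp)
  obtain ⟨B1, hB1⟩ := exists_bound_of_eq_ends h.smooth_rho.continuous (fun x hx => (hr x hx).1)
    (fun x hx => (hl x hx).1)
  obtain ⟨B2, hB2⟩ := exists_bound_of_eq_ends h.smooth_u.continuous (fun x hx => (hr x hx).2)
    (fun x hx => (hl x hx).2)
  obtain ⟨B3, hB3⟩ := exists_bound_of_eq_ends c1 (fun x hx => (hpr x hx).1)
    (fun x hx => (hpl x hx).1)
  obtain ⟨B4, hB4⟩ := exists_bound_of_eq_ends c2 (fun x hx => (hpr x hx).2)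
    (fun x hx => (hpl x hx).2)
  have n1 := (abs_nonneg _).trans (hB1 0)
  have n2 := (abs_nonneg _).trans (hB2 0)
  have n3 := (abs_nonneg _).trans (hB3 0)
  have n4 := (abs_nonneg _).trans (hB4 0)
  refine ⟨deriv rb, deriv ub, min s.rhoL s.rhoR, B1 + B2 + B3 + B4 + 1, L + 1,
    { hm := lt_min hL hR
      hB := by linarith
      hL := by linarith
      cont_rbx := c1
      cont_ubx := c2
      hrb := fun x => (h.smooth_rho.differentiable (by simp) x).hasDerivAt
      hub := fun x => (h.smooth_u.differentiable (by simp) x).hasDerivAt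
      rb_lower := ?_
      rb_upper := fun x => by linarith [(le_abs_self _).trans (hB1 x)]
      ub_le := fun x => by linarith [hB2 x]
      rbx_le := fun x => by linarith [hB3 x]
      ubx_le := fun x => by linarith [hB4 x]
      right := fun x hx => ⟨(hr x (by linarith)).1, (hr x (by linarith)).2, hpr x hx⟩
      left := fun x hx => ⟨(hl x (by linarith)).1, (hl x (by linarith)).2, hpl x hx⟩ }⟩
  -- Monotonicity keeps ρ̄ between its end states, hence away from zero.
  intro x
  rcases h.monotone_rho with hm | hm
  · rw [← (hl (min x (-L)) (min_le_right _ _)).1]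
    exact (min_le_left _ _).trans (hm (min_le_left _ _))
  · rw [← (hr (max x L) (le_max_right _ _)).1]
    exact (min_le_right _ _).trans (hm (le_max_left _ _))

/-! ## Cutoff functions -/

/-- The derivative of the smooth transition function. -/
def stepDeriv (y : ℝ) : ℝ := deriv Real.smoothTransition y

theorem hasDerivAt_step (y : ℝ) : HasDerivAt Real.smoothTransition (stepDeriv y) y :=
  (Real.smoothTransition.contDiff.differentiable (n := 1) (by simp) y).hasDerivAt

theorem continuous_stepDeriv : Continuous stepDeriv :=
  Real.smoothTransition.contDiff.continuous_deriv (n := 1) le_rfl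

theorem stepDeriv_nonneg (y : ℝ) : 0 ≤ stepDeriv y := Real.smoothTransition.monotone.deriv_nonneg

/-- The value 1 attained there is a global maximum. -/
theorem stepDeriv_of_one_le {y : ℝ} (hy : 1 ≤ y) : stepDeriv y = 0 := by
  refine IsLocalMax.deriv_eq_zero (Eventually.of_forall fun z => ?_)
  rw [Real.smoothTransition.one_of_one_le hy]
  exact Real.smoothTransition.le_one z

theorem stepDeriv_of_nonpos {y : ℝ} (hy : y ≤ 0) : stepDeriv y = 0 := by
  refine IsLocalMin.deriv_eq_zero (Eventually.of_forall fun z => ?_)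
  rw [Real.smoothTransition.zero_of_nonpos hy]
  exact Real.smoothTransition.nonneg z

theorem exists_stepDeriv_le : ∃ c : ℝ, 0 < c ∧ ∀ y, stepDeriv y ≤ c := by
  obtain ⟨C, hC⟩ := (isCompact_Icc (a := (0 : ℝ)) (b := 1)).exists_bound_of_continuousOn
    continuous_stepDeriv.continuousOn
  have hC0 : 0 ≤ C := (norm_nonneg _).trans (hC 0 ⟨le_rfl, zero_le_one⟩)
  refine ⟨C + 1, by linarith, fun y => ?_⟩
  by_cases h1 : 1 ≤ y
  · rw [stepDeriv_of_one_le h1]; linarith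
  by_cases h0 : y ≤ 0
  · rw [stepDeriv_of_nonpos h0]; linarith
  · have := hC y ⟨(not_le.1 h0).le, (not_le.1 h1).le⟩
    linarith [(le_abs_self _).trans this]

/-- A cutoff between `|x| ≤ R - U t` and `|x| ≤ 2 R - U t`, which decreases along all lines of
speed at most `U`. -/
def cut (R U t x : ℝ) : ℝ :=
  Real.smoothTransition ((x + 2 * R - U * t) / R) * Real.smoothTransition ((2 * R - U * t - x) / R)

/-- The time derivative of `cut`. -/
def cutT (R U t x : ℝ) : ℝ :=
  -(U / R) * (stepDeriv ((x + 2 * R - U * t) / R)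
      * Real.smoothTransition ((2 * R - U * t - x) / R)
    + Real.smoothTransition ((x + 2 * R - U * t) / R) * stepDeriv ((2 * R - U * t - x) / R))

/-- The space derivative of `cut`. -/
def cutX (R U t x : ℝ) : ℝ :=
  1 / R * (stepDeriv ((x + 2 * R - U * t) / R)
      * Real.smoothTransition ((2 * R - U * t - x) / R)
    - Real.smoothTransition ((x + 2 * R - U * t) / R) * stepDeriv ((2 * R - U * t - x) / R))

theorem hasDerivAt_cut_t (R U t x : ℝ) : HasDerivAt (fun τ => cut R U τ x) (cutT R U t x) t := by
  have h1 : HasDerivAt (fun τ => (x + 2 * R - U * τ) / R) (-U / R) t := by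
    simpa using (((hasDerivAt_id t).const_mul U).const_sub (x + 2 * R)).div_const R
  have h2 : HasDerivAt (fun τ => (2 * R - U * τ - x) / R) (-U / R) t := by
    simpa using ((((hasDerivAt_id t).const_mul U).const_sub (2 * R)).sub_const x).div_const R
  refine (((hasDerivAt_step _).comp t h1).fun_mul ((hasDerivAt_step _).comp t h2)).congr_deriv ?_
  simp only [cutT, Function.comp]; ring

theorem hasDerivAt_cut_x (R U t x : ℝ) : HasDerivAt (fun y => cut R U t y) (cutX R U t x) x := by
  have h1 : HasDerivAt (fun y => (y + 2 * R - U * t) / R) (1 / R) x := by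
    simpa using (((hasDerivAt_id x).add_const (2 * R)).sub_const (U * t)).div_const R
  have h2 : HasDerivAt (fun y => (2 * R - U * t - y) / R) (-1 / R) x := by
    simpa using ((hasDerivAt_id x).const_sub (2 * R - U * t)).div_const R
  refine (((hasDerivAt_step _).comp x h1).fun_mul ((hasDerivAt_step _).comp x h2)).congr_deriv ?_
  simp only [cutX, Function.comp]; ring

theorem continuous_cut (R U : ℝ) : Continuous fun p : ℝ × ℝ => cut R U p.1 p.2 := by
  unfold cut
  exact (Real.smoothTransition.continuous.comp (by fun_prop)).mul
    (Real.smoothTransition.continuous.comp (by fun_prop))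

theorem continuous_cutT (R U : ℝ) : Continuous fun p : ℝ × ℝ => cutT R U p.1 p.2 := by
  have h1 := Real.smoothTransition.continuous
  have h2 := continuous_stepDeriv
  unfold cutT
  fun_prop

theorem continuous_cutX (R U : ℝ) : Continuous fun p : ℝ × ℝ => cutX R U p.1 p.2 := by
  have h1 := Real.smoothTransition.continuous
  have h2 := continuous_stepDeriv
  unfold cutX
  fun_prop

theorem cut_nonneg (R U t x : ℝ) : 0 ≤ cut R U t x :=
  mul_nonneg (Real.smoothTransition.nonneg _) (Real.smoothTransition.nonneg _)

theorem cut_le_one (R U t x : ℝ) : cut R U t x ≤ 1 :=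
  mul_le_one₀ (Real.smoothTransition.le_one _) (Real.smoothTransition.nonneg _)
    (Real.smoothTransition.le_one _)

/-- With a, b ≥ 0 the contributions of the two fronts, the expression is -((U - v)a + (U + v)b)/R.
This sign disposes of the convected energy, whose flux admits no bound by the energy itself. -/
theorem cut_transport {R U v : ℝ} (hR : 0 < R) (hv : |v| ≤ U) (t x : ℝ) :
    cutT R U t x + v * cutX R U t x ≤ 0 := by
  have h := abs_le.1 hv
  unfold cutT cutX
  set a := stepDeriv ((x + 2 * R - U * t) / R) * Real.smoothTransition ((2 * R - U * t - x) / R)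
  set b := Real.smoothTransition ((x + 2 * R - U * t) / R) * stepDeriv ((2 * R - U * t - x) / R)
  have ha : 0 ≤ a := mul_nonneg (stepDeriv_nonneg _) (Real.smoothTransition.nonneg _)
  have hb : 0 ≤ b := mul_nonneg (Real.smoothTransition.nonneg _) (stepDeriv_nonneg _)
  have : -(U / R) * (a + b) + v * (1 / R * (a - b)) = -(1 / R * ((U - v) * a + (U + v) * b)) := by
    ring
  rw [this, neg_nonpos]
  exact mul_nonneg (by positivity)
    (add_nonneg (mul_nonneg (by linarith) ha) (mul_nonneg (by linarith) hb))

theorem abs_cutX_le {c R : ℝ} (hc : ∀ y, stepDeriv y ≤ c) (hR : 0 < R) (U t x : ℝ) :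
    |cutX R U t x| ≤ c / R := by
  unfold cutX
  set s := stepDeriv ((x + 2 * R - U * t) / R) with hs
  set s' := stepDeriv ((2 * R - U * t - x) / R) with hs'
  have e1 : s * Real.smoothTransition ((2 * R - U * t - x) / R) ≤ c := by
    have h1 := Real.smoothTransition.le_one ((2 * R - U * t - x) / R)
    have h2 := Real.smoothTransition.nonneg ((2 * R - U * t - x) / R)
    nlinarith [hc ((x + 2 * R - U * t) / R), stepDeriv_nonneg ((x + 2 * R - U * t) / R)]
  have e2 : Real.smoothTransition ((x + 2 * R - U * t) / R) * s' ≤ c := by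
    have h1 := Real.smoothTransition.le_one ((x + 2 * R - U * t) / R)
    have h2 := Real.smoothTransition.nonneg ((x + 2 * R - U * t) / R)
    nlinarith [hc ((2 * R - U * t - x) / R), stepDeriv_nonneg ((2 * R - U * t - x) / R)]
  have n1 : 0 ≤ s * Real.smoothTransition ((2 * R - U * t - x) / R) :=
    mul_nonneg (stepDeriv_nonneg _) (Real.smoothTransition.nonneg _)
  have n2 : 0 ≤ Real.smoothTransition ((x + 2 * R - U * t) / R) * s' :=
    mul_nonneg (Real.smoothTransition.nonneg _) (stepDeriv_nonneg _)
  rw [abs_mul, abs_of_pos (by positivity : 0 < 1 / R), one_div,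
    div_eq_inv_mul c R]
  exact mul_le_mul_of_nonneg_left (abs_le.2 ⟨by linarith, by linarith⟩) (inv_pos.2 hR).le

theorem cut_right {R U t : ℝ} (hR : 0 < R) (hU : 0 ≤ U) (ht : 0 ≤ t) :
    cut R U t (2 * R) = 0 := by
  unfold cut
  rw [Real.smoothTransition.zero_of_nonpos (x := (2 * R - U * t - 2 * R) / R), mul_zero]
  exact div_nonpos_of_nonpos_of_nonneg (by nlinarith [mul_nonneg hU ht]) hR.le

theorem cut_left {R U t : ℝ} (hR : 0 < R) (hU : 0 ≤ U) (ht : 0 ≤ t) :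
    cut R U t (-(2 * R)) = 0 := by
  unfold cut
  rw [Real.smoothTransition.zero_of_nonpos (x := (-(2 * R) + 2 * R - U * t) / R), zero_mul]
  exact div_nonpos_of_nonpos_of_nonneg (by nlinarith [mul_nonneg hU ht]) hR.le

theorem cut_eq_one {R U t x : ℝ} (hR : 0 < R) (hx : |x| ≤ R - U * t) : cut R U t x = 1 := by
  have h := abs_le.1 hx
  unfold cut
  rw [Real.smoothTransition.one_of_one_le, Real.smoothTransition.one_of_one_le, one_mul]
  · rw [le_div_iff₀ hR]; linarith
  · rw [le_div_iff₀ hR]; linarith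

theorem cutX_eq_zero {R U t x : ℝ} (hR : 0 < R) (hx : |x| ≤ R - U * t) : cutX R U t x = 0 := by
  have h := abs_le.1 hx
  unfold cutX
  rw [stepDeriv_of_one_le, stepDeriv_of_one_le]
  · simp
  · rw [le_div_iff₀ hR]; linarith
  · rw [le_div_iff₀ hR]; linarith

/-! ## Behaviour at spatial infinity -/

/-- The states approach the end states at infinity, uniformly for `t ∈ [0, T]`. -/
def FarField (s : EndStates) (r u : ℝ → ℝ → ℝ) : Prop :=
  ∀ T : ℝ, (∀ G : ℝ × ℝ → ℝ, ContinuousAt G (s.rhoR, s.uR) → G (s.rhoR, s.uR) = 0 →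
      ∃ M : ℝ, ∀ t ∈ Icc 0 T, ∀ x, M ≤ x → |G (r t x, u t x)| ≤ 1) ∧
    (∀ G : ℝ × ℝ → ℝ, ContinuousAt G (s.rhoL, s.uL) → G (s.rhoL, s.uL) = 0 →
      ∃ M : ℝ, ∀ t ∈ Icc 0 T, ∀ x, x ≤ -M → |G (r t x, u t x)| ≤ 1)

/-- Uniform convergence of the states passes through any function continuous at the end state.
Quantifying over such functions makes the result directly applicable to fluxes and entropy variables
that vanish at an end state. -/
theorem IsNSSolution.farField {γ ε : ℝ} {s : EndStates} {rho0 u0 : ℝ → ℝ}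
    {rho u : ℝ → ℝ → ℝ} (h : IsNSSolution γ ε s rho0 u0 rho u) {r v : ℝ → ℝ → ℝ}
    (hr : ∀ t x, 0 ≤ t → r t x = rho t x) (hv : ∀ t x, 0 ≤ t → v t x = u t x) :
    FarField s r v := by
  have key : ∀ (G : ℝ × ℝ → ℝ) (a b : ℝ), ContinuousAt G (a, b) → G (a, b) = 0 →
      ∃ δ > 0, ∀ x y, dist a x < δ → dist b y < δ → |G (x, y)| ≤ 1 := by
    intro G a b hG h0
    obtain ⟨δ, hδ, hd⟩ := Metric.continuousAt_iff.1 hG 1 one_pos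
    refine ⟨δ, hδ, fun x y hx hy => ?_⟩
    have := hd (x := (x, y)) (by
      rw [Prod.dist_eq, max_lt_iff]
      exact ⟨by rwa [dist_comm] at hx, by rwa [dist_comm] at hy⟩)
    rw [h0, Real.dist_eq, sub_zero] at this
    exact this.le
  intro T
  constructor
  · intro G hG h0
    obtain ⟨δ, hδ, hd⟩ := key G _ _ hG h0
    have e1 := Metric.tendstoUniformlyOn_iff.1 (h.rho_right T) δ hδ
    have e2 := Metric.tendstoUniformlyOn_iff.1 (h.u_right T) δ hδ
    obtain ⟨M, hM⟩ := eventually_atTop.1 (e1.and e2)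
    refine ⟨M, fun t ht x hx => ?_⟩
    rw [hr t x ht.1, hv t x ht.1]
    exact hd _ _ ((hM x hx).1 t ht) ((hM x hx).2 t ht)
  · intro G hG h0
    obtain ⟨δ, hδ, hd⟩ := key G _ _ hG h0
    have e1 := Metric.tendstoUniformlyOn_iff.1 (h.rho_left T) δ hδ
    have e2 := Metric.tendstoUniformlyOn_iff.1 (h.u_left T) δ hδ
    obtain ⟨M, hM⟩ := eventually_atBot.1 (e1.and e2)
    refine ⟨-M, fun t ht x hx => ?_⟩
    rw [neg_neg] at hx
    rw [hr t x ht.1, hv t x ht.1]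
    exact hd _ _ ((hM x hx).1 t ht) ((hM x hx).2 t ht)

/-- The far field handles large |x| and compactness the rest. The bound is not uniform in ε; it only
fixes the speed of the cutoff and disappears from the estimates. -/
theorem FarField.exists_bound {s : EndStates} {r u : ℝ → ℝ → ℝ} (h : FarField s r u)
    (hu : Continuous fun p : ℝ × ℝ => u p.1 p.2) (T : ℝ) :
    ∃ U : ℝ, 0 ≤ U ∧ ∀ t ∈ Icc 0 T, ∀ x, |u t x| ≤ U := by
  obtain ⟨M, hM⟩ := (h T).1 (fun p => p.2 - s.uR) (by fun_prop) (sub_self _)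
  obtain ⟨M', hM'⟩ := (h T).2 (fun p => p.2 - s.uL) (by fun_prop) (sub_self _)
  obtain ⟨C, hC⟩ := ((isCompact_Icc (a := (0 : ℝ)) (b := T)).prod
    (isCompact_Icc (a := -M') (b := M))).exists_bound_of_continuousOn
    (f := fun p : ℝ × ℝ => u p.1 p.2) hu.continuousOn
  refine ⟨|C| + (|s.uR| + 1) + (|s.uL| + 1), by positivity, fun t ht x => ?_⟩
  have a1 := abs_nonneg C
  have a2 := abs_nonneg s.uR
  have a3 := abs_nonneg s.uL
  by_cases h1 : M ≤ x
  · have e1 := hM t ht x h1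
    simp only at e1
    have := abs_sub_abs_le_abs_sub (u t x) s.uR
    linarith
  by_cases h2 : x ≤ -M'
  · have e1 := hM' t ht x h2
    simp only at e1
    have := abs_sub_abs_le_abs_sub (u t x) s.uL
    linarith
  · have := hC (t, x) ⟨ht, ⟨(not_le.1 h2).le, (not_le.1 h1).le⟩⟩
    simp only [Real.norm_eq_abs] at this
    linarith [le_abs_self C]

/-! ## The energy identity -/

section Identity

variable {γ ε : ℝ} {r u rx ux rxx uxx : ℝ → ℝ → ℝ}

/-- The correction `ε ρ_x / ρ²` of the velocity. -/
def drift (ε : ℝ) (r rx : ℝ → ℝ → ℝ) (t x : ℝ) : ℝ := ε * rx t x / r t x ^ 2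

/-- The space derivative of `drift`. -/
def driftX (ε : ℝ) (r rx rxx : ℝ → ℝ → ℝ) (t x : ℝ) : ℝ :=
  ε * (rxx t x / r t x ^ 2 - 2 * rx t x ^ 2 / r t x ^ 3)

variable (F : Flow γ ε r u rx ux rxx uxx)
include F

theorem Flow.hasDerivAt_drift_x (t x : ℝ) :
    HasDerivAt (fun y => drift ε r rx t y) (driftX ε r rx rxx t x) x := by
  have hr := (F.pos t x).ne'
  refine (((F.hrxx t x).const_mul ε).fun_div ((F.hrx t x).fun_pow 2) (by positivity)).congr_deriv ?_
  unfold driftX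
  field_simp
  push_cast
  ring

/-- The term -εu_xx/ρ is the exact opposite of the viscous acceleration, so the sum of the velocity
and the drift obeys the inviscid momentum equation. This is the cancellation behind the bound of
ρ_x. -/
theorem Flow.hasDerivAt_drift_t {t : ℝ} (ht : 0 < t) (x : ℝ) :
    HasDerivAt (fun τ => drift ε r rx τ x)
      (-(u t x * driftX ε r rx rxx t x) - ε * uxx t x / r t x) t := by
  have hr := (F.pos t x).ne'
  refine (((F.hrxt t x ht).const_mul ε).fun_div ((F.hrt t x ht).fun_pow 2)
    (by positivity)).congr_deriv ?_
  unfold driftX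
  field_simp
  push_cast
  ring

theorem Flow.continuous_drift : Continuous fun p : ℝ × ℝ => drift ε r rx p.1 p.2 :=
  (F.cont_rx.const_mul ε).div (F.cont_r.pow 2) fun p => by have := F.pos p.1 p.2; positivity

theorem Flow.continuous_driftX : Continuous fun p : ℝ × ℝ => driftX ε r rx rxx p.1 p.2 := by
  have h := F.pos
  unfold driftX
  exact ((F.cont_rxx.div (F.cont_r.pow 2) fun p => (pow_pos (h p.1 p.2) 2).ne').sub
    (((F.cont_rx.pow 2).const_mul 2).div (F.cont_r.pow 3)
      fun p => (pow_pos (h p.1 p.2) 3).ne')).const_mul ε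

theorem Flow.continuous_rpow (a : ℝ) : Continuous fun p : ℝ × ℝ => r p.1 p.2 ^ a :=
  F.cont_r.rpow_const fun _ => Or.inl (F.pos _ _).ne'

end Identity

/-! ## The energy estimate -/

/-- The pointwise balance of ½ρ(u - ū)² + ½ρ(u - ū + z)² + 2e*, tested with φ. Here e stands for the
derivative of the internal energy, so that e_x = g and p_x = ρg; the internal energy occurs twice,
once for each velocity. What survives is transport of φ, the dissipations εu_x² and zρg, terms with
derivatives of the profile, and a flux against φ_x. -/
theorem energy_identity_aux {r u ub ubx rx ux uxx z zx g E p pb pbx e eb ebx φ φt φx ε : ℝ}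
    (hr : r ≠ 0) :
    (1 / 2 * (-(rx * u + r * ux) * (u - ub) ^ 2
            + r * (2 * (u - ub) * (ε * uxx / r - u * ux - g)))
        + 1 / 2 * (-(rx * u + r * ux) * (u - ub + z) ^ 2
            + r * (2 * (u - ub + z) * (ε * uxx / r - u * ux - g + (-(u * zx) - ε * uxx / r))))
        + 2 * ((e - eb) * -(rx * u + r * ux))) * φ
      + (1 / 2 * (r * (u - ub) ^ 2) + 1 / 2 * (r * (u - ub + z) ^ 2) + 2 * E) * φt
      + ((1 / 2 * ((rx * u + r * ux) * ((u - ub) ^ 2 + (u - ub + z) ^ 2)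
            + r * u * (2 * (u - ub) * (ux - ubx) + 2 * (u - ub + z) * (ux - ubx + zx)))
          + (2 * ((g - ebx) * (r * u) + (e - eb) * (rx * u + r * ux))
            - 2 * (ubx * (p - pb) + ub * (r * g - pbx))
            - ε * ((ux - ubx) * ux + (u - ub) * uxx))) * φ
        + (1 / 2 * (r * u * ((u - ub) ^ 2 + (u - ub + z) ^ 2))
          + (2 * ((e - eb) * (r * u)) - 2 * (ub * (p - pb)) - ε * ((u - ub) * ux))) * φx)
    = 1 / 2 * r * ((u - ub) ^ 2 + (u - ub + z) ^ 2) * (φt + u * φx) + 2 * E * φt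
      - z * (r * g) * φ - ε * ux ^ 2 * φ
      + (-(r * u * ubx * (u - ub + (u - ub + z))) + ε * ubx * ux - 2 * (p - pb) * ubx
        + 2 * ub * pbx - 2 * ebx * r * u) * φ
      + (2 * ((e - eb) * (r * u)) - 2 * (ub * (p - pb)) - ε * ((u - ub) * ux)) * φx := by
  field_simp
  ring

theorem abs_add_mul_add_le {D W b B : ℝ} (hb : |b| ≤ B) :
    |(D + b) * (D + W)| ≤ 2 * D ^ 2 + W ^ 2 + B ^ 2 := by
  have hb2 : b ^ 2 ≤ B ^ 2 := sq_le_sq' (abs_le.1 hb).1 (abs_le.1 hb).2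
  rw [abs_le]
  constructor
  · nlinarith [sq_nonneg (D + W), sq_nonneg (b + D), sq_nonneg (b + W), sq_nonneg D, sq_nonneg W]
  · nlinarith [sq_nonneg (D - W), sq_nonneg (b - D), sq_nonneg (b - W), sq_nonneg D, sq_nonneg W]

theorem abs_add_le_sq {D b B : ℝ} (hb : |b| ≤ B) : |D + b| ≤ D ^ 2 + 1 + B := by
  have := abs_add_le D b
  have : |D| ≤ D ^ 2 + 1 := by rw [← sq_abs]; nlinarith [sq_nonneg (|D| - 1), abs_nonneg D]
  linarith

set_option maxHeartbeats 1000000 in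
/-- Bound of the terms of the energy balance that live on the support of the derivatives of the
reference profile. -/
theorem exists_profile_terms_le {γ : ℝ} (hγ : 1 < γ) {s : EndStates} {rb ub rbx ubx : ℝ → ℝ}
    {m B L : ℝ} (h : ProfileBounds s rb ub rbx ubx m B L) {ε₁ : ℝ} (hε₁ : 0 ≤ ε₁) :
    ∃ C K : ℝ, 0 ≤ C ∧ 0 ≤ K ∧ ∀ x r D W ux ε : ℝ, 0 < r → 0 < ε → ε ≤ ε₁ →
      -(r * (D + ub x) * ubx x * (D + W)) + ε * ubx x * ux
          - 2 * (pressure γ r - pressure γ (rb x)) * ubx x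
          + 2 * ub x * (theta γ ^ 2 * rb x ^ (γ - 1) * rbx x)
          - 2 * (theta γ ^ 2 * rb x ^ (γ - 2) * rbx x) * r * (D + ub x)
        ≤ 1 / 4 * ε * ux ^ 2
          + C * (1 / 2 * (r * D ^ 2) + 1 / 2 * (r * W ^ 2) + 2 * relativeEnergy γ r (rb x))
          + K * (|ubx x| + |rbx x|) := by
  obtain ⟨N, hN0, hN⟩ := exists_rpow_le_relativeEnergy hγ B
  have hκ := kappa_pos hγ
  have hB := h.hB
  have hm := h.hm
  obtain ⟨c1, hc1⟩ : ∃ c, c = theta γ ^ 2 * B ^ (γ - 1) := ⟨_, rfl⟩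
  obtain ⟨c2, hc2⟩ : ∃ c, c = theta γ ^ 2 * (B ^ (γ - 1) / m) := ⟨_, rfl⟩
  obtain ⟨pB, hpB⟩ : ∃ c, c = kappa γ * B ^ γ := ⟨_, rfl⟩
  have hc1p : 0 ≤ c1 := hc1 ▸ by positivity
  have hc2p : 0 ≤ c2 := hc2 ▸ by positivity
  have hpBp : 0 ≤ pB := hpB ▸ by positivity
  obtain ⟨A3, hA3⟩ : ∃ c, c = (B ^ 2 + 2 * c2 * (1 + B) + 2 * kappa γ) * N := ⟨_, rfl⟩
  have hA3p : 0 ≤ A3 := hA3 ▸ by positivity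
  obtain ⟨A4, hA4⟩ : ∃ c, c = A3 + (B ^ 2 + 2 * c2 * (1 + B)) + ε₁ * B + 2 * pB + 2 * B * c1 :=
    ⟨_, rfl⟩
  have hA4p : 0 ≤ A4 := hA4 ▸ by positivity
  refine ⟨2 * B * (2 * (2 + 2 * c2) + 2 + A3), A4, by positivity, hA4p, ?_⟩
  intro x r D W ux ε hr hε hεε
  have hb := h.rb_pos x
  have hE := relativeEnergy_nonneg hγ hr hb
  have hp := hN r (rb x) hr hb (h.rb_upper x)
  have hrp : 0 ≤ r ^ γ := by positivity
  have hr1 := le_one_add_rpow hγ.le hr.le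
  set E := relativeEnergy γ r (rb x)
  have hub := h.ub_le x
  have q1 : rb x ^ (γ - 1) ≤ B ^ (γ - 1) :=
    Real.rpow_le_rpow hb.le (h.rb_upper x) (by linarith)
  -- The exponent γ - 2 may be negative, which is why the lower bound m of the profile enters.
  have q2 : rb x ^ (γ - 2) ≤ B ^ (γ - 1) / m := by
    have : rb x ^ (γ - 2) = rb x ^ (γ - 1) / rb x := by
      rw [← Real.rpow_sub_one hb.ne']; congr 1; ring
    rw [this]
    exact div_le_div₀ (by positivity) q1 hm (h.rb_lower x)
  have q3 : pressure γ (rb x) ≤ pB := by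
    rw [hpB]
    exact mul_le_mul_of_nonneg_left (Real.rpow_le_rpow hb.le (h.rb_upper x) (by linarith)) hκ.le
  have q4 : 0 ≤ pressure γ (rb x) := mul_nonneg hκ.le (by positivity)
  have q5 : 0 ≤ pressure γ r := mul_nonneg hκ.le (by positivity)
  have q6 : theta γ ^ 2 * rb x ^ (γ - 1) ≤ c1 := by
    rw [hc1]; exact mul_le_mul_of_nonneg_left q1 (by positivity)
  have q7 : theta γ ^ 2 * rb x ^ (γ - 2) ≤ c2 := by
    rw [hc2]; exact mul_le_mul_of_nonneg_left q2 (by positivity)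
  have q8 : 0 ≤ theta γ ^ 2 * rb x ^ (γ - 1) := by positivity
  have q9 : 0 ≤ theta γ ^ 2 * rb x ^ (γ - 2) := by positivity
  set g1 := theta γ ^ 2 * rb x ^ (γ - 1)
  set g2 := theta γ ^ 2 * rb x ^ (γ - 2)
  have hU0 := abs_nonneg (ubx x)
  have hR0 := abs_nonneg (rbx x)
  have hU1 := h.ubx_le x
  have hR1 := h.rbx_le x
  -- the five terms
  have a1 : -(r * (D + ub x) * ubx x * (D + W)) ≤ |ubx x| * (r * (2 * D ^ 2 + W ^ 2 + B ^ 2)) := by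
    have e := abs_add_mul_add_le (D := D) (W := W) hub
    calc -(r * (D + ub x) * ubx x * (D + W)) ≤ |-(r * (D + ub x) * ubx x * (D + W))| := le_abs_self _
      _ = |ubx x| * (r * |(D + ub x) * (D + W)|) := by
          rw [abs_neg, show r * (D + ub x) * ubx x * (D + W) = ubx x * (r * ((D + ub x) * (D + W)))
            by ring, abs_mul, abs_mul, abs_of_pos hr]
      _ ≤ _ := by gcongr
  -- Young's inequality. A quarter of the viscous dissipation is spent here and another quarter on
  -- the cutoff in `energy_rate_le`; one half remains.
  have a2 : ε * ubx x * ux ≤ 1 / 4 * ε * ux ^ 2 + |ubx x| * (ε₁ * B) := by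
    have e1 : ε * ubx x ^ 2 ≤ |ubx x| * (ε₁ * B) := by
      rw [← sq_abs]
      nlinarith [mul_le_mul hεε hU1 hU0 hε₁]
    nlinarith [mul_nonneg hε.le (sq_nonneg (ux / 2 - ubx x))]
  have a3 : -(2 * (pressure γ r - pressure γ (rb x)) * ubx x)
      ≤ |ubx x| * (2 * kappa γ * r ^ γ + 2 * pB) := by
    have e : |pressure γ r - pressure γ (rb x)| ≤ kappa γ * r ^ γ + pB := by
      have e0 : pressure γ r = kappa γ * r ^ γ := rfl
      rw [← e0, abs_le]
      constructor <;> linarith only [q3, q4, q5]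
    calc -(2 * (pressure γ r - pressure γ (rb x)) * ubx x)
        ≤ |-(2 * (pressure γ r - pressure γ (rb x)) * ubx x)| := le_abs_self _
      _ = |ubx x| * (2 * |pressure γ r - pressure γ (rb x)|) := by
          rw [abs_neg, abs_mul, abs_mul, abs_two]; ring
      _ ≤ |ubx x| * (2 * (kappa γ * r ^ γ + pB)) := by gcongr
      _ = _ := by ring
  have a4 : 2 * ub x * (g1 * rbx x) ≤ |rbx x| * (2 * B * c1) := by
    calc 2 * ub x * (g1 * rbx x) ≤ |2 * ub x * (g1 * rbx x)| := le_abs_self _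
      _ = |rbx x| * (2 * |ub x| * g1) := by
          rw [abs_mul, abs_mul, abs_mul, abs_two, abs_of_nonneg q8]; ring
      _ ≤ _ := by gcongr
  have a5 : -(2 * (g2 * rbx x) * r * (D + ub x)) ≤ |rbx x| * (2 * c2 * (r * (D ^ 2 + 1 + B))) := by
    have e := abs_add_le_sq (D := D) hub
    calc -(2 * (g2 * rbx x) * r * (D + ub x)) ≤ |-(2 * (g2 * rbx x) * r * (D + ub x))| :=
          le_abs_self _
      _ = |rbx x| * (2 * g2 * (r * |D + ub x|)) := by
          rw [abs_neg, abs_mul, abs_mul, abs_mul, abs_mul, abs_two, abs_of_nonneg q9,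
            abs_of_pos hr]; ring
      _ ≤ _ := by gcongr
  -- collecting
  set Y := (2 + 2 * c2) * (r * D ^ 2) + r * W ^ 2 + (B ^ 2 + 2 * c2 * (1 + B)) * r
      + 2 * kappa γ * r ^ γ + (ε₁ * B + 2 * pB + 2 * B * c1) with hY
  have hD0 : 0 ≤ r * D ^ 2 := by positivity
  have hW0 : 0 ≤ r * W ^ 2 := by positivity
  have b1 : |ubx x| * (r * (2 * D ^ 2 + W ^ 2 + B ^ 2)) + |ubx x| * (ε₁ * B)
      + |ubx x| * (2 * kappa γ * r ^ γ + 2 * pB) ≤ |ubx x| * Y := by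
    rw [← mul_add, ← mul_add]
    refine mul_le_mul_of_nonneg_left ?_ hU0
    have z1 : 0 ≤ 2 * c2 * (r * D ^ 2) := by positivity
    have z2 : 0 ≤ 2 * c2 * (1 + B) * r := by positivity
    have z3 : 0 ≤ 2 * B * c1 := by positivity
    rw [hY]; linarith only [z1, z2, z3]
  have b2 : |rbx x| * (2 * B * c1) + |rbx x| * (2 * c2 * (r * (D ^ 2 + 1 + B))) ≤ |rbx x| * Y := by
    rw [← mul_add]
    refine mul_le_mul_of_nonneg_left ?_ hR0
    have z1 : 0 ≤ B ^ 2 * r := by positivity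
    have z2 : 0 ≤ 2 * kappa γ * r ^ γ := by positivity
    have z3 : 0 ≤ ε₁ * B := by positivity
    rw [hY]; linarith only [z1, z2, z3, hD0, hW0, hpBp]
  have b3 : Y ≤ (2 + 2 * c2) * (r * D ^ 2) + r * W ^ 2 + A3 * E + A4 := by
    have e0 : 0 ≤ B ^ 2 + 2 * c2 * (1 + B) := by positivity
    have e1 := mul_le_mul_of_nonneg_left hr1 e0
    have e2 : (B ^ 2 + 2 * c2 * (1 + B) + 2 * kappa γ) * r ^ γ ≤ A3 * (1 + E) := by
      rw [hA3, mul_assoc _ N (1 + E)]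
      exact mul_le_mul_of_nonneg_left hp (by positivity)
    rw [hY, hA4]; linarith only [e1, e2]
  -- The derivatives of the profile are replaced by their supremum in front of the energies, but
  -- kept in front of the constant, which would otherwise not be integrable over the line.
  have b4 : (|ubx x| + |rbx x|) * Y ≤ 2 * B * ((2 + 2 * c2) * (r * D ^ 2) + r * W ^ 2 + A3 * E)
      + A4 * (|ubx x| + |rbx x|) := by
    have e0 : 0 ≤ (2 + 2 * c2) * (r * D ^ 2) + r * W ^ 2 + A3 * E := by positivity
    have e1 := mul_le_mul_of_nonneg_left b3 (add_nonneg hU0 hR0)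
    have e2 : |ubx x| + |rbx x| ≤ 2 * B := by linarith only [hU1, hR1]
    have e3 := mul_le_mul_of_nonneg_right e2 e0
    linarith only [e1, e3]
  have b5 : 2 * B * ((2 + 2 * c2) * (r * D ^ 2) + r * W ^ 2 + A3 * E)
      ≤ 2 * B * (2 * (2 + 2 * c2) + 2 + A3)
        * (1 / 2 * (r * D ^ 2) + 1 / 2 * (r * W ^ 2) + 2 * E) := by
    rw [mul_assoc (2 * B)]
    refine mul_le_mul_of_nonneg_left ?_ (by positivity)
    have y1 : 0 ≤ c2 * (r * D ^ 2) := by positivity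
    have y2 : 0 ≤ c2 * (r * W ^ 2) := by positivity
    have y3 : 0 ≤ c2 * E := by positivity
    have y4 : 0 ≤ A3 * (r * W ^ 2) := by positivity
    have y5 : 0 ≤ A3 * (r * D ^ 2) := by positivity
    have y6 : 0 ≤ A3 * E := by positivity
    linarith only [y1, y2, y3, y4, y5, y6, hD0, hW0, hE]
  linarith only [a1, a2, a3, a4, a5, b1, b2, b4, b5]

/-- The pointwise form of the energy inequality for a weight `w A²`. -/
theorem energy_rate_le {r u D W E Z G X U C K₀ ε ε₁ A At Ax w a ux μ : ℝ}
    (hr : 0 < r) (hE : 0 ≤ E) (hw : 0 < w) (hw1 : w ≤ 1) (hA : 0 ≤ A) (hA1 : A ≤ 1)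
    (hU : |u| ≤ U) (hcut : ∀ v, |v| ≤ U → At + v * Ax ≤ 0) (hε : 0 < ε) (hεε : ε ≤ ε₁)
    (hμ : 0 ≤ K₀ * μ)
    (hX : X ≤ 1 / 4 * ε * ux ^ 2 + C * (1 / 2 * (r * D ^ 2) + 1 / 2 * (r * W ^ 2) + 2 * E)
      + K₀ * μ)
    (ha : |Ax| ≤ a) (hfar : Ax ≠ 0 → |G| ≤ 1 ∧ |D| ≤ 1) :
    1 / 2 * r * (D ^ 2 + W ^ 2) * (-C * (w * A ^ 2) + w * (2 * A * At) + u * (w * (2 * A * Ax)))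
        + 2 * E * (-C * (w * A ^ 2) + w * (2 * A * At))
        - Z * (w * A ^ 2) - ε * ux ^ 2 * (w * A ^ 2) + X * (w * A ^ 2)
        + (G - ε * (D * ux)) * (w * (2 * A * Ax))
      ≤ -(w * A ^ 2 * (Z + 1 / 2 * (ε * ux ^ 2))) + K₀ * μ + (2 * a + 4 * ε₁ * a ^ 2) := by
  have ha0 : 0 ≤ a := (abs_nonneg _).trans ha
  have hwA : 0 ≤ w * A ^ 2 := by positivity
  have hwA1 : w * A ^ 2 ≤ 1 := mul_le_one₀ hw1 (by positivity) (pow_le_one₀ hA hA1)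
  have h1 : 1 / 2 * r * (D ^ 2 + W ^ 2) * (2 * w * A * (At + u * Ax)) ≤ 0 :=
    mul_nonpos_of_nonneg_of_nonpos (by positivity)
      (mul_nonpos_of_nonneg_of_nonpos (by positivity) (hcut u hU))
  have h2 : 2 * E * (2 * w * A * At) ≤ 0 := by
    have := hcut 0 (by simpa using (abs_nonneg u).trans hU)
    rw [zero_mul, add_zero] at this
    exact mul_nonpos_of_nonneg_of_nonpos (by positivity)
      (mul_nonpos_of_nonneg_of_nonpos (by positivity) this)
  have h3 : X * (w * A ^ 2) ≤ (1 / 4 * ε * ux ^ 2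
      + C * (1 / 2 * (r * D ^ 2) + 1 / 2 * (r * W ^ 2) + 2 * E)) * (w * A ^ 2) + K₀ * μ := by
    have := mul_le_mul_of_nonneg_right hX hwA
    nlinarith [mul_le_mul_of_nonneg_left hwA1 hμ]
  have h4 : (G - ε * (D * ux)) * (w * (2 * A * Ax))
      ≤ 1 / 4 * (ε * ux ^ 2) * (w * A ^ 2) + (2 * a + 4 * ε₁ * a ^ 2) := by
    -- The remaining flux acts only where the cutoff has slope. That region lies near the end
    -- states, where G and D are at most 1.
    by_cases hz : Ax = 0
    · rw [hz]; simp only [mul_zero]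
      have : 0 ≤ ε₁ := hε.le.trans hεε
      positivity
    obtain ⟨hG, hD⟩ := hfar hz
    have e1 : G * (w * (2 * A * Ax)) ≤ 2 * a := by
      calc G * (w * (2 * A * Ax)) ≤ |G * (w * (2 * A * Ax))| := le_abs_self _
        _ = 2 * (|G| * w * A * |Ax|) := by
            rw [abs_mul, abs_mul, abs_mul, abs_mul, abs_two, abs_of_pos hw, abs_of_nonneg hA]; ring
        _ ≤ 2 * (1 * 1 * 1 * a) := by gcongr
        _ = 2 * a := by ring
    -- This is why the cutoff enters squared: its derivative retains a factor A, so εDu_xAA_x is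
    -- absorbed by εu_x²A² at the price of εD²A_x².
    have e2 : -(ε * (D * ux)) * (w * (2 * A * Ax))
        ≤ w * (1 / 4 * (ε * ux ^ 2) * A ^ 2 + 4 * ε * (D ^ 2 * Ax ^ 2)) := by
      have : 0 ≤ w * (ε * (1 / 2 * (ux * A) + 2 * (D * Ax)) ^ 2) := by positivity
      nlinarith
    have e3 : w * (4 * ε * (D ^ 2 * Ax ^ 2)) ≤ 4 * ε₁ * a ^ 2 := by
      have d1 : D ^ 2 ≤ 1 := by rw [← sq_abs]; exact pow_le_one₀ (abs_nonneg _) hD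
      have d2 : Ax ^ 2 ≤ a ^ 2 := by rw [← sq_abs]; exact pow_le_pow_left₀ (abs_nonneg _) ha 2
      have hε1 : 0 ≤ ε₁ := hε.le.trans hεε
      calc w * (4 * ε * (D ^ 2 * Ax ^ 2)) ≤ 1 * (4 * ε₁ * (1 * a ^ 2)) := by gcongr
        _ = _ := by ring
    nlinarith
  nlinarith

/-- The integrated energy balance, for a flow given through its derivatives. -/
theorem energy_balance {r u rx ux uxx z zx g E p e φ φt φx rt ut zt S : ℝ → ℝ → ℝ}
    {ub ubx pb pbx eb ebx : ℝ → ℝ} {ε T M : ℝ} (hT : 0 ≤ T) (hM : 0 ≤ M)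
    (cr : Continuous fun q : ℝ × ℝ => r q.1 q.2) (cu : Continuous fun q : ℝ × ℝ => u q.1 q.2)
    (crx : Continuous fun q : ℝ × ℝ => rx q.1 q.2) (cux : Continuous fun q : ℝ × ℝ => ux q.1 q.2)
    (cuxx : Continuous fun q : ℝ × ℝ => uxx q.1 q.2) (cz : Continuous fun q : ℝ × ℝ => z q.1 q.2)
    (czx : Continuous fun q : ℝ × ℝ => zx q.1 q.2) (cg : Continuous fun q : ℝ × ℝ => g q.1 q.2)
    (cE : Continuous fun q : ℝ × ℝ => E q.1 q.2) (cp : Continuous fun q : ℝ × ℝ => p q.1 q.2)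
    (ce : Continuous fun q : ℝ × ℝ => e q.1 q.2) (cφ : Continuous fun q : ℝ × ℝ => φ q.1 q.2)
    (cφt : Continuous fun q : ℝ × ℝ => φt q.1 q.2) (cφx : Continuous fun q : ℝ × ℝ => φx q.1 q.2)
    (crt : Continuous fun q : ℝ × ℝ => rt q.1 q.2) (cut : Continuous fun q : ℝ × ℝ => ut q.1 q.2)
    (czt : Continuous fun q : ℝ × ℝ => zt q.1 q.2) (cS : Continuous fun q : ℝ × ℝ => S q.1 q.2)
    (cub : Continuous ub) (cubx : Continuous ubx) (cpb : Continuous pb) (cpbx : Continuous pbx)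
    (ceb : Continuous eb) (cebx : Continuous ebx)
    (hr : ∀ t x, r t x ≠ 0)
    (ert : ∀ t x, rt t x = -(rx t x * u t x + r t x * ux t x))
    (eut : ∀ t x, ut t x = ε * uxx t x / r t x - u t x * ux t x - g t x)
    (ezt : ∀ t x, zt t x = -(u t x * zx t x) - ε * uxx t x / r t x)
    (drt : ∀ t x, 0 < t → HasDerivAt (fun τ => r τ x) (rt t x) t)
    (dut : ∀ t x, 0 < t → HasDerivAt (fun τ => u τ x) (ut t x) t)
    (dzt : ∀ t x, 0 < t → HasDerivAt (fun τ => z τ x) (zt t x) t)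
    (dEt : ∀ t x, 0 < t → HasDerivAt (fun τ => E τ x) ((e t x - eb x) * rt t x) t)
    (dφt : ∀ t x, 0 < t → HasDerivAt (fun τ => φ τ x) (φt t x) t)
    (drx : ∀ t x, HasDerivAt (fun y => r t y) (rx t x) x)
    (dux : ∀ t x, HasDerivAt (fun y => u t y) (ux t x) x)
    (duxx : ∀ t x, HasDerivAt (fun y => ux t y) (uxx t x) x)
    (dzx : ∀ t x, HasDerivAt (fun y => z t y) (zx t x) x)
    (dex : ∀ t x, HasDerivAt (fun y => e t y) (g t x) x)
    (dpx : ∀ t x, HasDerivAt (fun y => p t y) (r t x * g t x) x)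
    (dφx : ∀ t x, HasDerivAt (fun y => φ t y) (φx t x) x)
    (dub : ∀ x, HasDerivAt ub (ubx x) x) (dpb : ∀ x, HasDerivAt pb (pbx x) x)
    (deb : ∀ x, HasDerivAt eb (ebx x) x)
    (hl : ∀ t ∈ Icc 0 T, φ t (-M) = 0) (hrt : ∀ t ∈ Icc 0 T, φ t M = 0)
    (hS : ∀ t ∈ Icc 0 T, ∀ x ∈ Icc (-M) M,
      1 / 2 * r t x * ((u t x - ub x) ^ 2 + (u t x - ub x + z t x) ^ 2)
          * (φt t x + u t x * φx t x) + 2 * E t x * φt t x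
        - z t x * (r t x * g t x) * φ t x - ε * ux t x ^ 2 * φ t x
        + (-(r t x * u t x * ubx x * (u t x - ub x + (u t x - ub x + z t x)))
          + ε * ubx x * ux t x - 2 * (p t x - pb x) * ubx x
          + 2 * ub x * pbx x - 2 * ebx x * r t x * u t x) * φ t x
        + (2 * ((e t x - eb x) * (r t x * u t x)) - 2 * (ub x * (p t x - pb x))
          - ε * ((u t x - ub x) * ux t x)) * φx t x ≤ S t x) :
    ∫ x in -M..M, (1 / 2 * (r T x * (u T x - ub x) ^ 2)
        + 1 / 2 * (r T x * (u T x - ub x + z T x) ^ 2) + 2 * E T x) * φ T x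
      ≤ (∫ x in -M..M, (1 / 2 * (r 0 x * (u 0 x - ub x) ^ 2)
        + 1 / 2 * (r 0 x * (u 0 x - ub x + z 0 x) ^ 2) + 2 * E 0 x) * φ 0 x)
        + ∫ t in 0..T, ∫ x in -M..M, S t x := by
  refine integral_le_of_conservation
    (P := fun t x => (1 / 2 * (r t x * (u t x - ub x) ^ 2)
        + 1 / 2 * (r t x * (u t x - ub x + z t x) ^ 2) + 2 * E t x) * φ t x)
    (Pt := fun t x => (1 / 2 * (rt t x * (u t x - ub x) ^ 2
            + r t x * (2 * (u t x - ub x) * ut t x))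
        + 1 / 2 * (rt t x * (u t x - ub x + z t x) ^ 2
            + r t x * (2 * (u t x - ub x + z t x) * (ut t x + zt t x)))
        + 2 * ((e t x - eb x) * rt t x)) * φ t x
      + (1 / 2 * (r t x * (u t x - ub x) ^ 2) + 1 / 2 * (r t x * (u t x - ub x + z t x) ^ 2)
        + 2 * E t x) * φt t x)
    (Q := fun t x => (1 / 2 * (r t x * u t x * ((u t x - ub x) ^ 2 + (u t x - ub x + z t x) ^ 2))
          + (2 * ((e t x - eb x) * (r t x * u t x)) - 2 * (ub x * (p t x - pb x))
            - ε * ((u t x - ub x) * ux t x))) * φ t x)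
    (Qx := fun t x => (1 / 2 * ((rx t x * u t x + r t x * ux t x)
              * ((u t x - ub x) ^ 2 + (u t x - ub x + z t x) ^ 2)
            + r t x * u t x * (2 * (u t x - ub x) * (ux t x - ubx x)
              + 2 * (u t x - ub x + z t x) * (ux t x - ubx x + zx t x)))
          + (2 * ((g t x - ebx x) * (r t x * u t x)
              + (e t x - eb x) * (rx t x * u t x + r t x * ux t x))
            - 2 * (ubx x * (p t x - pb x) + ub x * (r t x * g t x - pbx x))
            - ε * ((ux t x - ubx x) * ux t x + (u t x - ub x) * uxx t x))) * φ t x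
        + (1 / 2 * (r t x * u t x * ((u t x - ub x) ^ 2 + (u t x - ub x + z t x) ^ 2))
          + (2 * ((e t x - eb x) * (r t x * u t x)) - 2 * (ub x * (p t x - pb x))
            - ε * ((u t x - ub x) * ux t x))) * φx t x)
    hT hM ?_ ?_ ?_ cS ?_ ?_ ?_ ?_ ?_
  · fun_prop
  · fun_prop
  · fun_prop
  · intro t x ht
    have hD := (dut t x ht).sub_const (ub x)
    have h1 := ((drt t x ht).fun_mul (hD.fun_pow 2)).const_mul (1 / 2 : ℝ)
    have h2 := ((drt t x ht).fun_mul ((hD.fun_add (dzt t x ht)).fun_pow 2)).const_mul (1 / 2 : ℝ)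
    have h3 := (dEt t x ht).const_mul 2
    refine (((h1.fun_add h2).fun_add h3).fun_mul (dφt t x ht)).congr_deriv ?_
    push_cast
    ring
  · intro t x
    have hD := (dux t x).fun_sub (dub x)
    have h1 := (((drx t x).fun_mul (dux t x)).fun_mul ((hD.fun_pow 2).fun_add
      ((hD.fun_add (dzx t x)).fun_pow 2))).const_mul (1 / 2 : ℝ)
    have h2 := (((dex t x).fun_sub (deb x)).fun_mul ((drx t x).fun_mul (dux t x))).const_mul 2
    have h3 := ((dub x).fun_mul ((dpx t x).fun_sub (dpb x))).const_mul 2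
    have h4 := (hD.fun_mul (duxx t x)).const_mul ε
    refine ((h1.fun_add ((h2.fun_sub h3).fun_sub h4)).fun_mul (dφx t x)).congr_deriv ?_
    push_cast
    ring
  · intro t ht
    simp only [hl t ht, mul_zero]
  · intro t ht
    simp only [hrt t ht, mul_zero]
  · intro t ht x hx
    refine le_trans (le_of_eq ?_) (hS t ht x hx)
    rw [eut, ezt, ert]
    exact energy_identity_aux (hr t x)

theorem integral_le_of_subinterval {f : ℝ → ℝ} (hf : Continuous f) {M N : ℝ} (hM : 0 ≤ M)
    (hMN : M ≤ N) (h0 : ∀ x, 0 ≤ f x) : ∫ x in -M..M, f x ≤ ∫ x in -N..N, f x :=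
  intervalIntegral.integral_mono_interval (by linarith) (by linarith) hMN
    (Eventually.of_forall h0) (hf.intervalIntegrable _ _)

theorem integral_le_of_eq_zero_outside {f : ℝ → ℝ} (hf : Continuous f) {L N B : ℝ} (hL : 0 ≤ L)
    (hLN : L ≤ N) (hB : ∀ x, f x ≤ B) (hr : ∀ x, L ≤ x → f x = 0) (hl : ∀ x, x ≤ -L → f x = 0) :
    ∫ x in -N..N, f x ≤ 2 * L * B := by
  have hi : ∀ a b, IntervalIntegrable f volume a b := fun a b => hf.intervalIntegrable a b
  rw [← intervalIntegral.integral_add_adjacent_intervals (hi (-N) (-L)) (hi (-L) N),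
    ← intervalIntegral.integral_add_adjacent_intervals (hi (-L) L) (hi L N)]
  have h1 : ∫ x in -N..-L, f x = 0 := by
    rw [intervalIntegral.integral_congr (g := fun _ => (0 : ℝ)), intervalIntegral.integral_zero]
    intro x hx
    rw [uIcc_of_le (by linarith)] at hx
    exact hl x hx.2
  have h2 : ∫ x in L..N, f x = 0 := by
    rw [intervalIntegral.integral_congr (g := fun _ => (0 : ℝ)), intervalIntegral.integral_zero]
    intro x hx
    rw [uIcc_of_le hLN] at hx
    exact hr x hx.1
  have h3 : ∫ x in -L..L, f x ≤ ∫ x in -L..L, B :=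
    intervalIntegral.integral_mono_on (by linarith) (hi _ _) (by simp) fun x _ => hB x
  rw [intervalIntegral.integral_const, smul_eq_mul] at h3
  linarith

theorem integral_neg_add_mul_add {f g : ℝ → ℝ} (hf : Continuous f) (hg : Continuous g)
    (a b k l : ℝ) : ∫ x in a..b, (-f x + k * g x + l)
      = -(∫ x in a..b, f x) + k * (∫ x in a..b, g x) + (b - a) * l := by
  have h1 : IntervalIntegrable (fun x => -f x) volume a b := hf.neg.intervalIntegrable _ _
  have h2 : IntervalIntegrable (fun x => k * g x) volume a b :=
    (hg.const_mul k).intervalIntegrable _ _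
  rw [intervalIntegral.integral_add (h1.add h2) intervalIntegrable_const,
    intervalIntegral.integral_add h1 h2, intervalIntegral.integral_neg,
    intervalIntegral.integral_const_mul, intervalIntegral.integral_const, smul_eq_mul]

/-- The density of the relative mechanical energy. -/
def energyDensity (γ : ℝ) (rb ub : ℝ → ℝ) (r u : ℝ → ℝ → ℝ) (t x : ℝ) : ℝ :=
  1 / 2 * (r t x * (u t x - ub x) ^ 2) + relativeEnergy γ (r t x) (rb x)

theorem continuous_relativeEnergy {γ : ℝ} (hγ : 1 < γ) {X : Type*} [TopologicalSpace X]
    {f g : X → ℝ} (hf : Continuous f) (hg : Continuous g) :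
    Continuous fun p => relativeEnergy γ (f p) (g p) := by
  have h0 : 0 ≤ γ := by linarith
  have h1 : 0 ≤ γ - 1 := by linarith
  simp only [relativeEnergy_eq hγ]
  have c1 : Continuous fun p => f p ^ γ := hf.rpow_const fun _ => Or.inr h0
  have c2 : Continuous fun p => g p ^ γ := hg.rpow_const fun _ => Or.inr h0
  have c3 : Continuous fun p => g p ^ (γ - 1) := hg.rpow_const fun _ => Or.inr h1
  fun_prop

/-- A-priori bounds that hold uniformly in the viscosity. -/
structure EnergyBounds (γ ε T C : ℝ) (rb ub : ℝ → ℝ) (r u rx ux : ℝ → ℝ → ℝ) : Prop where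
  energy : ∀ t ∈ Icc 0 T, ∀ M, 0 ≤ M → ∫ x in -M..M, energyDensity γ rb ub r u t x ≤ C
  dissipation : ∀ M, 0 ≤ M → ∫ t in 0..T, ∫ x in -M..M,
    ε * (ux t x ^ 2 + r t x ^ (γ - 3) * rx t x ^ 2) ≤ C

/-- For large |x| the profile equals an end state, and both expressions vanish when the solution
does too. They are the flux terms that meet the slope of the cutoff. -/
theorem exists_stateFlux_le {γ : ℝ} {s : EndStates} (hL : 0 < s.rhoL)
    (hR : 0 < s.rhoR) {r u : ℝ → ℝ → ℝ} (hfar : FarField s r u) {rb ub rbx ubx : ℝ → ℝ}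
    {m B L : ℝ} (h : ProfileBounds s rb ub rbx ubx m B L) (T : ℝ) :
    ∃ M₁, ∀ t ∈ Icc 0 T, ∀ x, M₁ ≤ |x| →
      |2 * ((theta γ / 2 * r t x ^ (γ - 1) - theta γ / 2 * rb x ^ (γ - 1)) * (r t x * u t x))
        - 2 * (ub x * (pressure γ (r t x) - pressure γ (rb x)))| ≤ 1 ∧ |u t x - ub x| ≤ 1 := by
  have hc : ∀ a b : ℝ, 0 < a → ContinuousAt (fun p : ℝ × ℝ =>
      2 * ((theta γ / 2 * p.1 ^ (γ - 1) - theta γ / 2 * a ^ (γ - 1)) * (p.1 * p.2))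
        - 2 * (b * (kappa γ * p.1 ^ γ - kappa γ * a ^ γ))) (a, b) := by
    intro a b ha
    have h1 : ∀ c : ℝ, ContinuousAt (fun p : ℝ × ℝ => p.1 ^ c) (a, b) := fun c =>
      continuousAt_fst.rpow_const (Or.inl ha.ne')
    have h2 := h1 (γ - 1)
    have h3 := h1 γ
    fun_prop
  obtain ⟨m1, h1⟩ := (hfar T).1 _ (hc s.rhoR s.uR hR) (by simp)
  obtain ⟨m2, h2⟩ := (hfar T).2 _ (hc s.rhoL s.uL hL) (by simp)
  obtain ⟨m3, h3⟩ := (hfar T).1 (fun p => p.2 - s.uR) (by fun_prop) (sub_self _)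
  obtain ⟨m4, h4⟩ := (hfar T).2 (fun p => p.2 - s.uL) (by fun_prop) (sub_self _)
  refine ⟨max L (max (max m1 m2) (max m3 m4)), fun t ht x hx => ?_⟩
  simp only [max_le_iff] at hx
  obtain ⟨hxL, ⟨hx1, hx2⟩, hx3, hx4⟩ := hx
  rcases le_total 0 x with hx0 | hx0
  · rw [abs_of_nonneg hx0] at *
    obtain ⟨e1, e2, -, -⟩ := h.right x hxL
    rw [e1, e2]
    exact ⟨h1 t ht x hx1, h3 t ht x hx3⟩
  · rw [abs_of_nonpos hx0] at *
    obtain ⟨e1, e2, -, -⟩ := h.left x (by linarith)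
    rw [e1, e2]
    exact ⟨h2 t ht x (by linarith), h4 t ht x (by linarith)⟩

set_option maxHeartbeats 1000000 in
/-- The energy estimate and the estimate of the density gradient. -/
theorem exists_energyBounds {γ : ℝ} (hγ : 1 < γ) {s : EndStates} (hL : 0 < s.rhoL)
    (hR : 0 < s.rhoR) {rb ub rbx ubx : ℝ → ℝ} {m B L : ℝ}
    (h : ProfileBounds s rb ub rbx ubx m B L) {ε₁ E₀ E₁ T : ℝ} (hε₁ : 0 ≤ ε₁) (hE₀ : 0 ≤ E₀)
    (hE₁ : 0 ≤ E₁) (hT : 0 ≤ T) :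
    ∃ C : ℝ, 0 ≤ C ∧ ∀ (ε : ℝ) (r u rx ux rxx uxx : ℝ → ℝ → ℝ), 0 < ε → ε ≤ ε₁ →
      Flow γ ε r u rx ux rxx uxx → FarField s r u →
      (∀ M, 0 ≤ M → ∫ x in -M..M, energyDensity γ rb ub r u 0 x ≤ E₀) →
      (∀ M, 0 ≤ M → ∫ x in -M..M, ε ^ 2 * (rx 0 x ^ 2 / r 0 x ^ 3) ≤ E₁) →
      EnergyBounds γ ε T C rb ub r u rx ux := by
  obtain ⟨C₀, K₀, hC₀, hK₀, hloc⟩ := exists_profile_terms_le hγ h hε₁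
  obtain ⟨c, hc0, hc⟩ := exists_stepDeriv_le
  have hB := h.hB
  have hθ := theta_pos hγ
  -- The doubled initial energy is at most 3E₀ + E₁ because ½(D + z)² ≤ D² + z². The profile terms
  -- live on an interval of length 2L with size at most 2B. The cutoff errors 2c/R + 4ε₁c²/R² are
  -- integrated over length 4R with R ≥ 1.
  obtain ⟨A, hA⟩ : ∃ A, A = 3 * E₀ + E₁ + T * (K₀ * (2 * L * (2 * B)) + (8 * c + 16 * ε₁ * c ^ 2)) :=
    ⟨_, rfl⟩
  have hLp := h.hL
  have hA0 : 0 ≤ A := by rw [hA]; positivity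
  -- A factor that raises both dissipation coefficients, θ² and ½, to at least 1.
  obtain ⟨q, hq⟩ : ∃ q, q = 2 + 1 / theta γ ^ 2 := ⟨_, rfl⟩
  have hq1 : 2 ≤ q := by rw [hq]; linarith [(by positivity : 0 ≤ 1 / theta γ ^ 2)]
  have hq2 : 1 ≤ q * theta γ ^ 2 := by
    rw [hq, add_mul, one_div, inv_mul_cancel₀ (by positivity)]
    linarith [(by positivity : 0 ≤ 2 * theta γ ^ 2)]
  refine ⟨q * (Real.exp (C₀ * T) * A), by positivity, ?_⟩
  intro ε r u rx ux rxx uxx hε hεε F hfar hE hG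
  obtain ⟨U, hU0, hU⟩ := hfar.exists_bound F.cont_u T
  obtain ⟨M₁, hM₁⟩ := exists_stateFlux_le (γ := γ) hL hR hfar h T
  -- the weight
  obtain ⟨w, hw⟩ : ∃ w : ℝ → ℝ, w = fun t => Real.exp (-C₀ * t) := ⟨_, rfl⟩
  have hw0 : ∀ t, 0 < w t := fun t => by rw [hw]; exact Real.exp_pos _
  have hw1 : ∀ t, 0 ≤ t → w t ≤ 1 := fun t ht => by
    rw [hw]; exact Real.exp_le_one_iff.2 (by nlinarith)
  have hwT : ∀ t ∈ Icc 0 T, 1 ≤ Real.exp (C₀ * T) * w t := fun t ht => by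
    rw [hw]
    simp only
    rw [← Real.exp_add]
    exact Real.one_le_exp (by nlinarith [ht.2])
  have cw : Continuous w := by rw [hw]; fun_prop
  -- The exponential replaces Gronwall's lemma: the derivative -C₀w of the weight cancels the part
  -- of the profile terms that is proportional to the energy.
  have dw : ∀ t, HasDerivAt w (-C₀ * w t) t := fun t => by
    rw [hw]
    simpa [mul_comm] using ((hasDerivAt_id t).const_mul (-C₀)).exp
  -- functions of the flow
  have cr1 := F.continuous_rpow (γ - 1)
  have cr2 := F.continuous_rpow (γ - 2)
  have cr3 := F.continuous_rpow (γ - 3)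
  have crg := F.continuous_rpow γ
  have cr := F.cont_r
  have cu := F.cont_u
  have crx := F.cont_rx
  have cux := F.cont_ux
  have cuxx := F.cont_uxx
  have cz := F.continuous_drift
  have czx := F.continuous_driftX
  have crb := h.cont_rb
  have cub := h.cont_ub
  have crbx := h.cont_rbx
  have cubx := h.cont_ubx
  have crb1 : Continuous fun x => rb x ^ (γ - 1) := crb.rpow_const fun x => Or.inl (h.rb_pos x).ne'
  have crb2 : Continuous fun x => rb x ^ (γ - 2) := crb.rpow_const fun x => Or.inl (h.rb_pos x).ne'
  have crbg : Continuous fun x => rb x ^ γ := crb.rpow_const fun x => Or.inl (h.rb_pos x).ne'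
  have hr0 : ∀ t x, r t x ≠ 0 := fun t x => (F.pos t x).ne'
  have cq : Continuous fun p : ℝ × ℝ => ε * uxx p.1 p.2 / r p.1 p.2 :=
    (cuxx.const_mul ε).div cr fun p => hr0 _ _
  have cE : Continuous fun p : ℝ × ℝ => relativeEnergy γ (r p.1 p.2) (rb p.2) :=
    continuous_relativeEnergy hγ cr (crb.comp continuous_snd)
  have hEn : ∀ t x, 0 ≤ relativeEnergy γ (r t x) (rb x) := fun t x =>
    relativeEnergy_nonneg hγ (F.pos t x) (h.rb_pos x)
  have ced : ∀ t, Continuous (energyDensity γ rb ub r u t) := fun t => by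
    unfold energyDensity
    have : Continuous fun x => relativeEnergy γ (r t x) (rb x) :=
      continuous_relativeEnergy hγ (by fun_prop) crb
    fun_prop
  have hed : ∀ t x, 0 ≤ energyDensity γ rb ub r u t x := fun t x => by
    have := (F.pos t x).le
    exact add_nonneg (by positivity) (hEn t x)
  obtain ⟨d, hd⟩ : ∃ d : ℝ → ℝ → ℝ, ∀ t x, d t x =
      theta γ ^ 2 * (ε * (r t x ^ (γ - 3) * rx t x ^ 2)) + 1 / 2 * (ε * ux t x ^ 2) :=
    ⟨_, fun _ _ => rfl⟩
  have cd : Continuous fun p : ℝ × ℝ => d p.1 p.2 := by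
    simp only [hd]; fun_prop
  have hd0 : ∀ t x, 0 ≤ d t x := fun t x => by
    rw [hd]
    have := (F.pos t x).le
    positivity
  -- the balance on a large interval
  have main : ∀ R, 1 ≤ R → L ≤ R → M₁ ≤ R - U * T → ∀ t ∈ Icc 0 T,
      (∫ x in -(2 * R)..(2 * R), energyDensity γ rb ub r u t x * (w t * cut R U t x ^ 2))
        + (∫ τ in 0..t, ∫ x in -(2 * R)..(2 * R), w τ * cut R U τ x ^ 2 *
          d τ x) ≤ A := by
    intro R hR1 hRL hRM t ht
    have hR0 : 0 < R := by linarith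
    have cA := continuous_cut R U
    have cAt := continuous_cutT R U
    have cAx := continuous_cutX R U
    have ha : ∀ τ x, |cutX R U τ x| ≤ c / R := abs_cutX_le hc hR0 U
    have hbal := energy_balance (r := r) (u := u) (rx := rx) (ux := ux) (uxx := uxx)
      (z := drift ε r rx) (zx := driftX ε r rx rxx)
      (g := fun t x => theta γ ^ 2 * r t x ^ (γ - 2) * rx t x)
      (E := fun t x => relativeEnergy γ (r t x) (rb x)) (p := fun t x => pressure γ (r t x))
      (e := fun t x => theta γ / 2 * r t x ^ (γ - 1)) (φ := fun t x => w t * cut R U t x ^ 2)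
      (φt := fun t x => -C₀ * (w t * cut R U t x ^ 2) + w t * (2 * cut R U t x * cutT R U t x))
      (φx := fun t x => w t * (2 * cut R U t x * cutX R U t x))
      (rt := fun t x => -(rx t x * u t x + r t x * ux t x))
      (ut := fun t x => ε * uxx t x / r t x - u t x * ux t x
        - theta γ ^ 2 * r t x ^ (γ - 2) * rx t x)
      (zt := fun t x => -(u t x * driftX ε r rx rxx t x) - ε * uxx t x / r t x)
      (S := fun t x => -(w t * cut R U t x ^ 2 * d t x)
          + K₀ * (|ubx x| + |rbx x|) + (2 * (c / R) + 4 * ε₁ * (c / R) ^ 2))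
      (ub := ub) (ubx := ubx) (pb := fun x => pressure γ (rb x))
      (pbx := fun x => theta γ ^ 2 * rb x ^ (γ - 1) * rbx x)
      (eb := fun x => theta γ / 2 * rb x ^ (γ - 1))
      (ebx := fun x => theta γ ^ 2 * rb x ^ (γ - 2) * rbx x) (ε := ε) (T := t) (M := 2 * R)
      ht.1 (by linarith) cr cu crx cux cuxx cz czx (by fun_prop) cE
      (by unfold pressure; fun_prop) (by fun_prop) (by fun_prop) (by fun_prop) (by fun_prop)
      (by fun_prop) (by fun_prop) (by fun_prop) (by fun_prop) cub cubx
      (by unfold pressure; fun_prop) (by fun_prop) (by fun_prop) (by fun_prop) hr0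
      (fun _ _ => rfl) (fun _ _ => rfl) (fun _ _ => rfl) F.hrt F.hut
      (fun τ x hτ => F.hasDerivAt_drift_t hτ x)
      (fun τ x hτ => (hasDerivAt_relativeEnergy hγ (F.hrt τ x hτ)).congr_deriv (by ring))
      (fun τ x hτ => ((dw τ).fun_mul ((hasDerivAt_cut_t R U τ x).fun_pow 2)).congr_deriv
        (by push_cast; ring))
      F.hrx F.hux F.huxx F.hasDerivAt_drift_x ?_ ?_
      (fun τ x => (((hasDerivAt_cut_x R U τ x).fun_pow 2).const_mul (w τ)).congr_deriv
        (by push_cast; ring))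
      h.hub (fun x => hasDerivAt_pressure hγ (h.hrb x)) ?_
      (fun τ hτ => by simp only [cut_left hR0 hU0 hτ.1]; ring)
      (fun τ hτ => by simp only [cut_right hR0 hU0 hτ.1]; ring) ?_
    · -- consequences of the balance
      have i1 : ∫ x in -(2 * R)..(2 * R), energyDensity γ rb ub r u t x * (w t * cut R U t x ^ 2)
          ≤ ∫ x in -(2 * R)..(2 * R), (1 / 2 * (r t x * (u t x - ub x) ^ 2)
            + 1 / 2 * (r t x * (u t x - ub x + drift ε r rx t x) ^ 2)
            + 2 * relativeEnergy γ (r t x) (rb x)) * (w t * cut R U t x ^ 2) := by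
        have c1 := ced t
        have c2 : Continuous fun x => relativeEnergy γ (r t x) (rb x) :=
          continuous_relativeEnergy hγ (by fun_prop) crb
        refine intervalIntegral.integral_mono_on (by linarith)
          (Continuous.intervalIntegrable (by fun_prop) _ _)
          (Continuous.intervalIntegrable (by fun_prop) _ _) fun x _ => ?_
        refine mul_le_mul_of_nonneg_right ?_ (mul_nonneg (hw0 t).le (sq_nonneg _))
        have e1 : 0 ≤ 1 / 2 * (r t x * (u t x - ub x + drift ε r rx t x) ^ 2) := by
          have := (F.pos t x).le
          positivity
        unfold energyDensity
        linarith [hEn t x]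
      have i2 : ∫ x in -(2 * R)..(2 * R), (1 / 2 * (r 0 x * (u 0 x - ub x) ^ 2)
            + 1 / 2 * (r 0 x * (u 0 x - ub x + drift ε r rx 0 x) ^ 2)
            + 2 * relativeEnergy γ (r 0 x) (rb x)) * (w 0 * cut R U 0 x ^ 2)
          ≤ 3 * E₀ + E₁ := by
        have c1 := ced 0
        have c2 : Continuous fun x => relativeEnergy γ (r 0 x) (rb x) :=
          continuous_relativeEnergy hγ (by fun_prop) crb
        have c3 : Continuous fun x => ε ^ 2 * (rx 0 x ^ 2 / r 0 x ^ 3) :=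
          ((Continuous.div (by fun_prop) (by fun_prop) fun x =>
            pow_ne_zero 3 (hr0 0 x))).const_mul _
        calc _ ≤ ∫ x in -(2 * R)..(2 * R), (3 * energyDensity γ rb ub r u 0 x
              + ε ^ 2 * (rx 0 x ^ 2 / r 0 x ^ 3)) := by
              refine intervalIntegral.integral_mono_on (by linarith)
                (Continuous.intervalIntegrable (by fun_prop) _ _)
                (Continuous.intervalIntegrable (by fun_prop) _ _) fun x _ => ?_
              have hrp := F.pos 0 x
              have e1 : r 0 x * drift ε r rx 0 x ^ 2 = ε ^ 2 * (rx 0 x ^ 2 / r 0 x ^ 3) := by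
                unfold drift; field_simp
              have e2 : 0 ≤ r 0 x * (u 0 x - ub x - drift ε r rx 0 x) ^ 2 := by positivity
              have e3 : w 0 * cut R U 0 x ^ 2 ≤ 1 := mul_le_one₀ (hw1 0 le_rfl) (sq_nonneg _)
                (pow_le_one₀ (cut_nonneg _ _ _ _) (cut_le_one _ _ _ _))
              have e4 : 0 ≤ 1 / 2 * (r 0 x * (u 0 x - ub x) ^ 2)
                + 1 / 2 * (r 0 x * (u 0 x - ub x + drift ε r rx 0 x) ^ 2)
                + 2 * relativeEnergy γ (r 0 x) (rb x) :=
                add_nonneg (by positivity) (mul_nonneg zero_le_two (hEn 0 x))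
              refine (mul_le_of_le_one_right e4 e3).trans ?_
              rw [← e1]
              unfold energyDensity
              nlinarith [hEn 0 x]
          _ = 3 * (∫ x in -(2 * R)..(2 * R), energyDensity γ rb ub r u 0 x)
              + ∫ x in -(2 * R)..(2 * R), ε ^ 2 * (rx 0 x ^ 2 / r 0 x ^ 3) := by
              rw [intervalIntegral.integral_add ((c1.const_mul 3).intervalIntegrable _ _)
                (c3.intervalIntegrable _ _), intervalIntegral.integral_const_mul]
          _ ≤ 3 * E₀ + E₁ := by
              have := hE (2 * R) (by linarith)
              have := hG (2 * R) (by linarith)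
              linarith
      have i3 : ∀ τ, ∫ x in -(2 * R)..(2 * R), (-(w τ * cut R U τ x ^ 2 * d τ x)
          + K₀ * (|ubx x| + |rbx x|) + (2 * (c / R) + 4 * ε₁ * (c / R) ^ 2))
          ≤ -(∫ x in -(2 * R)..(2 * R), w τ * cut R U τ x ^ 2 *
          d τ x)
          + (K₀ * (2 * L * (2 * B)) + (8 * c + 16 * ε₁ * c ^ 2)) := by
        intro τ
        have c1 : Continuous fun x => w τ * cut R U τ x ^ 2 *
          d τ x := by
          fun_prop
        have c2 : Continuous fun x => |ubx x| + |rbx x| := by fun_prop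
        have e1 := integral_neg_add_mul_add c1 c2 (-(2 * R)) (2 * R) K₀
          (2 * (c / R) + 4 * ε₁ * (c / R) ^ 2)
        rw [e1]
        have e2 := integral_le_of_eq_zero_outside c2 hLp.le (N := 2 * R) (B := 2 * B)
          (by linarith) (fun x => by linarith [h.ubx_le x, h.rbx_le x])
          (fun x hx => by simp [(h.right x hx).2.2.1, (h.right x hx).2.2.2])
          (fun x hx => by simp [(h.left x hx).2.2.1, (h.left x hx).2.2.2])
        have e3 : (2 * R - -(2 * R)) * (2 * (c / R) + 4 * ε₁ * (c / R) ^ 2)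
            ≤ 8 * c + 16 * ε₁ * c ^ 2 := by
          have : (2 * R - -(2 * R)) * (2 * (c / R) + 4 * ε₁ * (c / R) ^ 2)
            = 8 * c + 16 * ε₁ * c ^ 2 / R := by field_simp; ring
          rw [this]
          have := div_le_self (by positivity : 0 ≤ 16 * ε₁ * c ^ 2) hR1
          linarith
        nlinarith [mul_le_mul_of_nonneg_left e2 hK₀]
      have c4 : Continuous fun τ => ∫ x in -(2 * R)..(2 * R), w τ * cut R U τ x ^ 2 *
          d τ x :=
        continuous_integral_strip (F := fun τ x => w τ * cut R U τ x ^ 2 *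
          d τ x)
          (by fun_prop) _ _
      have c5 : Continuous fun τ => ∫ x in -(2 * R)..(2 * R), (-(w τ * cut R U τ x ^ 2 * d τ x)
          + K₀ * (|ubx x| + |rbx x|) + (2 * (c / R) + 4 * ε₁ * (c / R) ^ 2)) :=
        continuous_integral_strip (F := fun τ x => (-(w τ * cut R U τ x ^ 2 * d τ x)
          + K₀ * (|ubx x| + |rbx x|) + (2 * (c / R) + 4 * ε₁ * (c / R) ^ 2)))
          (by fun_prop) _ _
      have i4 := intervalIntegral.integral_mono_on (μ := volume) ht.1 (c5.intervalIntegrable 0 t)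
        ((c4.neg.add continuous_const).intervalIntegrable 0 t) fun τ _ => i3 τ
      have i6 := integral_neg_add_mul_add c4 (continuous_const (y := (0 : ℝ))) 0 t 0
        (K₀ * (2 * L * (2 * B)) + (8 * c + 16 * ε₁ * c ^ 2))
      simp only [mul_zero, zero_mul, add_zero, sub_zero] at i6
      replace i4 := i4.trans_eq i6
      have i5 : t * (K₀ * (2 * L * (2 * B)) + (8 * c + 16 * ε₁ * c ^ 2))
          ≤ T * (K₀ * (2 * L * (2 * B)) + (8 * c + 16 * ε₁ * c ^ 2)) :=
        mul_le_mul_of_nonneg_right ht.2 (by positivity)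
      rw [hA]
      linarith
    · intro τ x
      refine (((F.hrx τ x).rpow_const (p := γ - 1) (Or.inl (hr0 τ x))).const_mul
        (theta γ / 2)).congr_deriv ?_
      rw [show γ - 1 - 1 = γ - 2 by ring, show γ - 1 = 2 * theta γ by unfold theta; ring]
      ring
    · intro τ x
      refine (hasDerivAt_pressure hγ (F.hrx τ x)).congr_deriv ?_
      have : r τ x ^ (γ - 1) = r τ x ^ (γ - 2) * r τ x := by
        rw [← Real.rpow_add_one (hr0 τ x)]; congr 1; ring
      rw [this]; ring
    · intro x
      refine (((h.hrb x).rpow_const (p := γ - 1) (Or.inl (h.rb_pos x).ne')).const_mul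
        (theta γ / 2)).congr_deriv ?_
      rw [show γ - 1 - 1 = γ - 2 by ring, show γ - 1 = 2 * theta γ by unfold theta; ring]
      ring
    · intro τ hτ x _
      have hτT : τ ∈ Icc 0 T := ⟨hτ.1, hτ.2.trans ht.2⟩
      have hrp := F.pos τ x
      have hX := hloc x (r τ x) (u τ x - ub x) (u τ x - ub x + drift ε r rx τ x) (ux τ x) ε
        hrp hε hεε
      rw [sub_add_cancel] at hX
      -- The work of the pressure gradient on the drift is the dissipation of the density gradient.
      have hz : drift ε r rx τ x * (r τ x * (theta γ ^ 2 * r τ x ^ (γ - 2) * rx τ x))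
          = theta γ ^ 2 * (ε * (r τ x ^ (γ - 3) * rx τ x ^ 2)) := by
        have e : r τ x ^ (γ - 2) = r τ x ^ (γ - 3) * r τ x := by
          rw [← Real.rpow_add_one (hr0 τ x)]; congr 1; ring
        unfold drift
        rw [e]
        field_simp
      rw [hz, hd]
      refine energy_rate_le hrp (hEn τ x) (hw0 τ) (hw1 τ hτ.1) (cut_nonneg _ _ _ _)
        (cut_le_one _ _ _ _) (hU τ hτT x) (fun v hv => cut_transport hR0 hv τ x) hε hεε
        (by positivity) hX (ha τ x) fun hne => ?_
      have hx : M₁ ≤ |x| := by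
        by_contra hcon
        refine hne (cutX_eq_zero hR0 ?_)
        have : U * τ ≤ U * T := mul_le_mul_of_nonneg_left hτT.2 hU0
        linarith [not_le.1 hcon]
      exact hM₁ τ hτT x hx
  -- a suitable interval
  have hRex : ∀ M, ∃ R, 1 ≤ R ∧ L ≤ R ∧ M₁ ≤ R - U * T ∧ M ≤ R - U * T := fun M => by
    have hUT : 0 ≤ U * T := by positivity
    refine ⟨max (max 1 L) (max M₁ M) + U * T, ?_, ?_, ?_, ?_⟩
    · linarith [(le_max_left 1 L).trans (le_max_left _ (max M₁ M))]
    · linarith [(le_max_right 1 L).trans (le_max_left _ (max M₁ M))]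
    · linarith [(le_max_left M₁ M).trans (le_max_right (max 1 L) _)]
    · linarith [(le_max_right M₁ M).trans (le_max_right (max 1 L) _)]
  have hcut1 : ∀ M R t x, 1 ≤ R → M ≤ R - U * T → t ∈ Icc 0 T → x ∈ Icc (-M) M →
      1 ≤ Real.exp (C₀ * T) * (w t * cut R U t x ^ 2) := by
    intro M R t x hR1 hM ht hx
    rw [cut_eq_one (by linarith)]
    · rw [one_pow, mul_one]; exact hwT t ht
    · have : U * t ≤ U * T := mul_le_mul_of_nonneg_left ht.2 hU0
      exact abs_le.2 ⟨by linarith [hx.1], by linarith [hx.2]⟩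
  have hexp : 0 < Real.exp (C₀ * T) := Real.exp_pos _
  refine ⟨fun t ht M hM => ?_, fun M hM => ?_⟩
  · obtain ⟨R, hR1, hRL, hRM₁, hRM⟩ := hRex M
    have hmain := main R hR1 hRL hRM₁ t ht
    have cA := continuous_cut R U
    have c1 := ced t
    have hUT : 0 ≤ U * T := by positivity
    have n1 : 0 ≤ ∫ τ in 0..t, ∫ x in -(2 * R)..(2 * R), w τ * cut R U τ x ^ 2 *
          d τ x := by
      refine intervalIntegral.integral_nonneg ht.1 fun τ _ =>
        intervalIntegral.integral_nonneg (by linarith) fun x _ => ?_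
      have := (hw0 τ).le
      have := hd0 τ x
      positivity
    have c2 : Continuous fun x => energyDensity γ rb ub r u t x * (w t * cut R U t x ^ 2) := by
      fun_prop
    calc ∫ x in -M..M, energyDensity γ rb ub r u t x
        ≤ ∫ x in -M..M, Real.exp (C₀ * T) *
            (energyDensity γ rb ub r u t x * (w t * cut R U t x ^ 2)) := by
          refine intervalIntegral.integral_mono_on (by linarith) (c1.intervalIntegrable _ _)
            ((c2.const_mul _).intervalIntegrable _ _) fun x hx => ?_
          have := mul_le_mul_of_nonneg_left (hcut1 M R t x hR1 hRM ht hx) (hed t x)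
          linarith
      _ ≤ ∫ x in -(2 * R)..(2 * R), Real.exp (C₀ * T) *
            (energyDensity γ rb ub r u t x * (w t * cut R U t x ^ 2)) :=
          integral_le_of_subinterval (c2.const_mul _) hM (by linarith) fun x => by
            have := (hw0 t).le
            have := hed t x
            positivity
      _ ≤ Real.exp (C₀ * T) * A := by
          rw [intervalIntegral.integral_const_mul]
          exact mul_le_mul_of_nonneg_left (by linarith) hexp.le
      _ ≤ q * (Real.exp (C₀ * T) * A) :=
          le_mul_of_one_le_left (by positivity) (by linarith)
  · obtain ⟨R, hR1, hRL, hRM₁, hRM⟩ := hRex M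
    have hmain := main R hR1 hRL hRM₁ T ⟨hT, le_rfl⟩
    have cA := continuous_cut R U
    have c1 := ced T
    have hUT : 0 ≤ U * T := by positivity
    have n1 : 0 ≤ ∫ x in -(2 * R)..(2 * R),
        energyDensity γ rb ub r u T x * (w T * cut R U T x ^ 2) := by
      refine intervalIntegral.integral_nonneg (by linarith) fun x _ => ?_
      have := (hw0 T).le
      have := hed T x
      positivity
    have cqd : Continuous fun p : ℝ × ℝ => q * Real.exp (C₀ * T)
        * (w p.1 * cut R U p.1 p.2 ^ 2 * d p.1 p.2) := by fun_prop
    have hnn : ∀ τ x, 0 ≤ q * Real.exp (C₀ * T) * (w τ * cut R U τ x ^ 2 *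
          d τ x) := fun τ x => by
      have := (hw0 τ).le
      have := hd0 τ x
      positivity
    have cl : Continuous fun p : ℝ × ℝ =>
      ε * (ux p.1 p.2 ^ 2 + r p.1 p.2 ^ (γ - 3) * rx p.1 p.2 ^ 2) := by fun_prop
    calc ∫ t in 0..T, ∫ x in -M..M, ε * (ux t x ^ 2 + r t x ^ (γ - 3) * rx t x ^ 2)
        ≤ ∫ t in 0..T, ∫ x in -(2 * R)..(2 * R), q * Real.exp (C₀ * T) *
          (w t * cut R U t x ^ 2 * d t x) := by
          refine intervalIntegral.integral_mono_on hT
            ((continuous_integral_strip (F := fun t x => ε * (ux t x ^ 2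
              + r t x ^ (γ - 3) * rx t x ^ 2)) cl _ _).intervalIntegrable _ _)
            ((continuous_integral_strip (F := fun t x => q * Real.exp (C₀ * T) *
              (w t * cut R U t x ^ 2 * d t x)) cqd _ _).intervalIntegrable _ _) fun t ht => ?_
          refine le_trans ?_ (integral_le_of_subinterval (M := M) (N := 2 * R) (f := fun x =>
            q * Real.exp (C₀ * T) * (w t * cut R U t x ^ 2 *
            d t x)) (by fun_prop) hM (by linarith) (hnn t))
          refine intervalIntegral.integral_mono_on (by linarith)
            ((cl.comp (continuous_const.prodMk continuous_id)).intervalIntegrable _ _)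
            (Continuous.intervalIntegrable (by fun_prop) _ _) fun x hx => ?_
          simp only [hd]
          have e1 := hcut1 M R t x hR1 hRM ht hx
          have hrp := (F.pos t x).le
          have e2 : 0 ≤ ε * ux t x ^ 2 := by positivity
          have e3 : 0 ≤ ε * (r t x ^ (γ - 3) * rx t x ^ 2) := by positivity
          set a := ε * ux t x ^ 2
          set b := ε * (r t x ^ (γ - 3) * rx t x ^ 2)
          have e4 : a + b ≤ q * (theta γ ^ 2 * b + 1 / 2 * a) := by
            nlinarith [mul_le_mul_of_nonneg_right hq2 e3, mul_le_mul_of_nonneg_right hq1 e2]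
          have e5 : 0 ≤ q * (theta γ ^ 2 * b + 1 / 2 * a) := by linarith
          calc ε * (ux t x ^ 2 + r t x ^ (γ - 3) * rx t x ^ 2) = a + b := by ring
            _ ≤ q * (theta γ ^ 2 * b + 1 / 2 * a) := e4
            _ ≤ (Real.exp (C₀ * T) * (w t * cut R U t x ^ 2))
                * (q * (theta γ ^ 2 * b + 1 / 2 * a)) := le_mul_of_one_le_left e5 e1
            _ = _ := by ring
      _ = q * Real.exp (C₀ * T) * ∫ t in 0..T, ∫ x in -(2 * R)..(2 * R),
          (w t * cut R U t x ^ 2 * d t x) := by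
          simp only [intervalIntegral.integral_const_mul]
      _ ≤ q * Real.exp (C₀ * T) * A :=
          mul_le_mul_of_nonneg_left (by linarith) (by positivity)
      _ = _ := by ring

/-! ## Higher integrability of the density -/

/-- Beyond the threshold δ^(-1/(b-a)) the higher power wins; the constant is the value of r^a at the
threshold. -/
theorem exists_rpow_le_mul_rpow_add {a b δ : ℝ} (ha : 0 ≤ a) (hab : a < b) (hδ : 0 < δ) :
    ∃ C : ℝ, 0 ≤ C ∧ ∀ r : ℝ, 0 < r → r ^ a ≤ δ * r ^ b + C := by
  refine ⟨((1 / δ) ^ (1 / (b - a))) ^ a, by positivity, fun r hr => ?_⟩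
  have hba : 0 < b - a := by linarith
  have h0 : 0 < r ^ b := by positivity
  by_cases h : r ≤ (1 / δ) ^ (1 / (b - a))
  · have := Real.rpow_le_rpow hr.le h ha
    nlinarith
  · have h1 : 1 / δ ≤ r ^ (b - a) := by
      have := Real.rpow_le_rpow (by positivity) (not_le.1 h).le hba.le
      rwa [← Real.rpow_mul (by positivity), one_div_mul_cancel hba.ne', Real.rpow_one] at this
    have h2 : r ^ a ≤ δ * r ^ b := by
      have e : r ^ b = r ^ (b - a) * r ^ a := by rw [← Real.rpow_add hr]; congr 1; ring
      have ha0 : 0 < r ^ a := by positivity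
      rw [e, ← mul_assoc]
      refine le_mul_of_one_le_left ha0.le ?_
      rwa [div_le_iff₀' hδ] at h1
    have h3 : 0 ≤ ((1 / δ) ^ (1 / (b - a))) ^ a := by positivity
    linarith

/-- The energy density controls all moments of the state up to the energy. -/
theorem exists_moments_le {γ : ℝ} (hγ : 1 < γ) {s : EndStates} {rb ub rbx ubx : ℝ → ℝ}
    {m B L : ℝ} (h : ProfileBounds s rb ub rbx ubx m B L) :
    ∃ A : ℝ, 0 ≤ A ∧ ∀ x r u : ℝ, 0 < r → r + r * |u| + r * u ^ 2 + r ^ γ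
      ≤ A * (1 + (1 / 2 * (r * (u - ub x) ^ 2) + relativeEnergy γ r (rb x))) := by
  obtain ⟨N, hN0, hN⟩ := exists_rpow_le_relativeEnergy hγ B
  have hB := h.hB
  refine ⟨8 + 4 * B ^ 2 + (3 + 4 * B ^ 2) * N, by positivity, fun x r u hr => ?_⟩
  have hp := hN r (rb x) hr (h.rb_pos x) (h.rb_upper x)
  have hE := relativeEnergy_nonneg hγ hr (h.rb_pos x)
  have hr1 := le_one_add_rpow hγ.le hr.le
  set E := relativeEnergy γ r (rb x)
  have hb2 : ub x ^ 2 ≤ B ^ 2 := sq_le_sq' (abs_le.1 (h.ub_le x)).1 (abs_le.1 (h.ub_le x)).2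
  have e1 : |u| ≤ 1 + u ^ 2 := by rw [← sq_abs u]; nlinarith [sq_nonneg (|u| - 1), abs_nonneg u]
  have e2 : u ^ 2 ≤ 2 * (u - ub x) ^ 2 + 2 * B ^ 2 := by nlinarith [sq_nonneg (u - 2 * ub x)]
  have e3 := mul_le_mul_of_nonneg_left e1 hr.le
  have e4 := mul_le_mul_of_nonneg_left e2 hr.le
  have e5 := mul_le_mul_of_nonneg_left hr1 (by positivity : 0 ≤ 2 + 4 * B ^ 2)
  have e6 := mul_le_mul_of_nonneg_left hp (by positivity : 0 ≤ 3 + 4 * B ^ 2)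
  have q : 0 ≤ r * (u - ub x) ^ 2 := by positivity
  have q1 : 0 ≤ B ^ 2 * (r * (u - ub x) ^ 2) := by positivity
  have q2 : 0 ≤ N * (r * (u - ub x) ^ 2) := by positivity
  have q3 : 0 ≤ B ^ 2 * N * (r * (u - ub x) ^ 2) := by positivity
  have q4 : 0 ≤ B ^ 2 * E := by positivity
  have q5 : 0 ≤ B ^ 2 := by positivity
  nlinarith

theorem integral_moments_le {γ ε T C N A : ℝ} (hγ : 1 < γ) {s : EndStates}
    {rb ub rbx ubx : ℝ → ℝ} {m B L : ℝ} (h : ProfileBounds s rb ub rbx ubx m B L)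
    {r u rx ux rxx uxx : ℝ → ℝ → ℝ} (F : Flow γ ε r u rx ux rxx uxx)
    (hEB : EnergyBounds γ ε T C rb ub r u rx ux) (hN : 0 ≤ N) (hA : 0 ≤ A)
    (hmom : ∀ x r u : ℝ, 0 < r → r + r * |u| + r * u ^ 2 + r ^ γ
      ≤ A * (1 + (1 / 2 * (r * (u - ub x) ^ 2) + relativeEnergy γ r (rb x))))
    {t : ℝ} (ht : t ∈ Icc 0 T) :
    ∫ x in -N..N, (r t x + r t x * |u t x| + r t x * u t x ^ 2 + r t x ^ γ) ≤ A * (2 * N + C) := by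
  have cr := F.cont_r
  have cu := F.cont_u
  have crg : Continuous fun x => r t x ^ γ :=
    (F.continuous_rpow γ).comp (continuous_const.prodMk continuous_id)
  have cub := h.cont_ub
  have c1 : Continuous (energyDensity γ rb ub r u t) := by
    unfold energyDensity
    have : Continuous fun x => relativeEnergy γ (r t x) (rb x) :=
      continuous_relativeEnergy hγ (by fun_prop) h.cont_rb
    fun_prop
  calc ∫ x in -N..N, (r t x + r t x * |u t x| + r t x * u t x ^ 2 + r t x ^ γ)
      ≤ ∫ x in -N..N, A * (1 + energyDensity γ rb ub r u t x) :=
        intervalIntegral.integral_mono_on (by linarith)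
          (Continuous.intervalIntegrable (by fun_prop) _ _)
          (Continuous.intervalIntegrable (by fun_prop) _ _)
          fun x _ => hmom x (r t x) (u t x) (F.pos t x)
    _ = A * (2 * N + ∫ x in -N..N, energyDensity γ rb ub r u t x) := by
        rw [intervalIntegral.integral_const_mul, intervalIntegral.integral_add (by simp)
          (c1.intervalIntegrable _ _), intervalIntegral.integral_const]
        simp only [smul_eq_mul]; ring
    _ ≤ A * (2 * N + C) := by gcongr; exact hEB.energy t ht N hN

theorem Flow.hasDerivAt_momentum {γ ε : ℝ} {r u rx ux rxx uxx : ℝ → ℝ → ℝ}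
    (F : Flow γ ε r u rx ux rxx uxx) {t : ℝ} (ht : 0 < t) (x : ℝ) :
    HasDerivAt (fun τ => r τ x * u τ x)
      (ε * uxx t x - (rx t x * u t x ^ 2 + r t x * (2 * u t x * ux t x)
        + theta γ ^ 2 * r t x ^ (γ - 1) * rx t x)) t := by
  have hr := (F.pos t x).ne'
  refine ((F.hrt t x ht).fun_mul (F.hut t x ht)).congr_deriv ?_
  have : r t x ^ (γ - 1) = r t x ^ (γ - 2) * r t x := by
    rw [← Real.rpow_add_one hr]; congr 1; ring
  rw [this]
  field_simp
  ring

/-! ### The momentum potential. -/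

section Potential

variable {γ ε : ℝ} {r u rx ux rxx uxx : ℝ → ℝ → ℝ}

/-- The localized momentum potential `∫_{-N}^x ρ u ζ`. -/
def momPot (r u : ℝ → ℝ → ℝ) (ζ : ℝ → ℝ) (N t x : ℝ) : ℝ := ∫ y in -N..x, r t y * u t y * ζ y

/-- The remainder `∫_{-N}^x (ρ u² + p - ε u_x) ζ'` in the equation of the momentum potential. -/
def momRem (γ ε : ℝ) (r u ux : ℝ → ℝ → ℝ) (ζx : ℝ → ℝ) (N t x : ℝ) : ℝ :=
  ∫ y in -N..x, (r t y * u t y ^ 2 + pressure γ (r t y) - ε * ux t y) * ζx y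

theorem continuous_primitive {f : ℝ → ℝ → ℝ} (hf : Continuous fun p : ℝ × ℝ => f p.1 p.2) (a : ℝ) :
    Continuous fun p : ℝ × ℝ => ∫ y in a..p.2, f p.1 y :=
  intervalIntegral.continuous_parametric_primitive_of_continuous hf

theorem hasDerivAt_primitive {f : ℝ → ℝ} (hf : Continuous f) (a x : ℝ) :
    HasDerivAt (fun y => ∫ z in a..y, f z) (f x) x :=
  intervalIntegral.integral_hasDerivAt_right (hf.intervalIntegrable _ _)
    (hf.stronglyMeasurableAtFilter _ _) hf.continuousAt

/-- Integrating the momentum equation in x turns its flux into a boundary value at x, since ζ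
vanishes at -N. The derivative of ζ leaves the remainder `momRem`. -/
theorem Flow.hasDerivAt_momPot_t (hγ : 1 < γ) (F : Flow γ ε r u rx ux rxx uxx) {ζ ζx : ℝ → ℝ}
    (cζ : Continuous ζ) (cζx : Continuous ζx) (hζ : ∀ x, HasDerivAt ζ (ζx x) x) {N : ℝ}
    (hN : ζ (-N) = 0) {t : ℝ} (ht : 0 < t) (x : ℝ) :
    HasDerivAt (fun τ => momPot r u ζ N τ x)
      ((ε * ux t x - r t x * u t x ^ 2 - pressure γ (r t x)) * ζ x
        + momRem γ ε r u ux ζx N t x) t := by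
  have cr := F.cont_r
  have cu := F.cont_u
  have crx := F.cont_rx
  have cux := F.cont_ux
  have cuxx := F.cont_uxx
  have crg := F.continuous_rpow γ
  have cr1 := F.continuous_rpow (γ - 1)
  have h1 := hasDerivAt_intervalIntegral_of_continuous (a := -N) (b := x) (t := t) (s := Ioi 0)
    (F := fun τ y => r τ y * u τ y * ζ y)
    (F' := fun τ y => (ε * uxx τ y - (rx τ y * u τ y ^ 2 + r τ y * (2 * u τ y * ux τ y)
        + theta γ ^ 2 * r τ y ^ (γ - 1) * rx τ y)) * ζ y)
    (Ioi_mem_nhds ht) (by fun_prop) (by fun_prop)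
    (fun τ hτ y => (F.hasDerivAt_momentum hτ y).mul_const (ζ y))
  refine h1.congr_deriv ?_
  have h2 : ∀ y, HasDerivAt (fun y => (ε * ux t y - r t y * u t y ^ 2 - pressure γ (r t y)) * ζ y)
      ((ε * uxx t y - (rx t y * u t y ^ 2 + r t y * (2 * u t y * ux t y)
        + theta γ ^ 2 * r t y ^ (γ - 1) * rx t y)) * ζ y
        - (r t y * u t y ^ 2 + pressure γ (r t y) - ε * ux t y) * ζx y) y := by
    intro y
    refine (((((F.huxx t y).const_mul ε).fun_sub ((F.hrx t y).fun_mul ((F.hux t y).fun_pow 2))).fun_sub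
      (hasDerivAt_pressure hγ (F.hrx t y))).fun_mul (hζ y)).congr_deriv ?_
    push_cast
    ring
  have c1 : Continuous fun y => (ε * uxx t y - (rx t y * u t y ^ 2 + r t y * (2 * u t y * ux t y)
        + theta γ ^ 2 * r t y ^ (γ - 1) * rx t y)) * ζ y := by
    have : Continuous fun y => r t y ^ (γ - 1) := cr1.comp (continuous_const.prodMk continuous_id)
    fun_prop
  have c2 : Continuous fun y =>
      (r t y * u t y ^ 2 + pressure γ (r t y) - ε * ux t y) * ζx y := by
    unfold pressure
    have : Continuous fun y => r t y ^ γ := crg.comp (continuous_const.prodMk continuous_id)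
    fun_prop
  have h3 := intervalIntegral.integral_eq_sub_of_hasDerivAt (a := -N) (b := x) (fun y _ => h2 y)
    ((c1.sub c2).intervalIntegrable _ _)
  rw [intervalIntegral.integral_sub (c1.intervalIntegrable _ _) (c2.intervalIntegrable _ _),
    hN, mul_zero, sub_zero] at h3
  unfold momRem
  linarith

end Potential

set_option maxHeartbeats 1000000 in
-- Testing the equation of mass with the momentum potential g produces -ζ²ρp(ρ). The potential is
-- bounded by the integral of ρ|u|, its remainder by the energy and the dissipation, and (ρζg)_t
-- contributes only two bounded boundary values in time.
theorem exists_density_bound {γ : ℝ} (hγ : 1 < γ) {s : EndStates}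
    {rb ub rbx ubx : ℝ → ℝ} {m B L : ℝ}
    (h : ProfileBounds s rb ub rbx ubx m B L) {ε₁ C T K : ℝ} (hε₁ : 0 ≤ ε₁) (hC : 0 ≤ C)
    (hT : 0 ≤ T) (hK : 1 ≤ K) :
    ∃ C' : ℝ, ∀ (ε : ℝ) (r u rx ux rxx uxx : ℝ → ℝ → ℝ), 0 < ε → ε ≤ ε₁ →
      Flow γ ε r u rx ux rxx uxx → EnergyBounds γ ε T C rb ub r u rx ux →
      ∫ t in 0..T, ∫ x in -K..K, r t x ^ (γ + 1) ≤ C' := by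
  obtain ⟨c, hc0, hc⟩ := exists_stepDeriv_le
  obtain ⟨A, hA0, hA⟩ := exists_moments_le hγ h
  have hκ := kappa_pos hγ
  -- This δ makes ερ² ≤ (κ/2)ρ^(γ+1) + ε₁Cδ for all ε ≤ ε₁, so the viscous term consumes half of the
  -- pressure term.
  obtain ⟨Cδ, hCδ, hδ⟩ := exists_rpow_le_mul_rpow_add (a := 2) (b := γ + 1) zero_le_two
    (by linarith) (δ := kappa γ / 2 / (ε₁ + 1)) (by positivity)
  have hK0 : 0 < K := by linarith
  obtain ⟨C₁, hC₁⟩ : ∃ C₁, C₁ = A * (2 * (2 * K) + C) := ⟨_, rfl⟩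
  have hC₁0 : 0 ≤ C₁ := hC₁ ▸ by positivity
  -- The part of the bound of the remainder that does not involve the dissipation: c bounds ζ', and
  -- 4Kε₁ comes from ε|u_x| ≤ ε₁ + εu_x² on an interval of length 4K.
  obtain ⟨b, hb⟩ : ∃ b, b = c * ((1 + kappa γ) * C₁ + 4 * K * ε₁) := ⟨_, rfl⟩
  refine ⟨2 / kappa γ * (2 * C₁ ^ 2 + (C + T * (4 * K * (ε₁ * Cδ)) + (T * (b * C₁) + c * C * C₁)
    + T * (c * C₁ * C₁))), ?_⟩
  intro ε r u rx ux rxx uxx hε hεε F hEB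
  have cr := F.cont_r
  have cu := F.cont_u
  have crx := F.cont_rx
  have cux := F.cont_ux
  have crg := F.continuous_rpow γ
  have crg1 := F.continuous_rpow (γ + 1)
  have hrp := F.pos
  obtain ⟨ζ, hζ⟩ : ∃ ζ : ℝ → ℝ, ζ = cut K 0 0 := ⟨_, rfl⟩
  obtain ⟨ζx, hζx⟩ : ∃ ζx : ℝ → ℝ, ζx = cutX K 0 0 := ⟨_, rfl⟩
  have cζ : Continuous ζ := by
    rw [hζ]; exact (continuous_cut K 0).comp (continuous_const.prodMk continuous_id)
  have cζx : Continuous ζx := by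
    rw [hζx]; exact (continuous_cutX K 0).comp (continuous_const.prodMk continuous_id)
  have dζ : ∀ x, HasDerivAt ζ (ζx x) x := by rw [hζ, hζx]; exact hasDerivAt_cut_x K 0 0
  have ζ0 : ∀ x, 0 ≤ ζ x := by rw [hζ]; exact cut_nonneg K 0 0
  have ζ1 : ∀ x, ζ x ≤ 1 := by rw [hζ]; exact cut_le_one K 0 0
  have ζl : ζ (-(2 * K)) = 0 := by rw [hζ]; exact cut_left hK0 le_rfl le_rfl
  have ζr : ζ (2 * K) = 0 := by rw [hζ]; exact cut_right hK0 le_rfl le_rfl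
  have ζK : ∀ x ∈ Icc (-K) K, ζ x = 1 := fun x hx => by
    rw [hζ]; exact cut_eq_one hK0 (by simpa using abs_le.2 hx)
  have ζxc : ∀ x, |ζx x| ≤ c := fun x => by
    rw [hζx]
    exact (abs_cutX_le hc hK0 0 0 x).trans (div_le_self hc0.le hK)
  have hmom : ∀ t ∈ Icc 0 T, ∫ x in -(2 * K)..(2 * K),
      (r t x + r t x * |u t x| + r t x * u t x ^ 2 + r t x ^ γ) ≤ C₁ := fun t ht => by
    rw [hC₁]; exact integral_moments_le hγ h F hEB (by linarith) hA0 hA ht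
  obtain ⟨g, hg⟩ : ∃ g : ℝ → ℝ → ℝ, g = momPot r u ζ (2 * K) := ⟨_, rfl⟩
  obtain ⟨R, hR⟩ : ∃ R : ℝ → ℝ → ℝ, R = momRem γ ε r u ux ζx (2 * K) := ⟨_, rfl⟩
  have cp : Continuous fun p : ℝ × ℝ => pressure γ (r p.1 p.2) := by unfold pressure; fun_prop
  have cg : Continuous fun p : ℝ × ℝ => g p.1 p.2 := by
    rw [hg]
    exact continuous_primitive (f := fun t y => r t y * u t y * ζ y) (by fun_prop) _
  have cR : Continuous fun p : ℝ × ℝ => R p.1 p.2 := by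
    rw [hR]
    exact continuous_primitive (f := fun t y =>
      (r t y * u t y ^ 2 + pressure γ (r t y) - ε * ux t y) * ζx y) (by fun_prop) _
  have dgt : ∀ t x, 0 < t → HasDerivAt (fun τ => g τ x)
      ((ε * ux t x - r t x * u t x ^ 2 - pressure γ (r t x)) * ζ x + R t x) t := by
    intro t x ht
    rw [hg, hR]
    exact F.hasDerivAt_momPot_t hγ cζ cζx dζ ζl ht x
  have dgx : ∀ t x, HasDerivAt (fun y => g t y) (r t x * u t x * ζ x) x := by
    intro t x
    rw [hg]
    exact hasDerivAt_primitive (f := fun y => r t y * u t y * ζ y) (by fun_prop) _ x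
  obtain ⟨I, hI⟩ : ∃ I : ℝ → ℝ, I = fun t => ∫ x in -(2 * K)..(2 * K), ε * ux t x ^ 2 := ⟨_, rfl⟩
  have cI : Continuous I := by
    rw [hI]; exact continuous_integral_strip (F := fun t x => ε * ux t x ^ 2) (by fun_prop) _ _
  have hI0 : ∀ t, 0 ≤ I t := fun t => by
    rw [hI]; exact intervalIntegral.integral_nonneg (by linarith) fun x _ => by positivity
  have crt : ∀ (a : ℝ) t, Continuous fun x => r t x ^ a := fun a t =>
    (F.continuous_rpow a).comp (continuous_const.prodMk continuous_id)
  have cpt : ∀ t, Continuous fun x => pressure γ (r t x) := fun t =>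
    cp.comp (continuous_const.prodMk continuous_id)
  -- moments
  have m1 : ∀ t ∈ Icc 0 T, ∫ x in -(2 * K)..(2 * K), r t x ≤ C₁ := fun t ht => by
    have c1 := crt γ t
    refine le_trans (intervalIntegral.integral_mono_on (by linarith)
      (Continuous.intervalIntegrable (by fun_prop) _ _)
      (Continuous.intervalIntegrable (by fun_prop) _ _) fun x _ => ?_) (hmom t ht)
    have := (hrp t x).le
    have h1 : 0 ≤ r t x * |u t x| := by positivity
    have h2 : 0 ≤ r t x * u t x ^ 2 := by positivity
    have h3 : 0 ≤ r t x ^ γ := by positivity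
    linarith
  have m2 : ∀ t ∈ Icc 0 T, ∫ x in -(2 * K)..(2 * K), r t x * |u t x| ≤ C₁ := fun t ht => by
    have c1 := crt γ t
    refine le_trans (intervalIntegral.integral_mono_on (by linarith)
      (Continuous.intervalIntegrable (by fun_prop) _ _)
      (Continuous.intervalIntegrable (by fun_prop) _ _) fun x _ => ?_) (hmom t ht)
    have := (hrp t x).le
    have h2 : 0 ≤ r t x * u t x ^ 2 := by positivity
    have h3 : 0 ≤ r t x ^ γ := by positivity
    linarith
  have m3 : ∀ t ∈ Icc 0 T, ∫ x in -(2 * K)..(2 * K), (r t x * u t x ^ 2 + pressure γ (r t x))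
      ≤ (1 + kappa γ) * C₁ := fun t ht => by
    have c1 := crt γ t
    have c2 := cpt t
    refine le_trans (intervalIntegral.integral_mono_on (by linarith)
      (Continuous.intervalIntegrable (by fun_prop) _ _)
      (Continuous.intervalIntegrable (u := fun x => (1 + kappa γ) *
        (r t x + r t x * |u t x| + r t x * u t x ^ 2 + r t x ^ γ)) (by fun_prop) _ _)
      fun x _ => ?_) ((intervalIntegral.integral_const_mul _ _).le.trans
        (mul_le_mul_of_nonneg_left (hmom t ht) (by positivity)))
    have := (hrp t x).le
    have h1 : 0 ≤ r t x * |u t x| := by positivity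
    have h2 : 0 ≤ r t x * u t x ^ 2 := by positivity
    have h3 : 0 ≤ r t x ^ γ := by positivity
    have h4 : 0 ≤ kappa γ * (r t x + r t x * |u t x| + r t x * u t x ^ 2) := by positivity
    unfold pressure
    linarith
  have gle : ∀ t ∈ Icc 0 T, ∀ x ∈ Icc (-(2 * K)) (2 * K), |g t x| ≤ C₁ := by
    intro t ht x hx
    rw [hg]
    refine (intervalIntegral.abs_integral_le_integral_abs hx.1).trans (le_trans ?_ (m2 t ht))
    refine (intervalIntegral.integral_mono_on hx.1 (Continuous.intervalIntegrable (by fun_prop) _ _)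
      (Continuous.intervalIntegrable (u := fun y => r t y * |u t y|) (by fun_prop) _ _)
      fun y _ => ?_).trans (intervalIntegral.integral_mono_interval le_rfl hx.1 hx.2
        (Eventually.of_forall fun y => mul_nonneg (hrp t y).le (abs_nonneg _))
        (Continuous.intervalIntegrable (by fun_prop) _ _))
    rw [abs_mul, abs_mul, abs_of_pos (hrp t y), abs_of_nonneg (ζ0 y)]
    exact mul_le_of_le_one_right (mul_nonneg (hrp t y).le (abs_nonneg _)) (ζ1 y)
  have Rle : ∀ t ∈ Icc 0 T, ∀ x ∈ Icc (-(2 * K)) (2 * K), |R t x| ≤ b + c * I t := by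
    intro t ht x hx
    rw [hR]
    have c2 := cpt t
    have hpp : ∀ y, 0 ≤ r t y * u t y ^ 2 + pressure γ (r t y) := fun y => by
      have := (hrp t y).le
      unfold pressure
      positivity
    refine (intervalIntegral.abs_integral_le_integral_abs hx.1).trans ?_
    have e1 : ∫ y in -(2 * K)..x,
        |(r t y * u t y ^ 2 + pressure γ (r t y) - ε * ux t y) * ζx y|
        ≤ ∫ y in -(2 * K)..(2 * K), c * ((r t y * u t y ^ 2 + pressure γ (r t y))
          + (ε₁ + ε * ux t y ^ 2)) := by
      refine (intervalIntegral.integral_mono_on hx.1 (Continuous.intervalIntegrable (by fun_prop) _ _)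
        (Continuous.intervalIntegrable (u := fun y => c * ((r t y * u t y ^ 2 + pressure γ (r t y))
          + (ε₁ + ε * ux t y ^ 2))) (by fun_prop) _ _)
        fun y _ => ?_).trans (intervalIntegral.integral_mono_interval le_rfl hx.1 hx.2
        (Eventually.of_forall fun y => mul_nonneg hc0.le (add_nonneg (hpp y) (by positivity)))
        (Continuous.intervalIntegrable (by fun_prop) _ _))
      rw [abs_mul, mul_comm]
      refine mul_le_mul (ζxc y) ?_ (abs_nonneg _) hc0.le
      have e0 : ε * |ux t y| ≤ ε₁ + ε * ux t y ^ 2 := by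
        rw [← sq_abs]
        nlinarith [mul_nonneg hε.le (sq_nonneg (|ux t y| - 1)), abs_nonneg (ux t y),
          mul_nonneg hε.le (sq_nonneg (|ux t y|))]
      refine (abs_sub _ _).trans ?_
      rw [abs_of_nonneg (hpp y), abs_mul, abs_of_pos hε]
      linarith
    refine e1.trans ?_
    rw [intervalIntegral.integral_const_mul, intervalIntegral.integral_add
      (Continuous.intervalIntegrable (by fun_prop) _ _)
      (Continuous.intervalIntegrable (by fun_prop) _ _),
      intervalIntegral.integral_add (f := fun _ => ε₁) intervalIntegrable_const
      (Continuous.intervalIntegrable (by fun_prop) _ _), intervalIntegral.integral_const,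
      smul_eq_mul, hb, hI]
    have := mul_le_mul_of_nonneg_left (m3 t ht) hc0.le
    nlinarith
  -- the conservation law
  have hmain := integral_le_of_conservation (T := T) (M := 2 * K)
    (P := fun t x => r t x * ζ x * g t x)
    (Pt := fun t x => -(rx t x * u t x + r t x * ux t x) * ζ x * g t x + r t x * ζ x
      * ((ε * ux t x - r t x * u t x ^ 2 - pressure γ (r t x)) * ζ x + R t x))
    (Q := fun t x => r t x * u t x * ζ x * g t x)
    (Qx := fun t x => ((rx t x * u t x + r t x * ux t x) * ζ x + r t x * u t x * ζx x) * g t x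
      + r t x * u t x * ζ x * (r t x * u t x * ζ x))
    (S := fun t x => -(kappa γ / 2 * (ζ x ^ 2 * r t x ^ (γ + 1)))
      + (ε * ux t x ^ 2 + ε₁ * Cδ + (b + c * I t) * r t x + c * C₁ * (r t x * |u t x|)))
    hT (by linarith) (by fun_prop) (by fun_prop) (by fun_prop) (by fun_prop)
    (fun t x ht => (((F.hrt t x ht).mul_const (ζ x)).fun_mul (dgt t x ht)).congr_deriv (by ring))
    (fun t x => ((((F.hrx t x).fun_mul (F.hux t x)).fun_mul (dζ x)).fun_mul
      (dgx t x)).congr_deriv (by ring))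
    (fun t _ => by simp only [ζl]; ring) (fun t _ => by simp only [ζr]; ring) ?_
  swap
  · intro t ht x hx
    -- The kinetic term -ρ²u²ζ² from the time derivative of g cancels ρuζ·g_x; only the pressure
    -- remains at this order.
    have e0 : -(rx t x * u t x + r t x * ux t x) * ζ x * g t x + r t x * ζ x
        * ((ε * ux t x - r t x * u t x ^ 2 - pressure γ (r t x)) * ζ x + R t x)
        + (((rx t x * u t x + r t x * ux t x) * ζ x + r t x * u t x * ζx x) * g t x
        + r t x * u t x * ζ x * (r t x * u t x * ζ x))
        = -(ζ x ^ 2 * (r t x * pressure γ (r t x))) + ε * (r t x * ux t x) * ζ x ^ 2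
          + r t x * ζ x * R t x + r t x * u t x * ζx x * g t x := by ring
    rw [e0]
    have hr := hrp t x
    have e1 : r t x * pressure γ (r t x) = kappa γ * r t x ^ (γ + 1) := by
      unfold pressure; rw [Real.rpow_add_one hr.ne']; ring
    have e2 : r t x ^ 2 ≤ kappa γ / 2 / (ε₁ + 1) * r t x ^ (γ + 1) + Cδ := by
      have := hδ (r t x) hr
      rwa [show r t x ^ (2 : ℝ) = r t x ^ 2 by norm_cast] at this
    have hw2 : ζ x ^ 2 ≤ 1 := pow_le_one₀ (ζ0 x) (ζ1 x)
    have hrg : 0 ≤ r t x ^ (γ + 1) := by positivity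
    have e3 : ε * r t x ^ 2 ≤ kappa γ / 2 * r t x ^ (γ + 1) + ε₁ * Cδ := by
      have z1 : ε * r t x ^ 2 ≤ ε₁ * (kappa γ / 2 / (ε₁ + 1) * r t x ^ (γ + 1) + Cδ) := by gcongr
      have z2 : ε₁ / (ε₁ + 1) ≤ 1 := by rw [div_le_one (by positivity)]; linarith
      have z3 : ε₁ * (kappa γ / 2 / (ε₁ + 1) * r t x ^ (γ + 1))
          = ε₁ / (ε₁ + 1) * (kappa γ / 2 * r t x ^ (γ + 1)) := by ring
      have z4 := mul_le_of_le_one_left (by positivity : 0 ≤ kappa γ / 2 * r t x ^ (γ + 1)) z2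
      nlinarith
    have e4 : ε * (r t x * ux t x) * ζ x ^ 2 ≤ ε * ux t x ^ 2
        + (kappa γ / 2 * (ζ x ^ 2 * r t x ^ (γ + 1)) + ε₁ * Cδ) := by
      have z1 : r t x * ux t x ≤ r t x ^ 2 + ux t x ^ 2 := by
        nlinarith [sq_nonneg (r t x - ux t x), sq_nonneg (r t x), sq_nonneg (ux t x)]
      have z2 : ε * (r t x * ux t x) * ζ x ^ 2
          ≤ (ε * r t x ^ 2) * ζ x ^ 2 + (ε * ux t x ^ 2) * ζ x ^ 2 := by
        nlinarith [mul_le_mul_of_nonneg_left z1 (by positivity : 0 ≤ ε * ζ x ^ 2)]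
      have z3 := mul_le_of_le_one_right (by positivity : 0 ≤ ε * ux t x ^ 2) hw2
      have z4 := mul_le_mul_of_nonneg_right e3 (sq_nonneg (ζ x))
      have z5 := mul_le_of_le_one_right (by positivity : 0 ≤ ε₁ * Cδ) hw2
      linarith
    have e5 : r t x * ζ x * R t x ≤ (b + c * I t) * r t x := by
      have z1 := Rle t ht x hx
      have z2 : r t x * ζ x ≤ r t x := mul_le_of_le_one_right hr.le (ζ1 x)
      calc r t x * ζ x * R t x ≤ r t x * ζ x * |R t x| :=
            mul_le_mul_of_nonneg_left (le_abs_self _) (mul_nonneg hr.le (ζ0 x))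
        _ ≤ r t x * |R t x| := mul_le_mul_of_nonneg_right z2 (abs_nonneg _)
        _ ≤ r t x * (b + c * I t) := mul_le_mul_of_nonneg_left z1 hr.le
        _ = _ := mul_comm _ _
    have e6 : r t x * u t x * ζx x * g t x ≤ c * C₁ * (r t x * |u t x|) := by
      have z1 := gle t ht x hx
      calc r t x * u t x * ζx x * g t x ≤ |r t x * u t x * ζx x * g t x| := le_abs_self _
        _ = r t x * |u t x| * (|ζx x| * |g t x|) := by
            rw [abs_mul, abs_mul, abs_mul, abs_of_pos hr]; ring
        _ ≤ r t x * |u t x| * (c * C₁) := mul_le_mul_of_nonneg_left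
            (mul_le_mul (ζxc x) z1 (abs_nonneg _) hc0.le) (mul_nonneg hr.le (abs_nonneg _))
        _ = _ := mul_comm _ _
    rw [e1]
    linarith
  -- boundary terms
  have hP : ∀ t ∈ Icc 0 T, |∫ x in -(2 * K)..(2 * K), r t x * ζ x * g t x| ≤ C₁ * C₁ := by
    intro t ht
    refine (intervalIntegral.abs_integral_le_integral_abs (by linarith)).trans ?_
    refine (intervalIntegral.integral_mono_on (by linarith)
      (Continuous.intervalIntegrable (by fun_prop) _ _)
      (Continuous.intervalIntegrable (u := fun x => C₁ * r t x) (by fun_prop) _ _)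
      fun x hx => ?_).trans ((intervalIntegral.integral_const_mul _ _).le.trans
        (mul_le_mul_of_nonneg_left (m1 t ht) hC₁0))
    rw [abs_mul, abs_mul, abs_of_pos (hrp t x), abs_of_nonneg (ζ0 x), mul_comm C₁]
    exact mul_le_mul (mul_le_of_le_one_right (hrp t x).le (ζ1 x)) (gle t ht x hx) (abs_nonneg _)
      (hrp t x).le
  -- the source
  have hS : ∀ t ∈ Icc 0 T, ∫ x in -(2 * K)..(2 * K), (-(kappa γ / 2 * (ζ x ^ 2 * r t x ^ (γ + 1)))
      + (ε * ux t x ^ 2 + ε₁ * Cδ + (b + c * I t) * r t x + c * C₁ * (r t x * |u t x|)))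
      ≤ -(kappa γ / 2 * ∫ x in -(2 * K)..(2 * K), ζ x ^ 2 * r t x ^ (γ + 1))
        + (I t + 4 * K * (ε₁ * Cδ) + (b * C₁ + c * C₁ * I t) + c * C₁ * C₁) := by
    intro t ht
    have c1 := crt (γ + 1) t
    have i1 : IntervalIntegrable (fun x => -(kappa γ / 2 * (ζ x ^ 2 * r t x ^ (γ + 1)))) volume
      (-(2 * K)) (2 * K) := Continuous.intervalIntegrable (by fun_prop) _ _
    have i2 : IntervalIntegrable (fun x => ε * ux t x ^ 2) volume
      (-(2 * K)) (2 * K) := Continuous.intervalIntegrable (by fun_prop) _ _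
    have i3 : IntervalIntegrable (fun x => (b + c * I t) * r t x) volume
      (-(2 * K)) (2 * K) := Continuous.intervalIntegrable (by fun_prop) _ _
    have i4 : IntervalIntegrable (fun x => c * C₁ * (r t x * |u t x|)) volume
      (-(2 * K)) (2 * K) := Continuous.intervalIntegrable (by fun_prop) _ _
    have i0 : IntervalIntegrable (fun _ : ℝ => ε₁ * Cδ) volume
      (-(2 * K)) (2 * K) := intervalIntegrable_const
    rw [intervalIntegral.integral_add i1 (((i2.add i0).add i3).add i4),
      intervalIntegral.integral_add ((i2.add i0).add i3) i4,
      intervalIntegral.integral_add (i2.add i0) i3, intervalIntegral.integral_add i2 i0,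
      intervalIntegral.integral_neg, intervalIntegral.integral_const_mul,
      intervalIntegral.integral_const_mul (b + c * I t),
      intervalIntegral.integral_const_mul (c * C₁), intervalIntegral.integral_const, smul_eq_mul]
    have hbI : 0 ≤ b + c * I t := by
      have := hI0 t
      rw [hb]; positivity
    have z1 := mul_le_mul_of_nonneg_left (m1 t ht) hbI
    have z2 := mul_le_mul_of_nonneg_left (m2 t ht) (by positivity : 0 ≤ c * C₁)
    have z3 : ∫ x in -(2 * K)..(2 * K), ε * ux t x ^ 2 = I t := by rw [hI]
    rw [z3]
    linarith
  have cJ : Continuous fun t => ∫ x in -(2 * K)..(2 * K), ζ x ^ 2 * r t x ^ (γ + 1) :=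
    continuous_integral_strip (F := fun t x => ζ x ^ 2 * r t x ^ (γ + 1)) (by fun_prop) _ _
  have cS : Continuous fun t => ∫ x in -(2 * K)..(2 * K),
      (-(kappa γ / 2 * (ζ x ^ 2 * r t x ^ (γ + 1)))
      + (ε * ux t x ^ 2 + ε₁ * Cδ + (b + c * I t) * r t x + c * C₁ * (r t x * |u t x|))) :=
    continuous_integral_strip (F := fun t x => -(kappa γ / 2 * (ζ x ^ 2 * r t x ^ (γ + 1)))
      + (ε * ux t x ^ 2 + ε₁ * Cδ + (b + c * I t) * r t x + c * C₁ * (r t x * |u t x|)))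
      (by fun_prop) _ _
  have hST := intervalIntegral.integral_mono_on (μ := volume) hT (cS.intervalIntegrable 0 T)
    (Continuous.intervalIntegrable (u := fun t => -(kappa γ / 2 * ∫ x in -(2 * K)..(2 * K),
      ζ x ^ 2 * r t x ^ (γ + 1)) + (I t + 4 * K * (ε₁ * Cδ) + (b * C₁ + c * C₁ * I t)
      + c * C₁ * C₁)) (by fun_prop) _ _) hS
  have hIT : ∫ t in 0..T, I t ≤ C := by
    refine le_trans ?_ (hEB.dissipation (2 * K) (by linarith))
    have cd : Continuous fun p : ℝ × ℝ =>
        ε * (ux p.1 p.2 ^ 2 + r p.1 p.2 ^ (γ - 3) * rx p.1 p.2 ^ 2) := by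
      have := F.continuous_rpow (γ - 3)
      fun_prop
    refine intervalIntegral.integral_mono_on hT (cI.intervalIntegrable _ _)
      ((continuous_integral_strip (F := fun t x => ε * (ux t x ^ 2
        + r t x ^ (γ - 3) * rx t x ^ 2)) cd _ _).intervalIntegrable _ _) fun t _ => ?_
    rw [hI]
    refine intervalIntegral.integral_mono_on (by linarith)
      (Continuous.intervalIntegrable (by fun_prop) _ _)
      ((cd.comp (continuous_const.prodMk continuous_id)).intervalIntegrable _ _) fun x _ => ?_
    have := (hrp t x).le
    have : 0 ≤ r t x ^ (γ - 3) * rx t x ^ 2 := by positivity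
    nlinarith
  have hfin : ∫ t in 0..T, (-(kappa γ / 2 * ∫ x in -(2 * K)..(2 * K), ζ x ^ 2 * r t x ^ (γ + 1))
        + (I t + 4 * K * (ε₁ * Cδ) + (b * C₁ + c * C₁ * I t) + c * C₁ * C₁))
      = -(kappa γ / 2 * ∫ t in 0..T, ∫ x in -(2 * K)..(2 * K), ζ x ^ 2 * r t x ^ (γ + 1))
        + (1 + c * C₁) * (∫ t in 0..T, I t)
        + T * (4 * K * (ε₁ * Cδ) + b * C₁ + c * C₁ * C₁) := by
    have i1 : IntervalIntegrable (fun t => -(kappa γ / 2 * ∫ x in -(2 * K)..(2 * K),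
        ζ x ^ 2 * r t x ^ (γ + 1))) volume 0 T := Continuous.intervalIntegrable (by fun_prop) _ _
    have i2 : IntervalIntegrable (fun t => (1 + c * C₁) * I t) volume 0 T :=
      Continuous.intervalIntegrable (by fun_prop) _ _
    rw [← intervalIntegral.integral_const_mul, ← intervalIntegral.integral_const_mul,
      ← intervalIntegral.integral_neg, ← intervalIntegral.integral_add i1 i2]
    have : T * (4 * K * (ε₁ * Cδ) + b * C₁ + c * C₁ * C₁)
        = ∫ t in 0..T, (4 * K * (ε₁ * Cδ) + b * C₁ + c * C₁ * C₁) := by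
      rw [intervalIntegral.integral_const, smul_eq_mul, sub_zero]
    rw [this, ← intervalIntegral.integral_add (i1.add i2) intervalIntegrable_const]
    congr 1
    funext t
    ring
  have hPT := abs_le.1 (hP T ⟨hT, le_rfl⟩)
  have hP0 := abs_le.1 (hP 0 ⟨le_rfl, hT⟩)
  have hIT' := mul_le_mul_of_nonneg_left hIT (by positivity : 0 ≤ 1 + c * C₁)
  have hJ : kappa γ / 2 * (∫ t in 0..T, ∫ x in -(2 * K)..(2 * K), ζ x ^ 2 * r t x ^ (γ + 1))
      ≤ 2 * C₁ ^ 2 + (C + T * (4 * K * (ε₁ * Cδ)) + (T * (b * C₁) + c * C * C₁)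
    + T * (c * C₁ * C₁)) := by linarith [hPT.1, hP0.2]
  have hlast : ∫ t in 0..T, ∫ x in -K..K, r t x ^ (γ + 1)
      ≤ ∫ t in 0..T, ∫ x in -(2 * K)..(2 * K), ζ x ^ 2 * r t x ^ (γ + 1) := by
    refine intervalIntegral.integral_mono_on hT ((continuous_integral_strip
      (F := fun t x => r t x ^ (γ + 1)) crg1 _ _).intervalIntegrable _ _)
      (cJ.intervalIntegrable _ _) fun t _ => ?_
    have c1 := crt (γ + 1) t
    refine le_trans (intervalIntegral.integral_mono_on (by linarith)
      (Continuous.intervalIntegrable (by fun_prop) _ _)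
      (Continuous.intervalIntegrable (u := fun x => ζ x ^ 2 * r t x ^ (γ + 1)) (by fun_prop) _ _)
      fun x hx => ?_) (integral_le_of_subinterval (by fun_prop) hK0.le (by linarith) fun x => ?_)
    · rw [ζK x hx, one_pow, one_mul]
    · have := (hrp t x).le
      positivity
  calc _ ≤ _ := hlast
    _ = 2 / kappa γ * (kappa γ / 2 *
        ∫ t in 0..T, ∫ x in -(2 * K)..(2 * K), ζ x ^ 2 * r t x ^ (γ + 1)) := by
        field_simp
    _ ≤ _ := mul_le_mul_of_nonneg_left hJ (by positivity)

/-! ## Local bound of the velocity -/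

/-- Cauchy-Schwarz, obtained from the nonnegativity of the variance of |f|. -/
theorem sq_integral_abs_le {f : ℝ → ℝ} (hf : Continuous f) {L : ℝ} (hL : 0 < L) :
    (∫ x in -L..L, |f x|) ^ 2 ≤ 2 * L * ∫ x in -L..L, f x ^ 2 := by
  set J := ∫ x in -L..L, |f x| with hJ
  have h0 : 0 ≤ ∫ x in -L..L, (|f x| - J / (2 * L)) ^ 2 :=
    intervalIntegral.integral_nonneg (by linarith) fun x _ => sq_nonneg _
  have h1 : ∫ x in -L..L, (|f x| - J / (2 * L)) ^ 2
      = (∫ x in -L..L, f x ^ 2) - J / L * J + 2 * L * (J / (2 * L)) ^ 2 := by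
    have e : (fun x => (|f x| - J / (2 * L)) ^ 2)
        = fun x => f x ^ 2 - J / L * |f x| + (J / (2 * L)) ^ 2 := by
      funext x
      rw [sub_sq, sq_abs]
      congr 2
      field_simp
    have i1 : IntervalIntegrable (fun x => f x ^ 2) volume (-L) L :=
      Continuous.intervalIntegrable (by fun_prop) _ _
    have i2 : IntervalIntegrable (fun x => J / L * |f x|) volume (-L) L :=
      Continuous.intervalIntegrable (by fun_prop) _ _
    rw [e, intervalIntegral.integral_add (i1.sub i2) intervalIntegrable_const,
      intervalIntegral.integral_sub i1 i2, intervalIntegral.integral_const_mul,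
      intervalIntegral.integral_const, smul_eq_mul, ← hJ]
    ring
  rw [h1] at h0
  have h2 : J / L * J = J ^ 2 / L := by ring
  have h3 : 2 * L * (J / (2 * L)) ^ 2 = J ^ 2 / (2 * L) := by field_simp
  have h4 : J ^ 2 / L = 2 * (J ^ 2 / (2 * L)) := by field_simp
  rw [h2, h3, h4] at h0
  have h5 : J ^ 2 / (2 * L) ≤ ∫ x in -L..L, f x ^ 2 := by linarith
  rwa [div_le_iff₀ (by positivity), mul_comm] at h5

/-- On bounded intervals the velocity is controlled by its derivative and the energy, also in the
presence of near vacuum. -/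
theorem exists_velocity_bound {γ : ℝ} (hγ : 1 < γ) {s : EndStates} {rb ub rbx ubx : ℝ → ℝ}
    {m B L : ℝ} (h : ProfileBounds s rb ub rbx ubx m B L) (C K : ℝ) :
    ∃ C' L₁ : ℝ, 0 ≤ C' ∧ 0 < L₁ ∧ K ≤ L₁ ∧ ∀ (ε T : ℝ) (r u rx ux rxx uxx : ℝ → ℝ → ℝ),
      Flow γ ε r u rx ux rxx uxx → EnergyBounds γ ε T C rb ub r u rx ux →
      ∀ t ∈ Icc 0 T, ∀ x ∈ Icc (-L₁) L₁, u t x ^ 2 ≤ C' * (1 + ∫ y in -L₁..L₁, ux t y ^ 2) := by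
  have hκ := kappa_pos hγ
  have hm := h.hm
  have hB := h.hB
  have hγ0 : 0 < γ - 1 := by linarith
  obtain ⟨ce, hce⟩ : ∃ ce, ce = kappa γ / 2 * m ^ γ := ⟨_, rfl⟩
  have hce0 : 0 < ce := by rw [hce]; positivity
  obtain ⟨r0, hr0⟩ : ∃ r0, r0 = m * ((γ - 1) / (2 * γ)) := ⟨_, rfl⟩
  have hr00 : 0 < r0 := by rw [hr0]; positivity
  -- On an interval this long the energy density cannot be at least ce everywhere, for its integral
  -- would exceed C.
  obtain ⟨L₁, hL₁⟩ : ∃ L₁, L₁ = max (max K 1) (C / ce) := ⟨_, rfl⟩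
  have hL1 : 1 ≤ L₁ := by rw [hL₁]; exact (le_max_right _ _).trans (le_max_left _ _)
  have hLK : K ≤ L₁ := by rw [hL₁]; exact (le_max_left _ _).trans (le_max_left _ _)
  have hLC : C / ce ≤ L₁ := by rw [hL₁]; exact le_max_right _ _
  refine ⟨2 * (2 * (2 * ce / r0) + 2 * B ^ 2) + 4 * L₁, L₁, by positivity, by linarith, hLK, ?_⟩
  intro ε T r u rx ux rxx uxx F hEB t ht x hx
  have cr := F.cont_r
  have cu := F.cont_u
  have cux := F.cont_ux
  have cub := h.cont_ub
  obtain ⟨y, hy, hye⟩ : ∃ y ∈ Icc (-L₁) L₁, energyDensity γ rb ub r u t y < ce := by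
    by_contra! hcon
    have c1 : Continuous (energyDensity γ rb ub r u t) := by
      unfold energyDensity
      have : Continuous fun x => relativeEnergy γ (r t x) (rb x) :=
        continuous_relativeEnergy hγ (by fun_prop) h.cont_rb
      fun_prop
    have h1 : ∫ _ in -L₁..L₁, ce ≤ ∫ y in -L₁..L₁, energyDensity γ rb ub r u t y :=
      intervalIntegral.integral_mono_on (by linarith) intervalIntegrable_const
        (c1.intervalIntegrable _ _) hcon
    rw [intervalIntegral.integral_const, smul_eq_mul] at h1
    have h2 := hEB.energy t ht L₁ (by linarith)
    rw [div_le_iff₀ hce0] at hLC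
    nlinarith
  unfold energyDensity at hye
  have hry := F.pos t y
  have hEy := relativeEnergy_nonneg hγ hry (h.rb_pos y)
  -- Below r0 the relative internal energy alone would reach ce. At y the density is thus bounded
  -- below, and the kinetic energy bounds the velocity there; elsewhere u is reached by integrating
  -- u_x.
  have hry0 : r0 ≤ r t y := by
    by_contra hcon
    have h1 : r t y ≤ rb y * ((γ - 1) / (2 * γ)) := by
      refine (not_le.1 hcon).le.trans ?_
      rw [hr0]
      exact mul_le_mul_of_nonneg_right (h.rb_lower y) (by positivity)
    have h2 := relativeEnergy_lower hγ hry (h.rb_pos y) h1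
    have h3 : ce ≤ kappa γ / 2 * rb y ^ γ := by
      rw [hce]
      exact mul_le_mul_of_nonneg_left
        (Real.rpow_le_rpow hm.le (h.rb_lower y) (by linarith)) (by positivity)
    have : 0 ≤ 1 / 2 * (r t y * (u t y - ub y) ^ 2) := by positivity
    linarith
  have hDy : (u t y - ub y) ^ 2 ≤ 2 * ce / r0 := by
    rw [le_div_iff₀ hr00]
    nlinarith [mul_le_mul_of_nonneg_right hry0 (sq_nonneg (u t y - ub y))]
  have huy : u t y ^ 2 ≤ 2 * (2 * ce / r0) + 2 * B ^ 2 := by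
    have hb2 : ub y ^ 2 ≤ B ^ 2 := sq_le_sq' (abs_le.1 (h.ub_le y)).1 (abs_le.1 (h.ub_le y)).2
    nlinarith [sq_nonneg (u t y - 2 * ub y)]
  have cuxt : Continuous (ux t) := by fun_prop
  have hdiff : |u t x - u t y| ≤ ∫ z in -L₁..L₁, |ux t z| := by
    rw [← intervalIntegral.integral_eq_sub_of_hasDerivAt (f := fun z => u t z)
      (fun z _ => F.hux t z) (cuxt.intervalIntegrable _ _)]
    rw [← Real.norm_eq_abs]
    refine intervalIntegral.norm_integral_le_abs_integral_norm.trans ?_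
    have h1 := intervalIntegral.abs_integral_mono_interval (μ := volume) (f := fun z => |ux t z|)
      (a := y) (b := x) (c := -L₁) (d := L₁) ?_ (Eventually.of_forall fun z => abs_nonneg _)
      (cuxt.abs.intervalIntegrable _ _)
    · refine h1.trans (le_of_eq (abs_of_nonneg ?_))
      exact intervalIntegral.integral_nonneg (by linarith) fun z _ => abs_nonneg _
    · rw [uIoc_of_le (by linarith : -L₁ ≤ L₁)]
      exact Ioc_subset_Ioc (le_min hy.1 hx.1) (max_le hy.2 hx.2)
  have hsq := sq_integral_abs_le cuxt (by linarith : 0 < L₁)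
  have hd2 : (u t x - u t y) ^ 2 ≤ 2 * L₁ * ∫ z in -L₁..L₁, ux t z ^ 2 := by
    rw [← sq_abs]
    exact (pow_le_pow_left₀ (abs_nonneg _) hdiff 2).trans hsq
  have hI : 0 ≤ ∫ z in -L₁..L₁, ux t z ^ 2 :=
    intervalIntegral.integral_nonneg (by linarith) fun z _ => sq_nonneg _
  have hfin : u t x ^ 2 ≤ 2 * u t y ^ 2 + 2 * (u t x - u t y) ^ 2 := by
    nlinarith [sq_nonneg (u t x - 2 * u t y)]
  have : 0 ≤ 2 * (2 * (2 * ce / r0) + 2 * B ^ 2) * ∫ z in -L₁..L₁, ux t z ^ 2 := by positivity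
  nlinarith

/-! ## The generating function of the entropy -/

/-- An odd smooth approximation of `s |s|`. -/
def psi (s : ℝ) : ℝ := s * √(1 + s ^ 2)

/-- The first derivative of `psi`. -/
def psi' (s : ℝ) : ℝ := (1 + 2 * s ^ 2) / √(1 + s ^ 2)

/-- The second derivative of `psi`. -/
def psi'' (s : ℝ) : ℝ := s * (3 + 2 * s ^ 2) / √(1 + s ^ 2) ^ 3

theorem sqrt_one_add_sq_pos (s : ℝ) : 0 < √(1 + s ^ 2) := Real.sqrt_pos.2 (by positivity)

theorem sq_sqrt_one_add_sq (s : ℝ) : √(1 + s ^ 2) ^ 2 = 1 + s ^ 2 := Real.sq_sqrt (by positivity)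

theorem abs_le_sqrt_one_add_sq (s : ℝ) : |s| ≤ √(1 + s ^ 2) := Real.abs_le_sqrt (by linarith)

theorem sqrt_one_add_sq_le (s : ℝ) : √(1 + s ^ 2) ≤ 1 + |s| := by
  rw [Real.sqrt_le_left (by positivity)]
  nlinarith [sq_abs s, abs_nonneg s]

theorem hasDerivAt_sqrt_one_add_sq (s : ℝ) :
    HasDerivAt (fun s => √(1 + s ^ 2)) (s / √(1 + s ^ 2)) s := by
  have h := (((hasDerivAt_id s).fun_pow 2).const_add 1).sqrt (by simp; positivity)
  refine h.congr_deriv ?_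
  simp only [id]
  field_simp
  push_cast
  ring

theorem hasDerivAt_psi (s : ℝ) : HasDerivAt psi (psi' s) s := by
  refine ((hasDerivAt_id s).fun_mul (hasDerivAt_sqrt_one_add_sq s)).congr_deriv ?_
  have h1 := sqrt_one_add_sq_pos s
  have h2 := sq_sqrt_one_add_sq s
  unfold psi'
  simp only [id]
  field_simp
  rw [h2]; ring

theorem hasDerivAt_psi' (s : ℝ) : HasDerivAt psi' (psi'' s) s := by
  have h1 := sqrt_one_add_sq_pos s
  have h2 := sq_sqrt_one_add_sq s
  have h := ((((hasDerivAt_id s).fun_pow 2).const_mul 2).const_add 1).fun_div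
    (hasDerivAt_sqrt_one_add_sq s) h1.ne'
  refine h.congr_deriv ?_
  unfold psi''
  simp only [id]
  field_simp
  rw [h2]
  push_cast
  ring

theorem continuous_psi : Continuous psi :=
  continuous_iff_continuousAt.2 fun s => (hasDerivAt_psi s).continuousAt

theorem continuous_psi' : Continuous psi' :=
  continuous_iff_continuousAt.2 fun s => (hasDerivAt_psi' s).continuousAt

theorem continuous_psi'' : Continuous psi'' := by
  unfold psi''
  exact Continuous.div (by fun_prop) (by fun_prop) fun s => (pow_pos (sqrt_one_add_sq_pos s) 3).ne'

theorem psi_neg (s : ℝ) : psi (-s) = -psi s := by unfold psi; rw [neg_sq]; ring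

/-- The reason for smoothing s|s|: a bounded continuous ψ'' keeps the viscous entropy production
below the dissipation. -/
theorem abs_psi''_le (s : ℝ) : |psi'' s| ≤ 3 := by
  have h1 := sqrt_one_add_sq_pos s
  have h2 := sq_sqrt_one_add_sq s
  have h3 := abs_le_sqrt_one_add_sq s
  unfold psi''
  rw [abs_div, abs_mul, abs_of_pos (pow_pos h1 3), div_le_iff₀ (pow_pos h1 3),
    abs_of_pos (by positivity : 0 < 3 + 2 * s ^ 2)]
  calc |s| * (3 + 2 * s ^ 2) ≤ √(1 + s ^ 2) * (3 * (1 + s ^ 2)) := by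
        apply mul_le_mul h3 (by nlinarith [sq_nonneg s]) (by positivity) h1.le
    _ = 3 * √(1 + s ^ 2) ^ 3 := by rw [pow_succ _ 2, h2]; ring

theorem psi'_nonneg (s : ℝ) : 0 ≤ psi' s := by unfold psi'; positivity

theorem psi'_le (s : ℝ) : psi' s ≤ 2 * (1 + |s|) := by
  have h1 := sqrt_one_add_sq_pos s
  have h2 := sq_sqrt_one_add_sq s
  have h3 := sqrt_one_add_sq_le s
  unfold psi'
  rw [div_le_iff₀ h1]
  nlinarith [abs_nonneg s, sq_nonneg s]

theorem abs_psi_le (s : ℝ) : |psi s| ≤ 1 + 2 * s ^ 2 := by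
  unfold psi
  have h3 := sqrt_one_add_sq_le s
  have h4 := sq_abs s
  rw [abs_mul, abs_of_pos (sqrt_one_add_sq_pos s)]
  nlinarith [abs_nonneg s, mul_le_mul_of_nonneg_left h3 (abs_nonneg s), sq_nonneg (|s| - 1)]

theorem abs_psi'_sub_le (x y : ℝ) : |psi' x - psi' y| ≤ 3 * |x - y| := by
  have := convex_univ.norm_image_sub_le_of_norm_hasDerivWithin_le (f := psi') (f' := psi'')
    (C := 3) (fun z _ => (hasDerivAt_psi' z).hasDerivWithinAt) (fun z _ => abs_psi''_le z)
    (mem_univ y) (mem_univ x)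
  simpa using this

theorem abs_psi_taylor_le (x D : ℝ) : |psi (x + D) - psi x - D * psi' x| ≤ 3 * D ^ 2 := by
  have h := (convex_uIcc x (x + D)).norm_image_sub_le_of_norm_hasDerivWithin_le
    (f := fun y => psi y - psi' x * y) (f' := fun y => psi' y - psi' x) (C := 3 * |D|)
    (fun z _ => ((hasDerivAt_psi z).fun_sub (by
      simpa using (hasDerivAt_id z).const_mul (psi' x))).hasDerivWithinAt) (fun z hz => by
      refine (abs_psi'_sub_le z x).trans (mul_le_mul_of_nonneg_left ?_ (by norm_num))
      have := abs_sub_left_of_mem_uIcc hz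
      simpa using this) left_mem_uIcc right_mem_uIcc
  simp only [Real.norm_eq_abs] at h
  have e : psi (x + D) - psi' x * (x + D) - (psi x - psi' x * x)
      = psi (x + D) - psi x - D * psi' x := by ring
  rw [e, add_sub_cancel_left] at h
  calc _ ≤ _ := h
    _ = 3 * D ^ 2 := by rw [← sq_abs D]; ring

/-- For 0 ≤ a ≤ b the difference is at least (b - a)√(1+b²) ≥ (b - a)². Oddness covers negative
arguments, and ψ(b) ≥ b² for b ≥ 0 covers opposite signs. This quadratic monotonicity is the source
of the cubic power of the velocity. -/
theorem sq_le_psi_sub {a b : ℝ} (hab : a ≤ b) : (b - a) ^ 2 / 4 ≤ psi b - psi a := by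
  have key : ∀ a b : ℝ, 0 ≤ a → a ≤ b → (b - a) ^ 2 / 4 ≤ psi b - psi a := by
    intro a b ha hab
    have h1 : b ≤ √(1 + b ^ 2) := (le_abs_self b).trans (abs_le_sqrt_one_add_sq b)
    have h2 : √(1 + a ^ 2) ≤ √(1 + b ^ 2) := Real.sqrt_le_sqrt (by nlinarith)
    unfold psi
    nlinarith [mul_le_mul_of_nonneg_left h2 ha, mul_le_mul_of_nonneg_left h1 (sub_nonneg.2 hab)]
  have key2 : ∀ b : ℝ, 0 ≤ b → b ^ 2 ≤ psi b := by
    intro b hb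
    have h1 : b ≤ √(1 + b ^ 2) := (le_abs_self b).trans (abs_le_sqrt_one_add_sq b)
    unfold psi
    nlinarith
  rcases le_total 0 a with ha | ha
  · exact key a b ha hab
  rcases le_total 0 b with hb | hb
  · have h1 := key2 b hb
    have h2 := key2 (-a) (by linarith)
    rw [psi_neg] at h2
    nlinarith [sq_nonneg (a + b)]
  · have := key (-b) (-a) (by linarith) (by linarith)
    rw [psi_neg, psi_neg] at this
    nlinarith

theorem psi_mono : Monotone psi := fun a b hab => by
  have := sq_le_psi_sub hab
  nlinarith [sq_nonneg (b - a)]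

/-- By oddness the sum is the increment of ψ over an interval of length 2|D| centred at y, so the
bound does not depend on y. It will be used with y = ρ^θ sin α, at any density. -/
theorem cube_le_psi_add (D y : ℝ) : |D| ^ 3 ≤ D * (psi (D + y) + psi (D - y)) := by
  have e : psi (D + y) + psi (D - y) = psi (y + D) - psi (y - D) := by
    rw [← neg_sub y D, psi_neg, add_comm D y]; ring
  rw [e]
  rcases le_total 0 D with hD | hD
  · have := sq_le_psi_sub (a := y - D) (b := y + D) (by linarith)
    rw [abs_of_nonneg hD]
    nlinarith [mul_le_mul_of_nonneg_left this hD]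
  · have := sq_le_psi_sub (a := y + D) (b := y - D) (by linarith)
    rw [abs_of_nonpos hD]
    nlinarith [mul_le_mul_of_nonneg_left this (neg_nonneg.2 hD)]

/-! ## Averages over the entropy kernel

The entropy kernel `(1 - s²)^λ ds`, `λ = (3 - γ) / (2 (γ - 1))`, is written as
`cos(α)^(1/θ) dα` by means of the substitution `s = sin α`. -/

/-- The average of `f(a + l s)` with weight `v`, where `s = sin α`. -/
def avg (v : ℝ → ℝ) (f : ℝ → ℝ) (a l : ℝ) : ℝ :=
  ∫ α in -(Real.pi / 2)..(Real.pi / 2), v α * f (a + l * Real.sin α)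

/-- The weight `cos(α)^(1/θ) sin(α)^k`. -/
def kernel (γ : ℝ) (k : ℕ) (α : ℝ) : ℝ := Real.cos α ^ (1 / theta γ) * Real.sin α ^ k

theorem neg_pi_div_two_le : -(Real.pi / 2) ≤ Real.pi / 2 := by linarith [Real.pi_pos]

theorem continuous_kernel {γ : ℝ} (hγ : 1 < γ) (k : ℕ) : Continuous (kernel γ k) :=
  (Real.continuous_cos.rpow_const fun _ => Or.inr (one_div_pos.2 (theta_pos hγ)).le).mul
    (Real.continuous_sin.pow k)

theorem kernel_zero_nonneg {γ : ℝ} {α : ℝ} (hα : α ∈ Icc (-(Real.pi / 2)) (Real.pi / 2)) :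
    0 ≤ kernel γ 0 α := by
  unfold kernel
  have := Real.cos_nonneg_of_mem_Icc hα
  positivity

theorem abs_kernel_le {γ : ℝ} {α : ℝ} (k : ℕ) (hα : α ∈ Icc (-(Real.pi / 2)) (Real.pi / 2)) :
    |kernel γ k α| ≤ kernel γ 0 α := by
  have h0 := kernel_zero_nonneg (γ := γ) hα
  unfold kernel at *
  rw [pow_zero, mul_one] at *
  rw [abs_mul, abs_of_nonneg h0, abs_pow]
  exact mul_le_of_le_one_right h0 (pow_le_one₀ (abs_nonneg _) (Real.abs_sin_le_one α))

/-- The total mass of the kernel. -/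
def kernelMass (γ : ℝ) : ℝ := ∫ α in -(Real.pi / 2)..(Real.pi / 2), kernel γ 0 α

theorem kernelMass_pos {γ : ℝ} (hγ : 1 < γ) : 0 < kernelMass γ := by
  refine intervalIntegral.intervalIntegral_pos_of_pos_on
    ((continuous_kernel hγ 0).intervalIntegrable _ _) (fun α hα => ?_) (by linarith [Real.pi_pos])
  unfold kernel
  have := Real.cos_pos_of_mem_Ioo hα
  positivity

theorem continuous_avg {v f : ℝ → ℝ} (hv : Continuous v) (hf : Continuous f) {X : Type*}
    [TopologicalSpace X] {a l : X → ℝ} (ha : Continuous a) (hl : Continuous l) :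
    Continuous fun x => avg v f (a x) (l x) :=
  intervalIntegral.continuous_parametric_intervalIntegral_of_continuous'
    (f := fun x α => v α * f (a x + l x * Real.sin α)) (by fun_prop) _ _

/-- Varying the scale l brings down a factor sin α, which is the passage from k to k + 1. -/
theorem hasDerivAt_avg {γ : ℝ} (hγ : 1 < γ) (k : ℕ) {f f' : ℝ → ℝ} (hf' : Continuous f')
    (hd : ∀ s, HasDerivAt f (f' s) s) {a l a' l' : ℝ → ℝ} (ca : Continuous a) (cl : Continuous l)
    (ca' : Continuous a') (cl' : Continuous l') {S : Set ℝ} {t : ℝ} (hS : S ∈ 𝓝 t)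
    (da : ∀ τ ∈ S, HasDerivAt a (a' τ) τ) (dl : ∀ τ ∈ S, HasDerivAt l (l' τ) τ) :
    HasDerivAt (fun τ => avg (kernel γ k) f (a τ) (l τ))
      (a' t * avg (kernel γ k) f' (a t) (l t) + l' t * avg (kernel γ (k + 1)) f' (a t) (l t)) t := by
  have cf : Continuous f := continuous_iff_continuousAt.2 fun s => (hd s).continuousAt
  have cv := continuous_kernel hγ k
  have cv' := continuous_kernel hγ (k + 1)
  have h := hasDerivAt_intervalIntegral_of_continuous (a := -(Real.pi / 2)) (b := Real.pi / 2) hS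
    (F := fun τ α => kernel γ k α * f (a τ + l τ * Real.sin α))
    (F' := fun τ α => kernel γ k α * (f' (a τ + l τ * Real.sin α) * (a' τ + l' τ * Real.sin α)))
    (by fun_prop) (by fun_prop) (fun τ hτ α => ((hd _).comp τ
      ((da τ hτ).fun_add ((dl τ hτ).mul_const (Real.sin α)))).const_mul (kernel γ k α))
  refine h.congr_deriv ?_
  unfold avg
  rw [← intervalIntegral.integral_const_mul, ← intervalIntegral.integral_const_mul,
    ← intervalIntegral.integral_add (Continuous.intervalIntegrable (by fun_prop) _ _)
    (Continuous.intervalIntegrable (by fun_prop) _ _)]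
  congr 1
  funext α
  have : kernel γ (k + 1) α = kernel γ k α * Real.sin α := by unfold kernel; rw [pow_succ]; ring
  rw [this]
  ring

theorem avg_neg (γ : ℝ) (k : ℕ) (f : ℝ → ℝ) (a l : ℝ) :
    avg (kernel γ k) f a (-l) = (-1) ^ k * avg (kernel γ k) f a l := by
  unfold avg
  have h := intervalIntegral.integral_comp_neg (a := -(Real.pi / 2)) (b := Real.pi / 2)
    (f := fun α => kernel γ k α * f (a + -l * Real.sin α))
  rw [neg_neg] at h
  rw [← h, ← intervalIntegral.integral_const_mul]
  congr 1
  funext α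
  unfold kernel
  rw [Real.cos_neg, Real.sin_neg, neg_pow, neg_mul_neg]
  ring

/-- Integration by parts in the entropy kernel. -/
theorem avg_parts {γ : ℝ} (hγ : 1 < γ) {f f' : ℝ → ℝ} (hf' : Continuous f')
    (hd : ∀ s, HasDerivAt f (f' s) s) (a l : ℝ) :
    theta γ * l * (avg (kernel γ 0) f' a l - avg (kernel γ 2) f' a l)
      = (1 + theta γ) * avg (kernel γ 1) f a l := by
  have hθ := theta_pos hγ
  have cf : Continuous f := continuous_iff_continuousAt.2 fun s => (hd s).continuousAt
  have c0 := continuous_kernel hγ 0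
  have c1 := continuous_kernel hγ 1
  have c2 := continuous_kernel hγ 2
  have hp : 0 < 1 / theta γ := one_div_pos.2 hθ
  -- The function cos(α)^(1/θ+1) f(a + l sin α) vanishes at ±π/2, so its derivative integrates to
  -- zero; cos² = 1 - sin² produces the difference of the kernels 0 and 2. The resulting relation is
  -- what makes the entropy and its flux compatible.
  have hder : ∀ α ∈ uIcc (-(Real.pi / 2)) (Real.pi / 2),
      HasDerivAt (fun α => Real.cos α ^ (1 / theta γ + 1) * f (a + l * Real.sin α))
        (l * (kernel γ 0 α * f' (a + l * Real.sin α) - kernel γ 2 α * f' (a + l * Real.sin α))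
          - (1 / theta γ + 1) * (kernel γ 1 α * f (a + l * Real.sin α))) α := by
    intro α hα
    rw [uIcc_of_le neg_pi_div_two_le] at hα
    have hcos := Real.cos_nonneg_of_mem_Icc hα
    have h1 := (Real.hasDerivAt_cos α).rpow_const (p := 1 / theta γ + 1) (Or.inr (by linarith))
    have h2 := (hd (a + l * Real.sin α)).comp α
      (((Real.hasDerivAt_sin α).const_mul l).const_add a)
    refine (h1.fun_mul h2).congr_deriv ?_
    have e1 : Real.cos α ^ (1 / theta γ + 1) = Real.cos α ^ (1 / theta γ) * Real.cos α :=
      Real.rpow_add_one' hcos (by positivity)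
    have e2 := Real.sin_sq_add_cos_sq α
    unfold kernel
    rw [add_sub_cancel_right, e1]
    simp only [Function.comp]
    have e3 : Real.sin α ^ 2 = 1 - Real.cos α ^ 2 := by linarith
    rw [e3]
    ring
  have h := intervalIntegral.integral_eq_sub_of_hasDerivAt hder
    (Continuous.intervalIntegrable (by fun_prop) _ _)
  have hz : (0 : ℝ) ^ (1 / theta γ + 1) = 0 := Real.zero_rpow (by positivity)
  rw [Real.cos_neg, Real.cos_pi_div_two, hz, zero_mul, zero_mul, sub_zero,
    intervalIntegral.integral_sub (Continuous.intervalIntegrable (by fun_prop) _ _)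
    (Continuous.intervalIntegrable (by fun_prop) _ _), intervalIntegral.integral_const_mul,
    intervalIntegral.integral_sub (Continuous.intervalIntegrable (by fun_prop) _ _)
    (Continuous.intervalIntegrable (by fun_prop) _ _), intervalIntegral.integral_const_mul] at h
  unfold avg
  have h' := congrArg (fun z => theta γ * z) (sub_eq_zero.1 h)
  beta_reduce at h'
  rw [mul_assoc, h', ← mul_assoc, mul_add, mul_one_div_cancel hθ.ne', mul_one]

theorem abs_avg_le {γ : ℝ} (hγ : 1 < γ) (k : ℕ) {f : ℝ → ℝ} (hf : Continuous f) {a l C : ℝ}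
    (hC : ∀ σ, |σ| ≤ 1 → |f (a + l * σ)| ≤ C) :
    |avg (kernel γ k) f a l| ≤ kernelMass γ * C := by
  have c0 := continuous_kernel hγ 0
  have ck := continuous_kernel hγ k
  unfold avg kernelMass
  refine (intervalIntegral.abs_integral_le_integral_abs neg_pi_div_two_le).trans ?_
  rw [← intervalIntegral.integral_mul_const]
  refine intervalIntegral.integral_mono_on neg_pi_div_two_le
    (Continuous.intervalIntegrable (by fun_prop) _ _)
    (Continuous.intervalIntegrable (by fun_prop) _ _) fun α hα => ?_
  rw [abs_mul]
  exact mul_le_mul (abs_kernel_le k hα) (hC _ (Real.abs_sin_le_one α)) (abs_nonneg _)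
    (kernel_zero_nonneg hα)

/-- An odd function is averaged with an even kernel. Hence the entropy vanishes at relative velocity
zero for every density, and its linearization there has only a momentum part. -/
theorem avg_psi_zero (γ l : ℝ) : avg (kernel γ 0) psi 0 l = 0 := by
  have h := avg_neg γ 0 psi 0 l
  have h2 : avg (kernel γ 0) psi 0 (-l) = -avg (kernel γ 0) psi 0 l := by
    unfold avg
    rw [← intervalIntegral.integral_neg]
    congr 1
    funext α
    rw [zero_add, zero_add, neg_mul, psi_neg]
    ring
  rw [h2] at h
  simp at h
  linarith

/-- The average is even in l, so it may be symmetrized before `cube_le_psi_add` is applied under the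
integral; this costs the factor ½. -/
theorem cube_le_avg_psi {γ : ℝ} (hγ : 1 < γ) (D l : ℝ) :
    kernelMass γ / 2 * |D| ^ 3 ≤ D * avg (kernel γ 0) psi D l := by
  have c0 := continuous_kernel hγ 0
  have cψ := continuous_psi
  have h := avg_neg γ 0 psi D l
  rw [pow_zero, one_mul] at h
  have h1 : kernelMass γ * |D| ^ 3
      ≤ D * (avg (kernel γ 0) psi D l + avg (kernel γ 0) psi D (-l)) := by
    unfold avg kernelMass
    rw [← intervalIntegral.integral_add (Continuous.intervalIntegrable (by fun_prop) _ _)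
      (Continuous.intervalIntegrable (by fun_prop) _ _), ← intervalIntegral.integral_mul_const,
      ← intervalIntegral.integral_const_mul]
    refine intervalIntegral.integral_mono_on neg_pi_div_two_le
      (Continuous.intervalIntegrable (by fun_prop) _ _)
      (Continuous.intervalIntegrable (by fun_prop) _ _) fun α hα => ?_
    have := mul_le_mul_of_nonneg_left (cube_le_psi_add D (l * Real.sin α))
      (kernel_zero_nonneg (γ := γ) hα)
    rw [neg_mul, ← sub_eq_add_neg]
    linarith
  rw [h] at h1
  linarith

/-- Pairing α with -α leaves sin α times an increment of the monotone ψ of the same sign. The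
density part of the entropy flux can therefore be dropped from below. -/
theorem avg_psi_one_nonneg {γ : ℝ} (hγ : 1 < γ) (D : ℝ) {l : ℝ} (hl : 0 ≤ l) :
    0 ≤ avg (kernel γ 1) psi D l := by
  have c1 := continuous_kernel hγ 1
  have cψ := continuous_psi
  have h := avg_neg γ 1 psi D l
  have h1 : 0 ≤ avg (kernel γ 1) psi D l - avg (kernel γ 1) psi D (-l) := by
    unfold avg
    rw [← intervalIntegral.integral_sub (Continuous.intervalIntegrable (by fun_prop) _ _)
      (Continuous.intervalIntegrable (by fun_prop) _ _)]
    refine intervalIntegral.integral_nonneg neg_pi_div_two_le fun α hα => ?_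
    rw [← mul_sub]
    have hk : kernel γ 1 α = kernel γ 0 α * Real.sin α := by unfold kernel; ring
    rw [hk, mul_assoc]
    refine mul_nonneg (kernel_zero_nonneg hα) ?_
    rcases le_total 0 (Real.sin α) with hs | hs
    · refine mul_nonneg hs (sub_nonneg.2 (psi_mono ?_))
      nlinarith
    · refine mul_nonneg_of_nonpos_of_nonpos hs (sub_nonpos.2 (psi_mono ?_))
      nlinarith
  rw [h] at h1
  linarith

/-! ## The entropy pair -/

/-- The entropy `ρ ∫ ψ(D + ρ^θ s)`. -/
def entropy (γ r D : ℝ) : ℝ := r * avg (kernel γ 0) psi D (r ^ theta γ)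

/-- The flux `ρ ∫ (u + θ ρ^θ s) ψ(D + ρ^θ s)` of `entropy`. -/
def entropyFlux (γ r u D : ℝ) : ℝ :=
  r * (u * avg (kernel γ 0) psi D (r ^ theta γ)
    + theta γ * r ^ theta γ * avg (kernel γ 1) psi D (r ^ theta γ))

/-- The derivative of `entropy` with respect to the momentum. -/
def entropyVar (γ r D : ℝ) : ℝ := avg (kernel γ 0) psi' D (r ^ theta γ)

/-- The chain rule for the entropy ρA₀ and the flux ρ(uA₀ + θlA₁) with l = ρ^θ. What is left after
cancellation is a multiple of the integration-by-parts relation `hparts`, so only the source with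
acceleration v remains. -/
theorem entropy_identity_aux {r u rx ux A0 A1 B0 B1 B2 θ l g v : ℝ}
    (hg : r * g = θ ^ 2 * l ^ 2 * rx)
    (hparts : θ * l * (B0 - B2) = (1 + θ) * A1) {rt ut lt lx : ℝ}
    (hrt : rt = -(rx * u + r * ux)) (hut : ut = v - u * ux - g)
    (hlt : r * lt = θ * l * rt) (hlx : r * lx = θ * l * rx) :
    rt * A0 + r * (ut * B0 + lt * B1)
      + (rx * (u * A0 + θ * l * A1)
        + r * (ux * A0 + u * (ux * B0 + lx * B1) + (θ * lx * A1 + θ * l * (ux * B1 + lx * B2))))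
    = r * v * B0 := by
  have e1 : r * (ut * B0) = r * v * B0 - r * u * ux * B0 - (r * g) * B0 := by rw [hut]; ring
  have e2 : r * (lt * B1) = θ * l * rt * B1 := by rw [← hlt]; ring
  have e3 : r * (u * (lx * B1)) = u * (θ * l * rx) * B1 := by rw [← hlx]; ring
  have e4 : r * (θ * lx * A1) = θ * (θ * l * rx) * A1 := by rw [← hlx]; ring
  have e5 : r * (θ * l * (lx * B2)) = θ * l * (θ * l * rx) * B2 := by rw [← hlx]; ring
  rw [hg] at e1
  have e6 : θ * l * rx * ((1 + θ) * A1 - θ * l * (B0 - B2)) = 0 := by rw [hparts]; ring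
  have : rt * A0 + r * (ut * B0 + lt * B1)
      + (rx * (u * A0 + θ * l * A1)
        + r * (ux * A0 + u * (ux * B0 + lx * B1) + (θ * lx * A1 + θ * l * (ux * B1 + lx * B2))))
      = rt * A0 + r * (ut * B0) + r * (lt * B1) + rx * (u * A0 + θ * l * A1) + r * ux * A0
        + r * u * ux * B0 + r * (u * (lx * B1)) + r * (θ * lx * A1) + r * θ * l * ux * B1
        + r * (θ * l * (lx * B2)) := by ring
  rw [this, e1, e2, e3, e4, e5, hrt]
  linear_combination e6

/-! ### Bounds of the entropy pair -/

section Bounds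

variable {γ : ℝ} (hγ : 1 < γ)
include hγ

theorem abs_avg_psi_le (k : ℕ) (D l : ℝ) :
    |avg (kernel γ k) psi D l| ≤ kernelMass γ * (1 + 4 * D ^ 2 + 4 * l ^ 2) := by
  refine abs_avg_le hγ k continuous_psi fun σ hσ => (abs_psi_le _).trans ?_
  have h1 : (l * σ) ^ 2 ≤ l ^ 2 := by
    rw [mul_pow]
    exact mul_le_of_le_one_right (sq_nonneg _) (by rw [← sq_abs]; exact pow_le_one₀ (abs_nonneg _) hσ)
  nlinarith [sq_nonneg (D - l * σ)]

theorem abs_entropyVar_le (r D : ℝ) :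
    |entropyVar γ r D| ≤ kernelMass γ * (2 * (1 + |D| + |r ^ theta γ|)) := by
  refine abs_avg_le hγ 0 continuous_psi' fun σ hσ => ?_
  rw [abs_of_nonneg (psi'_nonneg _)]
  refine (psi'_le _).trans ?_
  have h1 := abs_add_le D (r ^ theta γ * σ)
  have h2 : |r ^ theta γ * σ| ≤ |r ^ theta γ| := by
    rw [abs_mul]; exact mul_le_of_le_one_right (abs_nonneg _) hσ
  linarith

theorem abs_avg_psi''_le (k : ℕ) (D l : ℝ) :
    |avg (kernel γ k) psi'' D l| ≤ kernelMass γ * 3 :=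
  abs_avg_le hγ k continuous_psi'' fun _ _ => abs_psi''_le _

/-- The entropy, after subtraction of its linear part at a state with velocity zero, is controlled
by the relative energy. -/
theorem exists_abs_entropy_sub_le {b : ℝ} (hb : 0 < b) :
    ∃ C : ℝ, 0 ≤ C ∧ ∀ r D : ℝ, 0 < r → |entropy γ r D - entropyVar γ b 0 * (r * D)|
      ≤ C * (1 / 2 * (r * D ^ 2) + relativeEnergy γ r b) := by
  have hM := kernelMass_pos hγ
  have hκ := kappa_pos hγ
  have h0 : 0 < γ - 1 := by linarith
  refine ⟨kernelMass γ * (12 + 3 * ((γ - 1) / kappa γ)), by positivity, fun r D hr => ?_⟩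
  obtain ⟨l, hl⟩ : ∃ l, l = r ^ theta γ := ⟨_, rfl⟩
  obtain ⟨l', hl'⟩ : ∃ l', l' = b ^ theta γ := ⟨_, rfl⟩
  have c0 := continuous_kernel hγ 0
  have cψ := continuous_psi
  have cψ' := continuous_psi'
  have hE : r * (l - l') ^ 2 ≤ (γ - 1) / kappa γ * relativeEnergy γ r b := by
    have := le_relativeEnergy hγ hr hb
    rw [← hl, ← hl'] at this
    calc r * (l - l') ^ 2 = (γ - 1) / kappa γ * (kappa γ / (γ - 1) * (r * (l - l') ^ 2)) := by
          field_simp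
      _ ≤ _ := by gcongr
  -- Expansion in D around l sin α, but with slope taken at l' sin α: the Taylor error is of order
  -- D², the change of slope of order |D||l - l'|. Multiplied by r, both are controlled by the
  -- relative energy.
  have e1 : avg (kernel γ 0) psi D l - entropyVar γ b 0 * D
      = ∫ α in -(Real.pi / 2)..(Real.pi / 2), kernel γ 0 α * (psi (l * Real.sin α + D)
        - psi (l * Real.sin α) - D * psi' (l' * Real.sin α)) := by
    have z := avg_psi_zero γ l
    have e0 : avg (kernel γ 0) psi D l - entropyVar γ b 0 * D
        = avg (kernel γ 0) psi D l - avg (kernel γ 0) psi 0 l - entropyVar γ b 0 * D := by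
      rw [z, sub_zero]
    rw [e0]
    unfold entropyVar avg
    rw [← hl', ← intervalIntegral.integral_mul_const, ← intervalIntegral.integral_sub
      (Continuous.intervalIntegrable (by fun_prop) _ _)
      (Continuous.intervalIntegrable (by fun_prop) _ _), ← intervalIntegral.integral_sub
      (Continuous.intervalIntegrable (by fun_prop) _ _)
      (Continuous.intervalIntegrable (by fun_prop) _ _)]
    congr 1
    funext α
    rw [zero_add, zero_add, add_comm D]
    ring
  have e2 : |avg (kernel γ 0) psi D l - entropyVar γ b 0 * D|
      ≤ kernelMass γ * (6 * D ^ 2 + 3 * (l - l') ^ 2) := by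
    rw [e1]
    unfold kernelMass
    refine (intervalIntegral.abs_integral_le_integral_abs neg_pi_div_two_le).trans ?_
    rw [← intervalIntegral.integral_mul_const]
    refine intervalIntegral.integral_mono_on neg_pi_div_two_le
      (Continuous.intervalIntegrable (by fun_prop) _ _)
      (Continuous.intervalIntegrable (by fun_prop) _ _) fun α hα => ?_
    have hk := kernel_zero_nonneg (γ := γ) hα
    rw [abs_mul, abs_of_nonneg hk]
    refine mul_le_mul_of_nonneg_left ?_ hk
    have t1 := abs_psi_taylor_le (l * Real.sin α) D
    have t2 := abs_psi'_sub_le (l * Real.sin α) (l' * Real.sin α)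
    have t3 : |l * Real.sin α - l' * Real.sin α| ≤ |l - l'| := by
      rw [← sub_mul, abs_mul]
      exact mul_le_of_le_one_right (abs_nonneg _) (Real.abs_sin_le_one α)
    have t4 : |D * (psi' (l * Real.sin α) - psi' (l' * Real.sin α))| ≤ |D| * (3 * |l - l'|) := by
      rw [abs_mul]
      exact mul_le_mul_of_nonneg_left (by linarith) (abs_nonneg _)
    have t5 := abs_add_le (psi (l * Real.sin α + D) - psi (l * Real.sin α)
      - D * psi' (l * Real.sin α)) (D * (psi' (l * Real.sin α) - psi' (l' * Real.sin α)))
    rw [show psi (l * Real.sin α + D) - psi (l * Real.sin α)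
      - D * psi' (l * Real.sin α) + D * (psi' (l * Real.sin α) - psi' (l' * Real.sin α))
      = psi (l * Real.sin α + D) - psi (l * Real.sin α) - D * psi' (l' * Real.sin α) by ring] at t5
    have t6 : |D| * (3 * |l - l'|) ≤ 3 * D ^ 2 + 3 * (l - l') ^ 2 := by
      have s1 := sq_abs D
      have s2 := sq_abs (l - l')
      nlinarith [sq_nonneg (|D| - |l - l'|), sq_nonneg D, sq_nonneg (l - l')]
    linarith
  have e3 : entropy γ r D - entropyVar γ b 0 * (r * D)
      = r * (avg (kernel γ 0) psi D l - entropyVar γ b 0 * D) := by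
    unfold entropy; rw [hl]; ring
  rw [e3, abs_mul, abs_of_pos hr]
  have hD : 0 ≤ r * D ^ 2 := by positivity
  have hE0 := relativeEnergy_nonneg hγ hr hb
  calc r * |avg (kernel γ 0) psi D l - entropyVar γ b 0 * D|
      ≤ r * (kernelMass γ * (6 * D ^ 2 + 3 * (l - l') ^ 2)) :=
        mul_le_mul_of_nonneg_left e2 hr.le
    _ = kernelMass γ * (6 * (r * D ^ 2) + 3 * (r * (l - l') ^ 2)) := by ring
    _ ≤ kernelMass γ * ((12 + 3 * ((γ - 1) / kappa γ))
        * (1 / 2 * (r * D ^ 2) + relativeEnergy γ r b)) := by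
        refine mul_le_mul_of_nonneg_left ?_ hM.le
        have : 0 ≤ (γ - 1) / kappa γ * (r * D ^ 2) := by positivity
        nlinarith
    _ = _ := by ring

/-- The entropy flux controls `ρ |u|³`. -/
theorem exists_le_entropyFlux (c : ℝ) :
    ∃ C : ℝ, 0 ≤ C ∧ ∀ r u : ℝ, 0 < r → kernelMass γ / 8 * (r * |u| ^ 3)
      - C * (r + r * u ^ 2 + r ^ γ) ≤ entropyFlux γ r u (u - c) := by
  have hM := kernelMass_pos hγ
  refine ⟨kernelMass γ * (|c| * (4 + 8 * c ^ 2 + 8) + |c| ^ 3), by positivity, fun r u hr => ?_⟩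
  obtain ⟨l, hl⟩ : ∃ l, l = r ^ theta γ := ⟨_, rfl⟩
  have hl0 : 0 ≤ l := hl ▸ by positivity
  have h1 := cube_le_avg_psi hγ (u - c) l
  have h2 := avg_psi_one_nonneg hγ (u - c) hl0
  have h3 := abs_avg_psi_le hγ 0 (u - c) l
  have h4 : r ^ γ = r * l ^ 2 := by rw [hl, rpow_gamma hr]
  have hθ := theta_pos hγ
  unfold entropyFlux
  rw [← hl, h4]
  set A0 := avg (kernel γ 0) psi (u - c) l
  set A1 := avg (kernel γ 1) psi (u - c) l
  -- This part of the flux is discarded. In u = (u - c) + c, the first summand gives the cube and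
  -- the second only quadratic terms.
  have h5 : 0 ≤ theta γ * l * A1 := by positivity
  have h6 : -(|c| * (kernelMass γ * (1 + 4 * (u - c) ^ 2 + 4 * l ^ 2))) ≤ c * A0 := by
    have : |c * A0| ≤ |c| * (kernelMass γ * (1 + 4 * (u - c) ^ 2 + 4 * l ^ 2)) := by
      rw [abs_mul]; exact mul_le_mul_of_nonneg_left h3 (abs_nonneg _)
    exact (abs_le.1 this).1
  have h7 : |u| ^ 3 ≤ 4 * |u - c| ^ 3 + 4 * |c| ^ 3 := by
    have a1 : |u| ≤ |u - c| + |c| := by simpa using abs_add_le (u - c) c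
    have a2 := pow_le_pow_left₀ (abs_nonneg u) a1 3
    have a3 := abs_nonneg (u - c)
    have a4 := abs_nonneg c
    nlinarith [mul_nonneg (add_nonneg a3 a4) (sq_nonneg (|u - c| - |c|))]
  have h8 : 1 + 4 * (u - c) ^ 2 + 4 * l ^ 2
      ≤ (4 + 8 * c ^ 2 + 8) * (1 + u ^ 2 + l ^ 2) := by
    nlinarith [sq_nonneg (u + c), mul_nonneg (sq_nonneg c) (sq_nonneg u),
      mul_nonneg (sq_nonneg c) (sq_nonneg l), sq_nonneg l, sq_nonneg u]
  have h9 : u * A0 = (u - c) * A0 + c * A0 := by ring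
  have h10 : kernelMass γ / 8 * |u| ^ 3 - kernelMass γ * (|c| * (4 + 8 * c ^ 2 + 8) + |c| ^ 3)
      * (1 + u ^ 2 + l ^ 2) ≤ u * A0 := by
    rw [h9]
    have b1 := mul_le_mul_of_nonneg_left h7 (by positivity : 0 ≤ kernelMass γ / 8)
    have b2 := mul_le_mul_of_nonneg_left h8 (by positivity : 0 ≤ |c| * kernelMass γ)
    have b3 : 0 ≤ kernelMass γ * |c| ^ 3 * (u ^ 2 + l ^ 2) := by positivity
    have b4 : 0 ≤ kernelMass γ * |c| ^ 3 := by positivity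
    nlinarith
  have h11 := mul_le_mul_of_nonneg_left h10 hr.le
  have h12 := mul_nonneg hr.le h5
  nlinarith

end Bounds

/-! ## The relative entropy pair of a flow -/

/-- The entropy relative to the state `(b, c)`. -/
def relEntropy (γ b c r u : ℝ) : ℝ := entropy γ r (u - c) - entropyVar γ b 0 * (r * (u - c))

/-- The flux of `relEntropy`, normalized to vanish at `(b, c)`. -/
def relFlux (γ b c r u : ℝ) : ℝ :=
  entropyFlux γ r u (u - c) - entropyFlux γ b c 0
    - entropyVar γ b 0 * (r * u * (u - c) + pressure γ r - pressure γ b)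

/-- The derivative of `relEntropy` with respect to the momentum. -/
def relVar (γ b c r u : ℝ) : ℝ := entropyVar γ r (u - c) - entropyVar γ b 0

section Continuity

variable {γ : ℝ} (hγ : 1 < γ) {X : Type*} [TopologicalSpace X] {r u : X → ℝ}
  (hr : Continuous r) (hu : Continuous u) (b c : ℝ)
include hγ hr hu

theorem continuous_avg_psi {f : ℝ → ℝ} (hf : Continuous f) (k : ℕ) :
    Continuous fun p => avg (kernel γ k) f (u p - c) (r p ^ theta γ) :=
  continuous_avg (continuous_kernel hγ k) hf (by fun_prop)
    (hr.rpow_const fun _ => Or.inr (theta_pos hγ).le)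

theorem continuous_relEntropy : Continuous fun p => relEntropy γ b c (r p) (u p) := by
  have h0 := continuous_avg_psi hγ hr hu c continuous_psi 0
  unfold relEntropy entropy
  fun_prop

theorem continuous_relFlux : Continuous fun p => relFlux γ b c (r p) (u p) := by
  have h0 := continuous_avg_psi hγ hr hu c continuous_psi 0
  have h1 := continuous_avg_psi hγ hr hu c continuous_psi 1
  have h2 : Continuous fun p => r p ^ theta γ :=
    hr.rpow_const fun _ => Or.inr (theta_pos hγ).le
  have h3 : Continuous fun p => r p ^ γ := hr.rpow_const fun _ => Or.inr (by linarith)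
  unfold relFlux entropyFlux pressure
  fun_prop

theorem continuous_relVar : Continuous fun p => relVar γ b c (r p) (u p) := by
  have h0 := continuous_avg_psi hγ hr hu c continuous_psi' 0
  unfold relVar
  have : Continuous fun p => entropyVar γ (r p) (u p - c) := h0
  fun_prop

end Continuity

section Derivatives

variable {γ ε : ℝ} {r u rx ux rxx uxx : ℝ → ℝ → ℝ}

/-- The acceleration of a flow. -/
def accel (γ ε : ℝ) (r u rx ux uxx : ℝ → ℝ → ℝ) (t x : ℝ) : ℝ :=
  ε * uxx t x / r t x - u t x * ux t x - theta γ ^ 2 * r t x ^ (γ - 2) * rx t x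

/-- The time derivative of `relEntropy` along a flow. -/
def relEntropyT (γ ε b c : ℝ) (r u rx ux uxx : ℝ → ℝ → ℝ) (t x : ℝ) : ℝ :=
  -(rx t x * u t x + r t x * ux t x) * avg (kernel γ 0) psi (u t x - c) (r t x ^ theta γ)
    + r t x * (accel γ ε r u rx ux uxx t x * avg (kernel γ 0) psi' (u t x - c) (r t x ^ theta γ)
      + -(rx t x * u t x + r t x * ux t x) * theta γ * r t x ^ (theta γ - 1)
        * avg (kernel γ 1) psi' (u t x - c) (r t x ^ theta γ))
    - entropyVar γ b 0 * (-(rx t x * u t x + r t x * ux t x) * (u t x - c)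
      + r t x * accel γ ε r u rx ux uxx t x)

/-- The space derivative of `relFlux` along a flow. -/
def relFluxX (γ b c : ℝ) (r u rx ux : ℝ → ℝ → ℝ) (t x : ℝ) : ℝ :=
  rx t x * (u t x * avg (kernel γ 0) psi (u t x - c) (r t x ^ theta γ)
      + theta γ * r t x ^ theta γ * avg (kernel γ 1) psi (u t x - c) (r t x ^ theta γ))
    + r t x * (ux t x * avg (kernel γ 0) psi (u t x - c) (r t x ^ theta γ)
      + u t x * (ux t x * avg (kernel γ 0) psi' (u t x - c) (r t x ^ theta γ)
        + rx t x * theta γ * r t x ^ (theta γ - 1)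
          * avg (kernel γ 1) psi' (u t x - c) (r t x ^ theta γ))
      + (theta γ * (rx t x * theta γ * r t x ^ (theta γ - 1))
          * avg (kernel γ 1) psi (u t x - c) (r t x ^ theta γ)
        + theta γ * r t x ^ theta γ * (ux t x * avg (kernel γ 1) psi' (u t x - c) (r t x ^ theta γ)
          + rx t x * theta γ * r t x ^ (theta γ - 1)
            * avg (kernel γ 2) psi' (u t x - c) (r t x ^ theta γ))))
    - entropyVar γ b 0 * ((rx t x * u t x + r t x * ux t x) * (u t x - c)
      + r t x * u t x * ux t x + theta γ ^ 2 * r t x ^ (γ - 1) * rx t x)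

/-- The space derivative of `relVar` along a flow. -/
def relVarX (γ c : ℝ) (r u rx ux : ℝ → ℝ → ℝ) (t x : ℝ) : ℝ :=
  ux t x * avg (kernel γ 0) psi'' (u t x - c) (r t x ^ theta γ)
    + rx t x * theta γ * r t x ^ (theta γ - 1)
      * avg (kernel γ 1) psi'' (u t x - c) (r t x ^ theta γ)

variable (hγ : 1 < γ) (F : Flow γ ε r u rx ux rxx uxx) (b c : ℝ)
include hγ F

omit hγ in
theorem Flow.continuous_accel : Continuous fun p : ℝ × ℝ => accel γ ε r u rx ux uxx p.1 p.2 := by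
  have h1 := F.cont_u
  have h2 := F.cont_rx
  have h3 := F.cont_ux
  have h4 := F.continuous_rpow (γ - 2)
  have h5 : Continuous fun p : ℝ × ℝ => ε * uxx p.1 p.2 / r p.1 p.2 :=
    (F.cont_uxx.const_mul ε).div F.cont_r fun p => (F.pos p.1 p.2).ne'
  unfold accel
  fun_prop

theorem Flow.continuous_relEntropyT :
    Continuous fun p : ℝ × ℝ => relEntropyT γ ε b c r u rx ux uxx p.1 p.2 := by
  have h0 := F.cont_r
  have h1 := F.cont_u
  have h2 := F.cont_rx
  have h3 := F.cont_ux
  have h4 := F.continuous_rpow (theta γ - 1)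
  have h5 := F.continuous_accel
  have a1 := continuous_avg_psi hγ h0 h1 c continuous_psi 0
  have a2 := continuous_avg_psi hγ h0 h1 c continuous_psi' 0
  have a3 := continuous_avg_psi hγ h0 h1 c continuous_psi' 1
  unfold relEntropyT
  fun_prop

theorem Flow.continuous_relFluxX :
    Continuous fun p : ℝ × ℝ => relFluxX γ b c r u rx ux p.1 p.2 := by
  have h0 := F.cont_r
  have h1 := F.cont_u
  have h2 := F.cont_rx
  have h3 := F.cont_ux
  have h4 := F.continuous_rpow (theta γ - 1)
  have h5 := F.continuous_rpow (theta γ)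
  have h6 := F.continuous_rpow (γ - 1)
  have a0 := continuous_avg_psi hγ h0 h1 c continuous_psi 0
  have a1 := continuous_avg_psi hγ h0 h1 c continuous_psi 1
  have b0 := continuous_avg_psi hγ h0 h1 c continuous_psi' 0
  have b1 := continuous_avg_psi hγ h0 h1 c continuous_psi' 1
  have b2 := continuous_avg_psi hγ h0 h1 c continuous_psi' 2
  unfold relFluxX
  fun_prop

theorem Flow.continuous_relVarX :
    Continuous fun p : ℝ × ℝ => relVarX γ c r u rx ux p.1 p.2 := by
  have h0 := F.cont_r
  have h1 := F.cont_u
  have h2 := F.cont_rx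
  have h3 := F.cont_ux
  have h4 := F.continuous_rpow (theta γ - 1)
  have a0 := continuous_avg_psi hγ h0 h1 c continuous_psi'' 0
  have a1 := continuous_avg_psi hγ h0 h1 c continuous_psi'' 1
  unfold relVarX
  fun_prop

theorem Flow.hasDerivAt_avg_t {f f' : ℝ → ℝ} (hf' : Continuous f')
    (hd : ∀ s, HasDerivAt f (f' s) s) (k : ℕ) {t : ℝ} (ht : 0 < t) (x : ℝ) :
    HasDerivAt (fun τ => avg (kernel γ k) f (u τ x - c) (r τ x ^ theta γ))
      (accel γ ε r u rx ux uxx t x * avg (kernel γ k) f' (u t x - c) (r t x ^ theta γ)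
        + -(rx t x * u t x + r t x * ux t x) * theta γ * r t x ^ (theta γ - 1)
          * avg (kernel γ (k + 1)) f' (u t x - c) (r t x ^ theta γ)) t := by
  have line : Continuous fun τ : ℝ => ((τ, x) : ℝ × ℝ) := by fun_prop
  have c0 : Continuous fun τ => r τ x := F.cont_r.comp line
  have c1 : Continuous fun τ => u τ x := F.cont_u.comp line
  have c2 : Continuous fun τ => rx τ x := F.cont_rx.comp line
  have c3 : Continuous fun τ => ux τ x := F.cont_ux.comp line
  have c4 : Continuous fun τ => r τ x ^ (theta γ - 1) := (F.continuous_rpow _).comp line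
  have c5 : Continuous fun τ => r τ x ^ theta γ := (F.continuous_rpow _).comp line
  have c6 : Continuous fun τ => accel γ ε r u rx ux uxx τ x := (F.continuous_accel).comp line
  exact hasDerivAt_avg hγ k hf' hd (a := fun τ => u τ x - c) (l := fun τ => r τ x ^ theta γ)
    (a' := fun τ => accel γ ε r u rx ux uxx τ x)
    (l' := fun τ => -(rx τ x * u τ x + r τ x * ux τ x) * theta γ * r τ x ^ (theta γ - 1))
    (by fun_prop) c5 c6 (by fun_prop) (Ioi_mem_nhds ht)
    (fun τ hτ => (F.hut τ x hτ).sub_const c)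
    (fun τ hτ => (F.hrt τ x hτ).rpow_const (Or.inl (F.pos τ x).ne'))

theorem Flow.hasDerivAt_avg_x {f f' : ℝ → ℝ} (hf' : Continuous f')
    (hd : ∀ s, HasDerivAt f (f' s) s) (k : ℕ) (t x : ℝ) :
    HasDerivAt (fun y => avg (kernel γ k) f (u t y - c) (r t y ^ theta γ))
      (ux t x * avg (kernel γ k) f' (u t x - c) (r t x ^ theta γ)
        + rx t x * theta γ * r t x ^ (theta γ - 1)
          * avg (kernel γ (k + 1)) f' (u t x - c) (r t x ^ theta γ)) x := by
  have line : Continuous fun y : ℝ => ((t, y) : ℝ × ℝ) := by fun_prop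
  have c1 : Continuous fun y => u t y := F.cont_u.comp line
  have c2 : Continuous fun y => rx t y := F.cont_rx.comp line
  have c3 : Continuous fun y => ux t y := F.cont_ux.comp line
  have c4 : Continuous fun y => r t y ^ (theta γ - 1) := (F.continuous_rpow _).comp line
  have c5 : Continuous fun y => r t y ^ theta γ := (F.continuous_rpow _).comp line
  exact hasDerivAt_avg hγ k hf' hd (a := fun y => u t y - c) (l := fun y => r t y ^ theta γ)
    (a' := fun y => ux t y)
    (l' := fun y => rx t y * theta γ * r t y ^ (theta γ - 1))
    (by fun_prop) c5 c3 (by fun_prop) univ_mem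
    (fun y _ => (F.hux t y).sub_const c)
    (fun y _ => (F.hrx t y).rpow_const (Or.inl (F.pos t y).ne'))

theorem Flow.hasDerivAt_relEntropy {t : ℝ} (ht : 0 < t) (x : ℝ) :
    HasDerivAt (fun τ => relEntropy γ b c (r τ x) (u τ x))
      (relEntropyT γ ε b c r u rx ux uxx t x) t :=
  ((F.hrt t x ht).fun_mul (F.hasDerivAt_avg_t hγ c continuous_psi' hasDerivAt_psi 0 ht x)).fun_sub
    (((F.hrt t x ht).fun_mul ((F.hut t x ht).sub_const c)).const_mul (entropyVar γ b 0))

theorem Flow.hasDerivAt_relFlux (t x : ℝ) :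
    HasDerivAt (fun y => relFlux γ b c (r t y) (u t y)) (relFluxX γ b c r u rx ux t x) x := by
  have d0 := F.hasDerivAt_avg_x hγ c continuous_psi' hasDerivAt_psi 0 t x
  have d1 := F.hasDerivAt_avg_x hγ c continuous_psi' hasDerivAt_psi 1 t x
  have dl := (F.hrx t x).rpow_const (p := theta γ) (Or.inl (F.pos t x).ne')
  have e1 := (F.hrx t x).fun_mul (((F.hux t x).fun_mul d0).fun_add ((dl.const_mul (theta γ)).fun_mul d1))
  have e2 := ((((F.hrx t x).fun_mul (F.hux t x)).fun_mul ((F.hux t x).sub_const c)).fun_add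
    (hasDerivAt_pressure hγ (F.hrx t x))).sub_const (pressure γ b)
  exact ((e1.sub_const (entropyFlux γ b c 0)).fun_sub (e2.const_mul (entropyVar γ b 0))).congr_deriv
    (by unfold relFluxX; ring)

theorem Flow.hasDerivAt_relVar (t x : ℝ) :
    HasDerivAt (fun y => relVar γ b c (r t y) (u t y)) (relVarX γ c r u rx ux t x) x :=
  (F.hasDerivAt_avg_x hγ c continuous_psi'' hasDerivAt_psi' 0 t x).sub_const _

/-- The entropy balance. -/
theorem Flow.relEntropyT_add_relFluxX (t x : ℝ) :
    relEntropyT γ ε b c r u rx ux uxx t x + relFluxX γ b c r u rx ux t x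
      = ε * uxx t x * relVar γ b c (r t x) (u t x) := by
  have hr := F.pos t x
  have p1 : r t x * r t x ^ (theta γ - 1) = r t x ^ theta γ := by
    rw [mul_comm, ← Real.rpow_add_one hr.ne', sub_add_cancel]
  have p2 : r t x * r t x ^ (γ - 2) = r t x ^ (γ - 1) := by
    rw [mul_comm, ← Real.rpow_add_one hr.ne']; congr 1; ring
  have p3 := rpow_gamma_sub_one (γ := γ) hr
  have h := entropy_identity_aux (r := r t x) (u := u t x) (rx := rx t x) (ux := ux t x)
    (A0 := avg (kernel γ 0) psi (u t x - c) (r t x ^ theta γ))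
    (B1 := avg (kernel γ 1) psi' (u t x - c) (r t x ^ theta γ))
    (g := theta γ ^ 2 * r t x ^ (γ - 2) * rx t x) (v := ε * uxx t x / r t x)
    (rt := -(rx t x * u t x + r t x * ux t x)) (ut := accel γ ε r u rx ux uxx t x)
    (lt := -(rx t x * u t x + r t x * ux t x) * theta γ * r t x ^ (theta γ - 1))
    (lx := rx t x * theta γ * r t x ^ (theta γ - 1))
    (by rw [← p3, ← p2]; ring)
    (avg_parts hγ continuous_psi' hasDerivAt_psi (u t x - c) (r t x ^ theta γ)) rfl rfl
    (by rw [← p1]; ring) (by rw [← p1]; ring)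
  have h2 : r t x * accel γ ε r u rx ux uxx t x
      = ε * uxx t x - r t x * u t x * ux t x - theta γ ^ 2 * r t x ^ (γ - 1) * rx t x := by
    unfold accel
    rw [← p2]
    field_simp
  have h3 : r t x * (ε * uxx t x / r t x) = ε * uxx t x := by field_simp
  rw [h3] at h
  unfold relEntropyT relFluxX relVar
  rw [h2, show entropyVar γ (r t x) (u t x - c)
    = avg (kernel γ 0) psi' (u t x - c) (r t x ^ theta γ) from rfl]
  linear_combination h

end Derivatives

/-! ### Bounds of the relative entropy pair -/

section Bounds

variable {γ : ℝ} (hγ : 1 < γ) {b : ℝ} (hb : 0 < b) (c : ℝ)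
include hγ

/-- The terms subtracted from the entropy flux are momentum flux, pressure and constants, hence of
lower order than ρ|u|³ and bounded by the moments. -/
theorem exists_neg_relFlux_le : ∃ C : ℝ, 0 ≤ C ∧ ∀ r u : ℝ, 0 < r → -relFlux γ b c r u
    ≤ -(kernelMass γ / 8 * (r * |u| ^ 3)) + C * (1 + (r + r * |u| + r * u ^ 2 + r ^ γ)) := by
  obtain ⟨C, hC0, hC⟩ := exists_le_entropyFlux hγ c
  have hκ := kappa_pos hγ
  obtain ⟨H, hH⟩ : ∃ H, H = entropyVar γ b 0 := ⟨_, rfl⟩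
  refine ⟨C + |entropyFlux γ b c 0| + |H| * (1 + |c| + kappa γ + |pressure γ b|), by positivity,
    fun r u hr => ?_⟩
  have h1 := hC r u hr
  obtain ⟨g, hg⟩ : ∃ g, g = r ^ γ := ⟨_, rfl⟩
  have hg0 : 0 ≤ g := hg ▸ by positivity
  have hp : pressure γ r = kappa γ * g := by rw [hg]; rfl
  unfold relFlux
  rw [← hH, hp]
  rw [← hg] at h1 ⊢
  have e1 : |r * u * (u - c) + kappa γ * g - pressure γ b|
      ≤ (1 + |c| + kappa γ + |pressure γ b|) * (1 + (r + r * |u| + r * u ^ 2 + g)) := by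
    have a1 : |r * u * (u - c)| ≤ r * u ^ 2 + |c| * (r * |u|) := by
      rw [show r * u * (u - c) = r * u ^ 2 - c * (r * u) by ring]
      refine (abs_sub _ _).trans ?_
      rw [abs_of_nonneg (by positivity : 0 ≤ r * u ^ 2), abs_mul, abs_mul r u, abs_of_pos hr]
    have a2 := abs_sub (r * u * (u - c) + kappa γ * g) (pressure γ b)
    have a3 := abs_add_le (r * u * (u - c)) (kappa γ * g)
    rw [abs_of_nonneg (by positivity : 0 ≤ kappa γ * g)] at a3
    have n1 : 0 ≤ r * |u| := by positivity
    have n2 : 0 ≤ r * u ^ 2 := by positivity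
    have n3 := abs_nonneg c
    have n4 := abs_nonneg (pressure γ b)
    have m1 : 0 ≤ (|c| + kappa γ + |pressure γ b|) * (r * u ^ 2 + r) := by positivity
    have m2 : 0 ≤ (1 + kappa γ + |pressure γ b|) * (r * |u|) := by positivity
    have m3 : 0 ≤ (1 + |c| + |pressure γ b|) * g := by positivity
    nlinarith
  have e2 : H * (r * u * (u - c) + kappa γ * g - pressure γ b)
      ≤ |H| * ((1 + |c| + kappa γ + |pressure γ b|) * (1 + (r + r * |u| + r * u ^ 2 + g))) := by
    refine (le_abs_self _).trans ?_
    rw [abs_mul]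
    exact mul_le_mul_of_nonneg_left e1 (abs_nonneg _)
  have e3 := le_abs_self (entropyFlux γ b c 0)
  have n1 : 0 ≤ r * |u| := by positivity
  have n2 : 0 ≤ r * u ^ 2 := by positivity
  have e4 : 0 ≤ |entropyFlux γ b c 0| * (r + r * |u| + r * u ^ 2 + g) := by positivity
  have e5 : 0 ≤ C * (1 + r * |u|) := by positivity
  nlinarith

/-- ψ' grows linearly, and (ρ^θ)² = ρ^(γ-1) ≤ 1 + ρ^γ. The u² carries no factor ρ, so the energy
does not control it near vacuum; this is what `exists_velocity_bound` is for. -/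
theorem exists_relVar_sq_le : ∃ C : ℝ, 0 ≤ C ∧ ∀ r u : ℝ, 0 < r →
    relVar γ b c r u ^ 2 ≤ C * (1 + u ^ 2 + r ^ γ) := by
  have hM := kernelMass_pos hγ
  obtain ⟨H, hH⟩ : ∃ H, H = entropyVar γ b 0 := ⟨_, rfl⟩
  refine ⟨2 * (kernelMass γ * 2) ^ 2 * (12 + 6 * c ^ 2) + 2 * H ^ 2, by positivity, fun r u hr => ?_⟩
  have h1 := abs_entropyVar_le hγ r (u - c)
  have h2 : (r ^ theta γ) ^ 2 ≤ 1 + r ^ γ := by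
    rw [← rpow_gamma_sub_one hr]
    have g0 : 0 < r ^ γ := by positivity
    rcases le_total r 1 with h | h
    · linarith [Real.rpow_le_one hr.le h (by linarith : 0 ≤ γ - 1)]
    · linarith [Real.rpow_le_rpow_of_exponent_le h (by linarith : γ - 1 ≤ γ)]
  have h3 : entropyVar γ r (u - c) ^ 2
      ≤ (kernelMass γ * 2) ^ 2 * (3 + 3 * (u - c) ^ 2 + 3 * (r ^ theta γ) ^ 2) := by
    rw [← sq_abs]
    refine (pow_le_pow_left₀ (abs_nonneg _) h1 2).trans ?_
    rw [← mul_assoc, mul_pow]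
    refine mul_le_mul_of_nonneg_left ?_ (sq_nonneg _)
    rw [← sq_abs (u - c), ← sq_abs (r ^ theta γ)]
    nlinarith [sq_nonneg (1 - |u - c|), sq_nonneg (1 - |r ^ theta γ|),
      sq_nonneg (|u - c| - |r ^ theta γ|)]
  have h4 : 3 + 3 * (u - c) ^ 2 + 3 * (r ^ theta γ) ^ 2
      ≤ (12 + 6 * c ^ 2) * (1 + u ^ 2 + r ^ γ) := by
    have g0 : 0 < r ^ γ := by positivity
    have : 0 ≤ c ^ 2 * (u ^ 2 + r ^ γ) := by positivity
    nlinarith [sq_nonneg (u + c), sq_nonneg u]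
  have h5 := mul_le_mul_of_nonneg_left h4 (sq_nonneg (kernelMass γ * 2))
  unfold relVar
  rw [← hH]
  have g0 : 0 < r ^ γ := by positivity
  have h6 : 0 ≤ H ^ 2 * (u ^ 2 + r ^ γ) := by positivity
  nlinarith [sq_nonneg (entropyVar γ r (u - c) + H)]

/-- ψ'' is bounded, and the square of (ρ^θ)_x is θ²ρ^(γ-3)ρ_x², exactly the density part of the
dissipation. -/
theorem exists_relVarX_mul_le : ∃ C : ℝ, 0 ≤ C ∧ ∀ (r u rx ux : ℝ → ℝ → ℝ) (t x : ℝ),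
    0 < r t x → |relVarX γ c r u rx ux t x * ux t x|
      ≤ C * (ux t x ^ 2 + r t x ^ (γ - 3) * rx t x ^ 2) := by
  have hM := kernelMass_pos hγ
  have hθ := theta_pos hγ
  refine ⟨kernelMass γ * 3 * (2 + theta γ ^ 2), by positivity, fun r u rx ux t x hr => ?_⟩
  have h0 := abs_avg_psi''_le hγ 0 (u t x - c) (r t x ^ theta γ)
  have h1 := abs_avg_psi''_le hγ 1 (u t x - c) (r t x ^ theta γ)
  obtain ⟨lx, hlx⟩ : ∃ lx, lx = rx t x * theta γ * r t x ^ (theta γ - 1) := ⟨_, rfl⟩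
  have h2 : lx ^ 2 = theta γ ^ 2 * (r t x ^ (γ - 3) * rx t x ^ 2) := by
    have : (r t x ^ (theta γ - 1)) ^ 2 = r t x ^ (γ - 3) := by
      rw [← Real.rpow_natCast, ← Real.rpow_mul hr.le]; congr 1; unfold theta; push_cast; ring
    rw [hlx, mul_pow, this]; ring
  have h3 : 0 ≤ r t x ^ (γ - 3) * rx t x ^ 2 := by positivity
  unfold relVarX
  rw [← hlx]
  set A := avg (kernel γ 0) psi'' (u t x - c) (r t x ^ theta γ)
  set B := avg (kernel γ 1) psi'' (u t x - c) (r t x ^ theta γ)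
  have e1 : |(ux t x * A + lx * B) * ux t x| ≤ |ux t x| ^ 2 * |A| + |lx| * |ux t x| * |B| := by
    rw [show (ux t x * A + lx * B) * ux t x = ux t x ^ 2 * A + lx * ux t x * B by ring]
    refine (abs_add_le _ _).trans ?_
    rw [abs_mul, abs_mul (lx * ux t x), abs_mul lx, abs_pow]
  have e2 := mul_le_mul_of_nonneg_left h0 (sq_nonneg |ux t x|)
  have e3 := mul_le_mul_of_nonneg_left h1 (mul_nonneg (abs_nonneg lx) (abs_nonneg (ux t x)))
  have e4 : |lx| * |ux t x| ≤ ux t x ^ 2 + theta γ ^ 2 * (r t x ^ (γ - 3) * rx t x ^ 2) := by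
    rw [← h2, ← sq_abs lx, ← sq_abs (ux t x)]
    nlinarith [sq_nonneg (|lx| - |ux t x|), sq_nonneg |lx|, sq_nonneg |ux t x|]
  have e5 := mul_le_mul_of_nonneg_right e4 (by positivity : 0 ≤ kernelMass γ * 3)
  have e6 : 0 ≤ kernelMass γ * 3 * (theta γ ^ 2 * ux t x ^ 2 + 2 * (r t x ^ (γ - 3) * rx t x ^ 2)) := by
    positivity
  rw [sq_abs] at e1 e2
  nlinarith

include hb in
/-- The relative energy with respect to a constant state is controlled by the moments. -/
theorem exists_stateEnergy_le : ∃ C : ℝ, 0 ≤ C ∧ ∀ r u : ℝ, 0 < r →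
    1 / 2 * (r * (u - c) ^ 2) + relativeEnergy γ r b
      ≤ C * (1 + (r + r * |u| + r * u ^ 2 + r ^ γ)) := by
  have hκ := kappa_pos hγ
  have h0 : 0 < γ - 1 := by linarith
  refine ⟨1 + c ^ 2 + kappa γ / (γ - 1) * (1 + γ * b ^ γ), by positivity, fun r u hr => ?_⟩
  rw [relativeEnergy_eq hγ]
  have hbb : b ^ (γ - 1) * b = b ^ γ := by
    rw [← Real.rpow_add_one hb.ne', sub_add_cancel]
  have g0 : 0 < r ^ γ := by positivity
  have g1 : 0 < b ^ γ := by positivity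
  have g2 : 0 ≤ γ * b ^ (γ - 1) * r := by positivity
  have e1 : r ^ γ - b ^ γ - γ * b ^ (γ - 1) * (r - b) ≤ (1 + γ * b ^ γ) * (1 + r ^ γ) := by
    have : 0 ≤ γ * b ^ γ * r ^ γ := by positivity
    nlinarith
  have e2 : kappa γ / (γ - 1) * (r ^ γ - b ^ γ - γ * b ^ (γ - 1) * (r - b))
      ≤ kappa γ / (γ - 1) * ((1 + γ * b ^ γ) * (1 + r ^ γ)) :=
    mul_le_mul_of_nonneg_left e1 (by positivity)
  have n1 : 0 ≤ r * |u| := by positivity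
  have n2 : 0 ≤ r * u ^ 2 := by positivity
  have e3 : 1 / 2 * (r * (u - c) ^ 2) ≤ (1 + c ^ 2) * (r + r * u ^ 2) := by
    have : 0 ≤ r * (u + c) ^ 2 := by positivity
    have : 0 ≤ r * c ^ 2 * u ^ 2 := by positivity
    nlinarith
  have e4 : 0 ≤ kappa γ / (γ - 1) * (1 + γ * b ^ γ) * (r + r * |u| + r * u ^ 2) := by positivity
  have e5 : 0 ≤ (1 + c ^ 2) * (1 + r * |u| + r ^ γ) := by positivity
  nlinarith

end Bounds

/-! ## The bound of `ρ |u|³` -/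

/-- A tent that equals `1` on `[-K, K]` and vanishes outside of `[-(K + 1), K + 1]`. -/
def tent (K x : ℝ) : ℝ := max 0 (min 1 (K + 1 - |x|))

theorem continuous_tent (K : ℝ) : Continuous (tent K) := by unfold tent; fun_prop

theorem tent_nonneg (K x : ℝ) : 0 ≤ tent K x := le_max_left _ _

theorem tent_le_one (K x : ℝ) : tent K x ≤ 1 := max_le zero_le_one (min_le_left _ _)

theorem tent_eq_one {K x : ℝ} (h : |x| ≤ K) : tent K x = 1 := by
  unfold tent
  rw [min_eq_left (by linarith), max_eq_right zero_le_one]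

theorem tent_eq_zero {K x : ℝ} (h : K + 1 ≤ |x|) : tent K x = 0 := by
  unfold tent
  exact max_eq_left ((min_le_right _ _).trans (by linarith))

theorem integral_tent_mul_le {K N : ℝ} (hK : 0 ≤ K) (hN : K + 1 ≤ N) {f : ℝ → ℝ}
    (hf : Continuous f) (h0 : ∀ x, 0 ≤ f x) :
    ∫ x in -N..N, tent K x * f x ≤ ∫ x in -(K + 1)..(K + 1), f x := by
  have ct := continuous_tent K
  have hi : ∀ a b, IntervalIntegrable (fun x => tent K x * f x) volume a b := fun a b =>
    Continuous.intervalIntegrable (by fun_prop) _ _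
  rw [← intervalIntegral.integral_add_adjacent_intervals (hi (-N) (-(K + 1))) (hi (-(K + 1)) N),
    ← intervalIntegral.integral_add_adjacent_intervals (hi (-(K + 1)) (K + 1)) (hi (K + 1) N)]
  have h1 : ∫ x in -N..-(K + 1), tent K x * f x = 0 := by
    rw [intervalIntegral.integral_congr (g := fun _ => (0 : ℝ)), intervalIntegral.integral_zero]
    intro x hx
    rw [uIcc_of_le (by linarith)] at hx
    beta_reduce
    rw [tent_eq_zero (by rw [abs_of_nonpos (by linarith [hx.2])]; linarith [hx.2]), zero_mul]
  have h2 : ∫ x in (K + 1)..N, tent K x * f x = 0 := by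
    rw [intervalIntegral.integral_congr (g := fun _ => (0 : ℝ)), intervalIntegral.integral_zero]
    intro x hx
    rw [uIcc_of_le hN] at hx
    beta_reduce
    rw [tent_eq_zero (hx.1.trans (le_abs_self x)), zero_mul]
  rw [h1, h2, zero_add, add_zero]
  exact intervalIntegral.integral_mono_on (by linarith) (hi _ _) (hf.intervalIntegrable _ _)
    fun x _ => mul_le_of_le_one_left (h0 x) (tent_le_one K x)

/-- A weight that increases from `0` at `-2 R` and decreases with slope `tent K` to `0`. -/
def weight (K R x : ℝ) : ℝ :=
  Real.smoothTransition ((x + 2 * R) / R) * -∫ y in (K + 1)..x, tent K y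

/-- The derivative of `weight`. -/
def weightX (K R x : ℝ) : ℝ :=
  stepDeriv ((x + 2 * R) / R) / R * (-∫ y in (K + 1)..x, tent K y)
    - Real.smoothTransition ((x + 2 * R) / R) * tent K x

theorem hasDerivAt_weight (K R x : ℝ) : HasDerivAt (weight K R) (weightX K R x) x := by
  have h1 : HasDerivAt (fun x => (x + 2 * R) / R) (1 / R) x := by
    simpa using ((hasDerivAt_id x).add_const (2 * R)).div_const R
  refine (((hasDerivAt_step _).comp x h1).fun_mul
    (hasDerivAt_primitive (continuous_tent K) (K + 1) x).fun_neg).congr_deriv ?_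
  simp only [weightX, Function.comp]
  ring

theorem continuous_weight (K R : ℝ) : Continuous (weight K R) :=
  continuous_iff_continuousAt.2 fun x => (hasDerivAt_weight K R x).continuousAt

theorem continuous_weightX (K R : ℝ) : Continuous (weightX K R) := by
  have h1 := continuous_stepDeriv
  have h2 := Real.smoothTransition.continuous
  have h3 := continuous_tent K
  have h4 : Continuous fun x => ∫ y in (K + 1)..x, tent K y :=
    intervalIntegral.continuous_primitive (fun _ _ => h3.intervalIntegrable _ _) _
  unfold weightX
  fun_prop

theorem neg_integral_tent_eq_zero {K x : ℝ} (hx : K + 1 ≤ x) :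
    -∫ y in (K + 1)..x, tent K y = 0 := by
  rw [intervalIntegral.integral_congr (g := fun _ => (0 : ℝ)), intervalIntegral.integral_zero,
    neg_zero]
  intro y hy
  rw [uIcc_of_le hx] at hy
  exact tent_eq_zero (hy.1.trans (le_abs_self y))

theorem neg_integral_tent_mem {K : ℝ} (hK : 0 ≤ K) (x : ℝ) :
    -∫ y in (K + 1)..x, tent K y ∈ Icc 0 (2 * (K + 1)) := by
  have ct := continuous_tent K
  rcases le_total (K + 1) x with hx | hx
  · rw [neg_integral_tent_eq_zero hx]
    exact ⟨le_rfl, by linarith⟩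
  rw [← intervalIntegral.integral_symm]
  refine ⟨intervalIntegral.integral_nonneg hx fun y _ => tent_nonneg K y, ?_⟩
  have h := integral_tent_mul_le hK (le_max_left (K + 1) (-x)) (f := fun _ => 1)
    continuous_const fun _ => zero_le_one
  simp only [mul_one, intervalIntegral.integral_const, smul_eq_mul] at h
  refine le_trans (intervalIntegral.integral_mono_interval ?_ hx (le_max_left _ (-x))
    (Eventually.of_forall fun y => tent_nonneg K y) (ct.intervalIntegrable _ _)) (h.trans ?_)
  · linarith [le_max_right (K + 1) (-x)]
  · linarith

theorem weight_nonneg {K : ℝ} (hK : 0 ≤ K) (R x : ℝ) : 0 ≤ weight K R x :=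
  mul_nonneg (Real.smoothTransition.nonneg _) (neg_integral_tent_mem hK x).1

theorem weight_le {K : ℝ} (hK : 0 ≤ K) (R x : ℝ) : weight K R x ≤ 2 * (K + 1) :=
  (mul_le_of_le_one_left (neg_integral_tent_mem hK x).1 (Real.smoothTransition.le_one _)).trans
    (neg_integral_tent_mem hK x).2

theorem weight_left {K R : ℝ} (hR : 0 < R) : weight K R (-(2 * R)) = 0 := by
  unfold weight
  rw [Real.smoothTransition.zero_of_nonpos, zero_mul]
  exact div_nonpos_of_nonpos_of_nonneg (by linarith) hR.le

theorem weight_right {K R x : ℝ} (hx : K + 1 ≤ x) : weight K R x = 0 := by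
  unfold weight
  rw [neg_integral_tent_eq_zero hx, mul_zero]

/-- In the product of the derivative of the weight with a quantity that is small on the left, only
the contribution of the tent remains. -/
theorem mul_weightX_le {K R c : ℝ} (hK : 0 ≤ K) (hR : K + 1 ≤ R) (hc : ∀ y, stepDeriv y ≤ c)
    {x v w : ℝ} (hv : x ≤ -R → |v| ≤ w) (hw : 0 ≤ w) :
    v * weightX K R x ≤ tent K x * -v + 2 * (K + 1) * c * w / R := by
  have hR0 : 0 < R := by linarith
  have hc0 : 0 ≤ c := (stepDeriv_nonneg 0).trans (hc 0)
  obtain ⟨h1, h2⟩ := neg_integral_tent_mem hK x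
  unfold weightX
  have e1 : Real.smoothTransition ((x + 2 * R) / R) * tent K x = tent K x := by
    by_cases hx : |x| ≤ R
    · rw [Real.smoothTransition.one_of_one_le, one_mul]
      rw [le_div_iff₀ hR0]; linarith [(abs_le.1 hx).1]
    · rw [tent_eq_zero (by linarith), mul_zero]
  rw [e1]
  set I := -∫ y in (K + 1)..x, tent K y
  have h3 := stepDeriv_nonneg ((x + 2 * R) / R)
  have e2 : v * (stepDeriv ((x + 2 * R) / R) / R * I) ≤ 2 * (K + 1) * c * w / R := by
    -- The rising part of the weight lives on [-2R, -R], where v is small; elsewhere the slope of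
    -- the transition is zero.
    by_cases hx : x ≤ -R
    · have e3 : stepDeriv ((x + 2 * R) / R) * I ≤ c * (2 * (K + 1)) :=
        mul_le_mul (hc _) h2 h1 hc0
      have e4 : 0 ≤ stepDeriv ((x + 2 * R) / R) * I := mul_nonneg h3 h1
      rw [show v * (stepDeriv ((x + 2 * R) / R) / R * I)
        = v * (stepDeriv ((x + 2 * R) / R) * I) / R by ring]
      refine div_le_div_of_nonneg_right ?_ hR0.le
      calc v * (stepDeriv ((x + 2 * R) / R) * I)
          ≤ w * (stepDeriv ((x + 2 * R) / R) * I) :=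
            mul_le_mul_of_nonneg_right ((le_abs_self v).trans (hv hx)) e4
        _ ≤ w * (c * (2 * (K + 1))) := mul_le_mul_of_nonneg_left e3 hw
        _ = _ := by ring
    · rw [stepDeriv_of_one_le]
      · rw [zero_div, zero_mul, mul_zero]; positivity
      · rw [le_div_iff₀ hR0]; linarith [not_le.1 hx]
  nlinarith

/-- Flux and entropy variable are normalized to vanish at the left end state. The right end plays no
role because the weight vanishes there. -/
theorem exists_relPair_small {γ : ℝ} (hγ : 1 < γ) {s : EndStates} {r u : ℝ → ℝ → ℝ}
    (h : FarField s r u) (T : ℝ) :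
    ∃ M : ℝ, ∀ t ∈ Icc 0 T, ∀ x, x ≤ -M → |relFlux γ s.rhoL s.uL (r t x) (u t x)| ≤ 1 ∧
      |relVar γ s.rhoL s.uL (r t x) (u t x)| ≤ 1 := by
  obtain ⟨M, hM⟩ := (h T).2 (fun p => relFlux γ s.rhoL s.uL p.1 p.2)
    (continuous_relFlux hγ continuous_fst continuous_snd _ _).continuousAt
    (by simp [relFlux])
  obtain ⟨M', hM'⟩ := (h T).2 (fun p => relVar γ s.rhoL s.uL p.1 p.2)
    (continuous_relVar hγ continuous_fst continuous_snd _ _).continuousAt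
    (by simp [relVar])
  refine ⟨max M M', fun t ht x hx => ⟨hM t ht x ?_, hM' t ht x ?_⟩⟩
  · linarith [le_max_left M M']
  · linarith [le_max_right M M']

/-- The weighted relative entropy is bounded by the relative energy. -/
theorem exists_abs_relEntropy_mul_weight_le {γ : ℝ} (hγ : 1 < γ) {s : EndStates}
    (hL : 0 < s.rhoL) {rb ub rbx ubx : ℝ → ℝ} {m B L : ℝ}
    (h : ProfileBounds s rb ub rbx ubx m B L) {K : ℝ} (hK : 0 ≤ K) :
    ∃ A A' : ℝ, 0 ≤ A ∧ 0 ≤ A' ∧ ∀ R x r u : ℝ, 0 < r →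
      |relEntropy γ s.rhoL s.uL r u * weight K R x|
        ≤ A * (1 / 2 * (r * (u - ub x) ^ 2) + relativeEnergy γ r (rb x))
          + A' * tent (max L (K + 1)) x := by
  obtain ⟨C₁, hC₁0, hC₁⟩ := exists_abs_entropy_sub_le hγ hL
  obtain ⟨C₂, hC₂0, hC₂⟩ := exists_stateEnergy_le hγ hL s.uL
  obtain ⟨C₃, hC₃0, hC₃⟩ := exists_moments_le hγ h
  refine ⟨2 * (K + 1) * C₁ * (1 + C₂ * C₃), 2 * (K + 1) * C₁ * (C₂ * (1 + C₃)), by positivity,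
    by positivity, fun R x r u hr => ?_⟩
  have hE : 0 ≤ 1 / 2 * (r * (u - ub x) ^ 2) + relativeEnergy γ r (rb x) := by
    have := relativeEnergy_nonneg hγ hr (h.rb_pos x)
    positivity
  set E := 1 / 2 * (r * (u - ub x) ^ 2) + relativeEnergy γ r (rb x) with hEdef
  have ht := tent_nonneg (max L (K + 1)) x
  have hw0 := weight_nonneg hK R x
  have hw1 := weight_le hK R x
  rw [abs_mul, abs_of_nonneg hw0]
  have h1 := hC₁ r (u - s.uL) hr
  by_cases hx : K + 1 ≤ x
  · rw [weight_right hx, mul_zero]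
    positivity
  have h2 : |relEntropy γ s.rhoL s.uL r u|
      ≤ C₁ * ((1 + C₂ * C₃) * E + C₂ * (1 + C₃) * tent (max L (K + 1)) x) := by
    refine h1.trans (mul_le_mul_of_nonneg_left ?_ hC₁0)
    -- Left of -L the profile is the left end state, and the two relative energies coincide. The
    -- rest of the support of the weight is bounded, and the change of reference state costs a
    -- constant there, recorded by the tent.
    by_cases hxL : x ≤ -L
    · obtain ⟨e1, e2, -⟩ := h.left x hxL
      have e3 : E = 1 / 2 * (r * (u - s.uL) ^ 2) + relativeEnergy γ r s.rhoL := by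
        rw [hEdef, e1, e2]
      rw [← e3]
      have : 0 ≤ C₂ * C₃ * E := by positivity
      have : 0 ≤ C₂ * (1 + C₃) * tent (max L (K + 1)) x := by positivity
      linarith
    · rw [tent_eq_one (abs_le.2 ⟨by linarith [le_max_left L (K + 1)],
        by linarith [le_max_right L (K + 1)]⟩)]
      have e1 := hC₂ r u hr
      have e2 := mul_le_mul_of_nonneg_left (hC₃ x r u hr) hC₂0
      rw [← hEdef] at e2
      nlinarith
  calc |relEntropy γ s.rhoL s.uL r u| * weight K R x
      ≤ |relEntropy γ s.rhoL s.uL r u| * (2 * (K + 1)) :=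
        mul_le_mul_of_nonneg_left hw1 (abs_nonneg _)
    _ ≤ C₁ * ((1 + C₂ * C₃) * E + C₂ * (1 + C₃) * tent (max L (K + 1)) x) * (2 * (K + 1)) :=
        mul_le_mul_of_nonneg_right h2 (by positivity)
    _ = _ := by ring

/-- In the application w is the velocity, v its derivative, V the entropy variable, J the integral
of u_x² and mo the moments. Young's inequality leaves εV², and the velocity bound replaces w² by 1 +
J, so that εJ belongs to the dissipation. -/
theorem mul_viscous_le {ε ε₁ τ V v J mo g w C C' : ℝ} (hε : 0 < ε) (hεε : ε ≤ ε₁) (hτ0 : 0 ≤ τ)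
    (hτ1 : τ ≤ 1) (hC : 0 ≤ C) (hC' : 0 ≤ C') (hJ : 0 ≤ J) (hm0 : 0 ≤ mo)
    (e1 : w ^ 2 ≤ C' * (1 + J)) (hg : g ≤ mo) (hV : V ^ 2 ≤ C * (1 + w ^ 2 + g)) :
    τ * (ε * V * v) ≤ ε * v ^ 2 + C * (1 + C') * (1 + ε₁) * (τ * (mo + (1 + ε * J))) := by
  have e2 : V * v ≤ v ^ 2 + V ^ 2 := by
    nlinarith [sq_nonneg (V - v), sq_nonneg V, sq_nonneg v]
  have e3 : V ^ 2 ≤ C * ((1 + C') * (1 + J + mo)) := by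
    refine hV.trans (mul_le_mul_of_nonneg_left ?_ hC)
    have : 0 ≤ C' * mo := mul_nonneg hC' hm0
    linarith
  have z2 : ε * (1 + J + mo) ≤ (1 + ε₁) * (mo + (1 + ε * J)) := by
    have z3 : ε * mo ≤ ε₁ * mo := mul_le_mul_of_nonneg_right hεε hm0
    have z4 : 0 ≤ ε₁ * (ε * J) := mul_nonneg (hε.le.trans hεε) (by positivity)
    linarith
  have e4 : ε * V ^ 2 ≤ C * (1 + C') * ((1 + ε₁) * (mo + (1 + ε * J))) := by
    calc ε * V ^ 2 ≤ ε * (C * ((1 + C') * (1 + J + mo))) := mul_le_mul_of_nonneg_left e3 hε.le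
      _ = C * (1 + C') * (ε * (1 + J + mo)) := by ring
      _ ≤ _ := mul_le_mul_of_nonneg_left z2 (by positivity)
  calc τ * (ε * V * v) = τ * (ε * (V * v)) := by ring
    _ ≤ τ * (ε * (v ^ 2 + V ^ 2)) :=
        mul_le_mul_of_nonneg_left (mul_le_mul_of_nonneg_left e2 hε.le) hτ0
    _ = τ * (ε * v ^ 2) + τ * (ε * V ^ 2) := by ring
    _ ≤ ε * v ^ 2 + τ * (C * (1 + C') * ((1 + ε₁) * (mo + (1 + ε * J)))) :=
        add_le_add (mul_le_of_le_one_left (by positivity) hτ1) (mul_le_mul_of_nonneg_left e4 hτ0)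
    _ = _ := by ring

/-- From |v| ≤ Rv² + 1: after division by R the square has a coefficient free of R, while the
constant keeps the factor 1/R needed on a strip of length O(R). -/
theorem mul_abs_div_le {ε ε₁ v R k : ℝ} (hε : 0 ≤ ε) (hεε : ε ≤ ε₁) (hR : 1 ≤ R) (hk : 0 ≤ k) :
    k * (ε * |v|) / R ≤ k * (ε * v ^ 2) + k * ε₁ * (1 / R) := by
  have hR0 : 0 < R := by linarith
  have e1 : |v| ≤ R * v ^ 2 + 1 := by
    rw [← sq_abs]
    nlinarith [sq_nonneg (|v| - 1), sq_nonneg (|v|), mul_nonneg (by linarith : 0 ≤ R - 1)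
      (sq_nonneg |v|), abs_nonneg v]
  have e2 : ε * |v| ≤ R * (ε * v ^ 2) + ε₁ := by
    have := mul_le_mul_of_nonneg_left e1 hε
    linarith
  have e3 := mul_le_mul_of_nonneg_left e2 hk
  rw [div_le_iff₀ hR0]
  have e4 : (k * (ε * v ^ 2) + k * ε₁ * (1 / R)) * R = k * (R * (ε * v ^ 2) + ε₁) := by
    field_simp
  rw [e4]
  exact e3

/-- The source of the weighted entropy balance. -/
theorem exists_entropy_source_le {γ : ℝ} (hγ : 1 < γ) (s : EndStates) {ε₁ K C' : ℝ}
    (hK : 0 ≤ K) (hε₁ : 0 ≤ ε₁) (hC' : 0 ≤ C') :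
    ∃ A : ℝ, 0 ≤ A ∧ ∀ (ε R J : ℝ) (r u rx ux : ℝ → ℝ → ℝ) (t x : ℝ), 0 < ε → ε ≤ ε₁ → 1 ≤ R →
      K + 1 ≤ R → 0 ≤ J → 0 < r t x → (|x| ≤ K + 1 → u t x ^ 2 ≤ C' * (1 + J)) →
      (x ≤ -R → |relFlux γ s.rhoL s.uL (r t x) (u t x)| ≤ 1 ∧
        |relVar γ s.rhoL s.uL (r t x) (u t x)| ≤ 1) →
      -(ε * relVarX γ s.uL r u rx ux t x * ux t x) * weight K R x
        + (relFlux γ s.rhoL s.uL (r t x) (u t x)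
          - ε * relVar γ s.rhoL s.uL (r t x) (u t x) * ux t x) * weightX K R x
      ≤ -(kernelMass γ / 8 * (tent K x * (r t x * |u t x| ^ 3)))
        + A * (ε * (ux t x ^ 2 + r t x ^ (γ - 3) * rx t x ^ 2)
          + tent K x * ((r t x + r t x * |u t x| + r t x * u t x ^ 2 + r t x ^ γ) + (1 + ε * J))
          + 1 / R) := by
  obtain ⟨C₁, hC₁0, hC₁⟩ := exists_neg_relFlux_le hγ (b := s.rhoL) s.uL
  obtain ⟨C₂, hC₂0, hC₂⟩ := exists_relVar_sq_le hγ (b := s.rhoL) s.uL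
  obtain ⟨C₃, hC₃0, hC₃⟩ := exists_relVarX_mul_le hγ s.uL
  obtain ⟨c, hc0, hc⟩ := exists_stepDeriv_le
  obtain ⟨k, hk⟩ : ∃ k, k = 2 * (K + 1) := ⟨_, rfl⟩
  have hk0 : 0 ≤ k := hk ▸ by positivity
  refine ⟨C₁ + C₂ * (1 + C') * (1 + ε₁) + C₃ * k + 1 + k * c * (1 + ε₁), by positivity, ?_⟩
  intro ε R J r u rx ux t x hε hεε hR1 hR hJ hr hu hfar
  have hR0 : 0 < R := by linarith
  have ht0 := tent_nonneg K x
  have ht1 := tent_le_one K x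
  obtain ⟨Dz, hDz⟩ : ∃ Dz, Dz = r t x ^ (γ - 3) * rx t x ^ 2 := ⟨_, rfl⟩
  have hDz0 : 0 ≤ Dz := hDz ▸ by positivity
  obtain ⟨V, hV⟩ : ∃ V, V = relVar γ s.rhoL s.uL (r t x) (u t x) := ⟨_, rfl⟩
  obtain ⟨q, hq⟩ : ∃ q, q = relFlux γ s.rhoL s.uL (r t x) (u t x) := ⟨_, rfl⟩
  obtain ⟨mo, hmo⟩ : ∃ mo, mo = r t x + r t x * |u t x| + r t x * u t x ^ 2 + r t x ^ γ := ⟨_, rfl⟩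
  have hg0 : 0 ≤ r t x ^ γ := by positivity
  have hmog : r t x ^ γ ≤ mo := by
    have n1 : 0 ≤ r t x + r t x * |u t x| + r t x * u t x ^ 2 := by positivity
    linarith
  have a1 := hC₁ (r t x) (u t x) hr
  have a2 := hC₂ (r t x) (u t x) hr
  have a3 := hC₃ r u rx ux t x hr
  have hw0 := weight_nonneg hK R x
  have hw1 := weight_le hK R x
  rw [← hk] at hw1
  rw [← hq] at a1 hfar ⊢
  rw [← hV] at a2 hfar ⊢
  rw [← hmo] at a1 ⊢
  rw [← hDz] at a3 ⊢
  -- the dissipative term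
  have s1 : -(ε * relVarX γ s.uL r u rx ux t x * ux t x) * weight K R x
      ≤ C₃ * k * (ε * (ux t x ^ 2 + Dz)) := by
    have e1 : -(ε * relVarX γ s.uL r u rx ux t x * ux t x) ≤ ε * (C₃ * (ux t x ^ 2 + Dz)) := by
      have := (abs_le.1 a3).1
      nlinarith
    have e2 : 0 ≤ ε * (C₃ * (ux t x ^ 2 + Dz)) := by positivity
    calc _ ≤ ε * (C₃ * (ux t x ^ 2 + Dz)) * weight K R x := mul_le_mul_of_nonneg_right e1 hw0
      _ ≤ ε * (C₃ * (ux t x ^ 2 + Dz)) * k := mul_le_mul_of_nonneg_left hw1 e2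
      _ = _ := by ring
  -- the flux
  have s2 := mul_weightX_le hK hR hc (x := x) (v := q) (w := 1) (fun hx => (hfar hx).1) zero_le_one
  have s3 := mul_weightX_le hK hR hc (x := x) (v := -(ε * V * ux t x)) (w := ε * |ux t x|)
    (fun hx => by
      rw [abs_neg, abs_mul, abs_mul, abs_of_pos hε]
      have := mul_le_mul_of_nonneg_right (hfar hx).2 (by positivity : 0 ≤ ε * |ux t x|)
      linarith) (by positivity)
  rw [← hk] at s2 s3
  have s4 : tent K x * -q ≤ -(kernelMass γ / 8 * (tent K x * (r t x * |u t x| ^ 3)))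
      + C₁ * (tent K x * (1 + mo)) := by
    have := mul_le_mul_of_nonneg_left a1 ht0
    linarith
  have s5 : tent K x * - -(ε * V * ux t x) ≤ ε * ux t x ^ 2
      + C₂ * (1 + C') * (1 + ε₁) * (tent K x * (mo + (1 + ε * J))) := by
    by_cases hx : |x| ≤ K + 1
    · rw [neg_neg]
      exact mul_viscous_le hε hεε ht0 ht1 hC₂0 hC' hJ (hg0.trans hmog) (hu hx) hmog a2
    · rw [tent_eq_zero (not_le.1 hx).le]
      have : 0 ≤ ε * ux t x ^ 2 := by positivity
      linarith
  have s6 : k * c * (ε * |ux t x|) / R ≤ k * c * (ε * ux t x ^ 2) + k * c * ε₁ * (1 / R) :=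
    mul_abs_div_le hε.le hεε hR1 (by positivity)
  have s7 : k * c * 1 / R = k * c * (1 / R) := by ring
  obtain ⟨Y, hY⟩ : ∃ Y, Y = ε * (ux t x ^ 2 + Dz) := ⟨_, rfl⟩
  obtain ⟨Z, hZ⟩ : ∃ Z, Z = tent K x * (mo + (1 + ε * J)) := ⟨_, rfl⟩
  have hY0 : 0 ≤ Y := hY ▸ by positivity
  have hYu : ε * ux t x ^ 2 ≤ Y := by
    rw [hY]; have : 0 ≤ ε * Dz := by positivity
    linarith
  have hm0 := hg0.trans hmog
  have hZ0 : 0 ≤ Z := hZ ▸ by positivity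
  have hZ1 : tent K x * (1 + mo) ≤ Z := by
    rw [hZ]; have : 0 ≤ tent K x * (ε * J) := by positivity
    linarith
  have hRi : 0 < 1 / R := by positivity
  rw [← hY] at s1
  rw [← hZ] at s5
  rw [← hY, ← hZ]
  rw [s7] at s2
  have f1 := mul_le_mul_of_nonneg_left hYu (by positivity : 0 ≤ k * c)
  have f2 := mul_le_mul_of_nonneg_left hZ1 hC₁0
  have f3 : 0 ≤ (C₁ + C₂ * (1 + C') * (1 + ε₁) + k * c * ε₁) * Y := by positivity
  have f4 : 0 ≤ (C₃ * k + 1 + k * c * (1 + ε₁)) * Z := by positivity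
  have f5 : 0 ≤ (C₁ + C₂ * (1 + C') * (1 + ε₁) + C₃ * k + 1) * (1 / R) := by positivity
  rw [show (q - ε * V * ux t x) * weightX K R x
    = q * weightX K R x + -(ε * V * ux t x) * weightX K R x by ring]
  linarith

/-- The weighted entropy balance bounds the integral of tent times flux, hence of ρ|u|³ on [-K, K].
The entropy at the initial and final times is bounded by the relative energy, and the production by
the dissipation and the moments. -/
theorem exists_velocity_moment_bound {γ : ℝ} (hγ : 1 < γ) {s : EndStates} (hL : 0 < s.rhoL)
    {rb ub rbx ubx : ℝ → ℝ} {m B L : ℝ} (h : ProfileBounds s rb ub rbx ubx m B L)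
    {ε₁ C T K : ℝ} (hε₁ : 0 ≤ ε₁) (hT : 0 ≤ T) (hK : 0 ≤ K) :
    ∃ C' : ℝ, ∀ (ε : ℝ) (r u rx ux rxx uxx : ℝ → ℝ → ℝ), 0 < ε → ε ≤ ε₁ →
      Flow γ ε r u rx ux rxx uxx → FarField s r u → EnergyBounds γ ε T C rb ub r u rx ux →
      ∫ t in 0..T, ∫ x in -K..K, r t x * |u t x| ^ 3 ≤ C' := by
  obtain ⟨Cv, L₁, hCv, hL₁, hKL₁, hv⟩ := exists_velocity_bound hγ h C (K + 1)
  obtain ⟨A, hA0, hA⟩ := exists_entropy_source_le hγ s hK hε₁ hCv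
  obtain ⟨A₂, A₃, hA₂0, hA₃0, hA₂⟩ := exists_abs_relEntropy_mul_weight_le hγ hL h hK
  obtain ⟨Am, hAm0, hAm⟩ := exists_moments_le hγ h
  have hM := kernelMass_pos hγ
  obtain ⟨K₂, hK₂⟩ : ∃ K₂, K₂ = max L (K + 1) := ⟨_, rfl⟩
  have hK₂0 : 0 ≤ K₂ := hK₂ ▸ (by positivity : 0 ≤ K + 1).trans (le_max_right _ _)
  obtain ⟨Cm, hCm⟩ : ∃ Cm, Cm = Am * (2 * (K + 1) + C) := ⟨_, rfl⟩
  obtain ⟨Cp, hCp⟩ : ∃ Cp, Cp = A₂ * C + A₃ * (2 * (K₂ + 1)) := ⟨_, rfl⟩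
  refine ⟨8 / kernelMass γ * (2 * Cp
    + A * (C + (2 * (K + 1)) * C + T * (Cm + 2 * (K + 1) + 4))), ?_⟩
  intro ε r u rx ux rxx uxx hε hεε F hfar hEB
  obtain ⟨M, hMfar⟩ := exists_relPair_small hγ hfar T
  -- R depends on the individual solution through M, yet the constant does not: R occurs only in the
  -- error 1/R, whose integral over the strip of length 4R is 4.
  obtain ⟨R, hR⟩ : ∃ R, R = max (max 1 M) (K₂ + 1) := ⟨_, rfl⟩
  have hR1 : 1 ≤ R := hR ▸ (le_max_left 1 M).trans (le_max_left _ _)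
  have hRM : M ≤ R := hR ▸ (le_max_right 1 M).trans (le_max_left _ _)
  have hRK₂ : K₂ + 1 ≤ R := hR ▸ le_max_right _ _
  have hRK : K + 1 ≤ R := by
    have : K + 1 ≤ K₂ := hK₂ ▸ le_max_right _ _
    linarith
  have hR0 : 0 < R := by linarith
  have cr := F.cont_r
  have cu := F.cont_u
  have crx := F.cont_rx
  have cux := F.cont_ux
  have cuxx := F.cont_uxx
  have crg := F.continuous_rpow γ
  have crg3 := F.continuous_rpow (γ - 3)
  have hrp := F.pos
  have ct := continuous_tent K
  have cw := continuous_weight K R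
  have cwx := continuous_weightX K R
  have cη := continuous_relEntropy hγ cr cu s.rhoL s.uL
  have cq := continuous_relFlux hγ cr cu s.rhoL s.uL
  have cV := continuous_relVar hγ cr cu s.rhoL s.uL
  have cηt := F.continuous_relEntropyT hγ s.rhoL s.uL
  have cqx := F.continuous_relFluxX hγ s.rhoL s.uL
  have cVx := F.continuous_relVarX hγ s.uL
  obtain ⟨J, hJ⟩ : ∃ J : ℝ → ℝ, J = fun t => ∫ x in -L₁..L₁, ux t x ^ 2 := ⟨_, rfl⟩
  have cJ : Continuous J := by
    rw [hJ]; exact continuous_integral_strip (F := fun t x => ux t x ^ 2) (by fun_prop) _ _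
  have hJ0 : ∀ t, 0 ≤ J t := fun t => by
    rw [hJ]; exact intervalIntegral.integral_nonneg (by linarith) fun x _ => sq_nonneg _
  obtain ⟨D, hD⟩ : ∃ D : ℝ → ℝ → ℝ, D = fun t x =>
    ε * (ux t x ^ 2 + r t x ^ (γ - 3) * rx t x ^ 2) := ⟨_, rfl⟩
  have cD : Continuous fun p : ℝ × ℝ => D p.1 p.2 := by rw [hD]; fun_prop
  obtain ⟨mo, hmo⟩ : ∃ mo : ℝ → ℝ → ℝ, mo = fun t x =>
    r t x + r t x * |u t x| + r t x * u t x ^ 2 + r t x ^ γ := ⟨_, rfl⟩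
  have cmo : Continuous fun p : ℝ × ℝ => mo p.1 p.2 := by rw [hmo]; fun_prop
  have hmo0 : ∀ t x, 0 ≤ mo t x := fun t x => by
    have := (hrp t x).le
    rw [hmo]; positivity
  obtain ⟨g, hg⟩ : ∃ g : ℝ → ℝ → ℝ, g = fun t x => r t x * |u t x| ^ 3 := ⟨_, rfl⟩
  have cg : Continuous fun p : ℝ × ℝ => g p.1 p.2 := by rw [hg]; fun_prop
  have hg0 : ∀ t x, 0 ≤ g t x := fun t x => by
    have := (hrp t x).le
    rw [hg]; positivity
  have slice : ∀ {f : ℝ → ℝ → ℝ}, Continuous (fun p : ℝ × ℝ => f p.1 p.2) → ∀ t,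
      Continuous fun x => f t x := fun hf t => hf.comp (continuous_const.prodMk continuous_id)
  have hmain := integral_le_of_conservation (T := T) (M := 2 * R)
    (P := fun t x => relEntropy γ s.rhoL s.uL (r t x) (u t x) * weight K R x)
    (Pt := fun t x => relEntropyT γ ε s.rhoL s.uL r u rx ux uxx t x * weight K R x)
    (Q := fun t x => (relFlux γ s.rhoL s.uL (r t x) (u t x)
      - ε * relVar γ s.rhoL s.uL (r t x) (u t x) * ux t x) * weight K R x)
    (Qx := fun t x => (relFluxX γ s.rhoL s.uL r u rx ux t x
        - (ε * relVarX γ s.uL r u rx ux t x * ux t x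
          + ε * relVar γ s.rhoL s.uL (r t x) (u t x) * uxx t x)) * weight K R x
      + (relFlux γ s.rhoL s.uL (r t x) (u t x)
        - ε * relVar γ s.rhoL s.uL (r t x) (u t x) * ux t x) * weightX K R x)
    (S := fun t x => -(kernelMass γ / 8 * (tent K x * g t x))
      + A * (D t x + tent K x * (mo t x + (1 + ε * J t)) + 1 / R))
    hT (by linarith) (by fun_prop) (by fun_prop) (by fun_prop) (by fun_prop)
    (fun t x ht => (F.hasDerivAt_relEntropy hγ s.rhoL s.uL ht x).mul_const _)
    (fun t x => ((F.hasDerivAt_relFlux hγ s.rhoL s.uL t x).fun_sub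
      (((F.hasDerivAt_relVar hγ s.rhoL s.uL t x).const_mul ε).fun_mul (F.huxx t x))).fun_mul
        (hasDerivAt_weight K R x))
    (fun t _ => by rw [weight_left hR0, mul_zero])
    (fun t _ => by rw [weight_right (by linarith), mul_zero]) ?_
  swap
  · intro t ht x hx
    have e0 := F.relEntropyT_add_relFluxX hγ s.rhoL s.uL t x
    have e1 := hA ε R (J t) r u rx ux t x hε hεε hR1 hRK (hJ0 t) (hrp t x)
      (fun hx => by
        rw [hJ]
        exact hv ε T r u rx ux rxx uxx F hEB t ht x (abs_le.1 (hx.trans hKL₁)))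
      (fun hx => hMfar t ht x (by linarith))
    rw [hD, hmo, hg]
    refine le_trans (le_of_eq ?_) e1
    have e2 : relEntropyT γ ε s.rhoL s.uL r u rx ux uxx t x
        = ε * uxx t x * relVar γ s.rhoL s.uL (r t x) (u t x)
          - relFluxX γ s.rhoL s.uL r u rx ux t x := by linarith
    rw [e2]
    ring
  have hP : ∀ t ∈ Icc 0 T, |∫ x in -(2 * R)..(2 * R),
      relEntropy γ s.rhoL s.uL (r t x) (u t x) * weight K R x| ≤ Cp := by
    intro t ht
    have c1 := slice (f := fun t x => relEntropy γ s.rhoL s.uL (r t x) (u t x)) cη t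
    have c2 : Continuous fun x => energyDensity γ rb ub r u t x := by
      have := slice cr t
      have := slice cu t
      have := h.cont_ub
      have := continuous_relativeEnergy hγ (slice cr t) h.cont_rb
      unfold energyDensity
      fun_prop
    have c3 := continuous_tent K₂
    refine (intervalIntegral.abs_integral_le_integral_abs (by linarith)).trans ?_
    refine (intervalIntegral.integral_mono_on (by linarith)
      (Continuous.intervalIntegrable (by fun_prop) _ _)
      (Continuous.intervalIntegrable (u := fun x => A₂ * energyDensity γ rb ub r u t x
        + A₃ * tent K₂ x) (by fun_prop) _ _) fun x _ => ?_).trans ?_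
    · rw [hK₂]; exact hA₂ R x (r t x) (u t x) (hrp t x)
    rw [intervalIntegral.integral_add (Continuous.intervalIntegrable (by fun_prop) _ _)
      (Continuous.intervalIntegrable (by fun_prop) _ _), intervalIntegral.integral_const_mul,
      intervalIntegral.integral_const_mul, hCp]
    refine add_le_add (mul_le_mul_of_nonneg_left (hEB.energy t ht _ (by linarith)) hA₂0)
      (mul_le_mul_of_nonneg_left ?_ hA₃0)
    have := integral_tent_mul_le hK₂0 (by linarith : K₂ + 1 ≤ 2 * R) (f := fun _ => 1)
      continuous_const fun _ => zero_le_one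
    simp only [mul_one, intervalIntegral.integral_const, smul_eq_mul] at this
    linarith
  obtain ⟨ID, hID⟩ : ∃ ID : ℝ → ℝ, ID = fun t => ∫ x in -(2 * R)..(2 * R), D t x := ⟨_, rfl⟩
  have cID : Continuous ID := hID ▸ continuous_integral_strip cD _ _
  obtain ⟨Ig, hIg⟩ : ∃ Ig : ℝ → ℝ, Ig = fun t => ∫ x in -K..K, g t x := ⟨_, rfl⟩
  have cIg : Continuous Ig := hIg ▸ continuous_integral_strip cg _ _
  have hS : ∀ t ∈ Icc 0 T, ∫ x in -(2 * R)..(2 * R), (-(kernelMass γ / 8 * (tent K x * g t x))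
      + A * (D t x + tent K x * (mo t x + (1 + ε * J t)) + 1 / R))
      ≤ -(kernelMass γ / 8) * Ig t
        + A * (ID t + 2 * (K + 1) * (ε * J t) + (Cm + 2 * (K + 1) + 4)) := by
    intro t ht
    have c1 := slice cg t
    have c2 := slice cD t
    have c3 := slice cmo t
    have i1 : IntervalIntegrable (fun x => -(kernelMass γ / 8 * (tent K x * g t x))) volume
      (-(2 * R)) (2 * R) := Continuous.intervalIntegrable (by fun_prop) _ _
    have i2 : IntervalIntegrable (fun x => tent K x * (mo t x + (1 + ε * J t))) volume
      (-(2 * R)) (2 * R) := Continuous.intervalIntegrable (by fun_prop) _ _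
    have i3 : IntervalIntegrable (fun x => D t x) volume
      (-(2 * R)) (2 * R) := c2.intervalIntegrable _ _
    rw [intervalIntegral.integral_add i1 (((i3.add i2).add intervalIntegrable_const).const_mul A),
      intervalIntegral.integral_neg, intervalIntegral.integral_const_mul,
      intervalIntegral.integral_const_mul,
      intervalIntegral.integral_add (i3.add i2) intervalIntegrable_const,
      intervalIntegral.integral_add i3 i2, intervalIntegral.integral_const, smul_eq_mul, hID, hIg]
    have e1 : ∫ x in -K..K, g t x ≤ ∫ x in -(2 * R)..(2 * R), tent K x * g t x := by
      refine le_trans (le_of_eq (intervalIntegral.integral_congr fun x hx => ?_))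
        (integral_le_of_subinterval (f := fun x => tent K x * g t x) (by fun_prop) hK
          (by linarith) fun x => mul_nonneg (tent_nonneg K x) (hg0 t x))
      rw [uIcc_of_le (by linarith)] at hx
      rw [tent_eq_one (abs_le.2 hx), one_mul]
    have e2 : ∫ x in -(2 * R)..(2 * R), tent K x * (mo t x + (1 + ε * J t))
        ≤ Cm + 2 * (K + 1) * (1 + ε * J t) := by
      refine (integral_tent_mul_le hK (by linarith) (by fun_prop) fun x => ?_).trans ?_
      · have := hmo0 t x
        have := hJ0 t
        positivity
      · rw [intervalIntegral.integral_add (c3.intervalIntegrable _ _) intervalIntegrable_const,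
          intervalIntegral.integral_const, smul_eq_mul, hCm, hmo]
        have := integral_moments_le hγ h F hEB (by linarith : 0 ≤ K + 1) hAm0 hAm ht
        linarith
    have e3 : (2 * R - -(2 * R)) * (1 / R) = 4 := by field_simp; ring
    have e4 := mul_le_mul_of_nonneg_left e1 (by positivity : 0 ≤ kernelMass γ / 8)
    have e5 := mul_le_mul_of_nonneg_left e2 hA0
    rw [e3]
    linarith
  have hJT : ∫ t in 0..T, ε * J t ≤ C := by
    refine le_trans (intervalIntegral.integral_mono_on hT
      (Continuous.intervalIntegrable (by fun_prop) _ _)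
      ((continuous_integral_strip cD (-L₁) L₁).intervalIntegrable _ _) fun t _ => ?_)
      (hD ▸ hEB.dissipation L₁ hL₁.le)
    have c1 := slice cux t
    have c2 := slice cD t
    rw [hJ]
    beta_reduce
    rw [← intervalIntegral.integral_const_mul]
    refine intervalIntegral.integral_mono_on (by linarith)
      (Continuous.intervalIntegrable (by fun_prop) _ _) (c2.intervalIntegrable _ _) fun x _ => ?_
    rw [hD]
    have := (hrp t x).le
    have : 0 ≤ ε * (r t x ^ (γ - 3) * rx t x ^ 2) := by positivity
    linarith
  have hDT : ∫ t in 0..T, ID t ≤ C := by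
    rw [hID, hD]; exact hEB.dissipation (2 * R) (by linarith)
  have hST := intervalIntegral.integral_mono_on (μ := volume) hT
    ((continuous_integral_strip (F := fun t x => -(kernelMass γ / 8 * (tent K x * g t x))
      + A * (D t x + tent K x * (mo t x + (1 + ε * J t)) + 1 / R)) (by fun_prop) (-(2 * R))
      (2 * R)).intervalIntegrable 0 T)
    (Continuous.intervalIntegrable (u := fun t => -(kernelMass γ / 8) * Ig t
      + A * (ID t + 2 * (K + 1) * (ε * J t) + (Cm + 2 * (K + 1) + 4))) (by fun_prop) _ _) hS
  have j1 : IntervalIntegrable Ig volume 0 T := cIg.intervalIntegrable _ _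
  have j2 : IntervalIntegrable ID volume 0 T := cID.intervalIntegrable _ _
  have j3 : IntervalIntegrable (fun t => ε * J t) volume 0 T :=
    Continuous.intervalIntegrable (by fun_prop) _ _
  rw [intervalIntegral.integral_add (j1.const_mul _)
      (((j2.add (j3.const_mul _)).add intervalIntegrable_const).const_mul A),
    intervalIntegral.integral_const_mul, intervalIntegral.integral_const_mul,
    intervalIntegral.integral_add (j2.add (j3.const_mul _)) intervalIntegrable_const,
    intervalIntegral.integral_add j2 (j3.const_mul _), intervalIntegral.integral_const_mul,
    intervalIntegral.integral_const, smul_eq_mul, sub_zero] at hST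
  have p1 := (abs_le.1 (hP T ⟨hT, le_rfl⟩)).1
  have p2 := (abs_le.1 (hP 0 ⟨le_rfl, hT⟩)).2
  have q1 := mul_le_mul_of_nonneg_left hJT (by positivity : 0 ≤ A * (2 * (K + 1)))
  have q2 := mul_le_mul_of_nonneg_left hDT hA0
  have fin : kernelMass γ / 8 * ∫ t in 0..T, Ig t ≤ 2 * Cp
      + A * (C + (2 * (K + 1)) * C + T * (Cm + 2 * (K + 1) + 4)) := by linarith
  rw [hIg, hg] at fin
  calc ∫ t in 0..T, ∫ x in -K..K, r t x * |u t x| ^ 3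
      = 8 / kernelMass γ * (kernelMass γ / 8 * ∫ t in 0..T, ∫ x in -K..K, r t x * |u t x| ^ 3) := by
        field_simp
    _ ≤ _ := mul_le_mul_of_nonneg_left fin (by positivity)

/-! ## The uniform higher integrability -/

theorem intervalIntegral_le_of_lintegral_le {f : ℝ → ℝ} (hf : Continuous f) (h0 : ∀ x, 0 ≤ f x)
    {E : ℝ≥0} (h : ∫⁻ x, ENNReal.ofReal (f x) ≤ E) {M : ℝ} (hM : 0 ≤ M) :
    ∫ x in -M..M, f x ≤ E := by
  rw [intervalIntegral.integral_of_le (by linarith),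
    integral_eq_lintegral_of_nonneg_ae (Eventually.of_forall h0) hf.aestronglyMeasurable]
  exact ENNReal.toReal_le_coe_of_le_coe ((setLIntegral_le_lintegral _ _).trans h)

/-- The higher moment `ρ^(γ+1) + ρ |u|³` of a state. -/
def moment (γ : ℝ) (q : ℝ × ℝ) : ℝ := q.1 ^ (γ + 1) + q.1 * |q.2| ^ 3

theorem moment_nonneg (γ : ℝ) {q : ℝ × ℝ} (hq : 0 ≤ q.1) : 0 ≤ moment γ q := by
  unfold moment; positivity

theorem continuous_moment {γ : ℝ} (hγ : 1 < γ) : Continuous (moment γ) := by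
  have : Continuous fun q : ℝ × ℝ => q.1 ^ (γ + 1) :=
    continuous_fst.rpow_const fun _ => Or.inr (by linarith)
  unfold moment
  fun_prop

/-- All constants of the a-priori estimates depend on ε only through an upper bound, and a
convergent sequence of viscosities has one. The final time and the half-width of the interval are
both taken to be K. -/
theorem exists_integral_moment_le {γ : ℝ} (hγ : 1 < γ) {s : EndStates} (hL : 0 < s.rhoL)
    (hR : 0 < s.rhoR) {rhobar ubar : ℝ → ℝ} (hbar : IsReferenceProfile s rhobar ubar)
    {ε : ℕ → ℝ} (hε : ∀ n, 0 < ε n) (hε₀ : Tendsto ε atTop (𝓝 0))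
    {rho0 u0 : ℕ → ℝ → ℝ} {E₀ E₁ M₀ : ℝ≥0}
    (hdata : ∀ n, InitialBounds γ (ε n) rhobar ubar E₀ E₁ M₀ (rho0 n) (u0 n))
    {rho u : ℕ → ℝ → ℝ → ℝ}
    (hsol : ∀ n, IsNSSolution γ (ε n) s (rho0 n) (u0 n) (rho n) (u n)) {K : ℝ} (hK : 1 ≤ K) :
    ∃ C : ℝ, ∀ n, ∫ p in Icc 0 K ×ˢ Icc (-K) K, moment γ (rho n p.1 p.2, u n p.1 p.2) ≤ C := by
  obtain ⟨rbx, ubx, m, B, L, h⟩ := hbar.bounds hL hR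
  obtain ⟨ε₁, hε₁⟩ := hε₀.bddAbove_range
  have hεε : ∀ n, ε n ≤ ε₁ := fun n => hε₁ (mem_range_self n)
  have hε₁0 : 0 ≤ ε₁ := (hε 0).le.trans (hεε 0)
  have hK0 : 0 ≤ K := by linarith
  obtain ⟨C, hC0, hC⟩ := exists_energyBounds hγ hL hR h hε₁0 E₀.2 E₁.2 hK0
  obtain ⟨C₁, hC₁⟩ := exists_density_bound hγ h hε₁0 hC0 hK0 hK
  obtain ⟨C₂, hC₂⟩ := exists_velocity_moment_bound hγ hL h hε₁0 hK0 hK0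
  refine ⟨C₁ + C₂, fun n => ?_⟩
  obtain ⟨r, v, rx, ux, rxx, uxx, F, hr, hv⟩ := (hsol n).flow hγ
  have hfar := (hsol n).farField hr hv
  have cr0 : Continuous fun x => r 0 x := F.cont_r.comp (continuous_const.prodMk continuous_id)
  have cv0 : Continuous fun x => v 0 x := F.cont_u.comp (continuous_const.prodMk continuous_id)
  have crx0 : Continuous fun x => rx 0 x := F.cont_rx.comp (continuous_const.prodMk continuous_id)
  have er : ∀ x, r 0 x = rho0 n x := fun x => by rw [hr 0 x le_rfl, (hsol n).initial_rho]
  have ev : ∀ x, v 0 x = u0 n x := fun x => by rw [hv 0 x le_rfl, (hsol n).initial_u]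
  have erx : ∀ x, rx 0 x = deriv (rho0 n) x := fun x => by
    have := (F.hrx 0 x).deriv
    rw [← this]
    congr 1
    funext y
    exact er y
  have hEB := hC (ε n) r v rx ux rxx uxx (hε n) (hεε n) F hfar (fun M hM => by
      refine intervalIntegral_le_of_lintegral_le ?_ (fun x => ?_)
        (le_trans (le_of_eq ?_) (hdata n).energy) hM
      · have := h.cont_ub
        have := continuous_relativeEnergy hγ cr0 h.cont_rb
        unfold energyDensity
        fun_prop
      · have h1 := relativeEnergy_nonneg hγ (F.pos 0 x) (h.rb_pos x)
        have h2 := (F.pos 0 x).le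
        unfold energyDensity
        positivity
      · unfold totalEnergy energyDensity
        refine lintegral_congr fun x => ?_
        rw [er, ev, sq_abs, mul_assoc])
    (fun M hM => by
      refine intervalIntegral_le_of_lintegral_le ?_ (fun x => ?_)
        (le_trans (le_of_eq ?_) (hdata n).gradient) hM
      · exact (Continuous.div (by fun_prop) (by fun_prop)
          fun x => (pow_pos (F.pos 0 x) 3).ne').const_mul _
      · have h2 := (F.pos 0 x).le
        positivity
      · rw [← lintegral_const_mul' _ _ ENNReal.ofReal_ne_top]
        refine lintegral_congr fun x => ?_
        rw [← ENNReal.ofReal_mul (sq_nonneg _), er, erx, sq_abs])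
  have b1 := hC₁ (ε n) r v rx ux rxx uxx (hε n) (hεε n) F hEB
  have b2 := hC₂ (ε n) r v rx ux rxx uxx (hε n) (hεε n) F hfar hEB
  have cr := F.cont_r
  have cv := F.cont_u
  have crg := F.continuous_rpow (γ + 1)
  have cm : Continuous fun p : ℝ × ℝ => moment γ (r p.1 p.2, v p.1 p.2) :=
    (continuous_moment hγ).comp (cr.prodMk cv)
  have e1 : ∫ p in Icc 0 K ×ˢ Icc (-K) K, moment γ (rho n p.1 p.2, u n p.1 p.2)
      = ∫ p in Icc 0 K ×ˢ Icc (-K) K, moment γ (r p.1 p.2, v p.1 p.2) := by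
    refine setIntegral_congr_fun (measurableSet_Icc.prod measurableSet_Icc) fun p hp => ?_
    rw [hr _ _ hp.1.1, hv _ _ hp.1.1]
  have e2 : ∫ p in Icc 0 K ×ˢ Icc (-K) K, moment γ (r p.1 p.2, v p.1 p.2)
      = ∫ t in 0..K, ∫ x in -K..K, moment γ (r t x, v t x) := by
    rw [Measure.volume_eq_prod, setIntegral_prod _ (by
      rw [← Measure.volume_eq_prod]
      exact cm.continuousOn.integrableOn_compact (isCompact_Icc.prod isCompact_Icc)),
      intervalIntegral.integral_of_le hK0, integral_Icc_eq_integral_Ioc]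
    refine setIntegral_congr_fun measurableSet_Ioc fun t _ => ?_
    rw [intervalIntegral.integral_of_le (by linarith), integral_Icc_eq_integral_Ioc]
  rw [e1, e2]
  have cg : Continuous fun p : ℝ × ℝ => r p.1 p.2 * |v p.1 p.2| ^ 3 := by fun_prop
  have e3 : ∀ t, ∫ x in -K..K, moment γ (r t x, v t x)
      = (∫ x in -K..K, r t x ^ (γ + 1)) + ∫ x in -K..K, r t x * |v t x| ^ 3 := fun t =>
    intervalIntegral.integral_add
      ((crg.comp (continuous_const.prodMk continuous_id)).intervalIntegrable _ _)
      ((cg.comp (continuous_const.prodMk continuous_id)).intervalIntegrable _ _)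
  simp only [e3]
  rw [intervalIntegral.integral_add ((continuous_integral_strip (F := fun t x => r t x ^ (γ + 1))
    crg _ _).intervalIntegrable _ _) ((continuous_integral_strip
    (F := fun t x => r t x * |v t x| ^ 3) cg _ _).intervalIntegrable _ _)]
  exact add_le_add b1 b2

/-! ## Functions on the compactification -/

/-- Truncation to `[0, 1]`. -/
def clip (x : ℝ) : ℝ := max 0 (min 1 x)

theorem continuous_clip : Continuous clip := by unfold clip; fun_prop

theorem clip_nonneg (x : ℝ) : 0 ≤ clip x := le_max_left _ _

theorem clip_le_one (x : ℝ) : clip x ≤ 1 := max_le zero_le_one (min_le_left _ _)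

theorem clip_eq_one {x : ℝ} (h : 1 ≤ x) : clip x = 1 := by
  unfold clip; rw [min_eq_left h, max_eq_right zero_le_one]

theorem clip_eq_zero {x : ℝ} (h : x ≤ 0) : clip x = 0 :=
  max_eq_left ((min_le_right _ _).trans h)

theorem clip_mono : Monotone clip := fun _ _ h => max_le_max le_rfl (min_le_min le_rfl h)

/-- The Euclidean length of a state. -/
def len (q : ℝ × ℝ) : ℝ := √(q.1 ^ 2 + q.2 ^ 2)

theorem continuous_len : Continuous len := by unfold len; fun_prop

theorem abs_fst_le_len (q : ℝ × ℝ) : |q.1| ≤ len q := by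
  refine Real.abs_le_sqrt ?_
  linarith [sq_nonneg q.2]

theorem abs_snd_le_len (q : ℝ × ℝ) : |q.2| ≤ len q := by
  refine Real.abs_le_sqrt ?_
  linarith [sq_nonneg q.1]

theorem len_le (q : ℝ × ℝ) : len q ≤ |q.1| + |q.2| := by
  refine Real.sqrt_le_iff.2 ⟨by positivity, ?_⟩
  rw [← sq_abs q.1, ← sq_abs q.2]
  nlinarith [abs_nonneg q.1, abs_nonneg q.2, mul_nonneg (abs_nonneg q.1) (abs_nonneg q.2)]

theorem isCompact_len_le (k : ℝ) : IsCompact (closedHalfPlane ∩ {q | len q ≤ k}) := by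
  refine Metric.isCompact_of_isClosed_isBounded ?_ ?_
  · exact (isClosed_le continuous_const continuous_fst).inter
      (isClosed_le continuous_len continuous_const)
  · refine (Metric.isBounded_closedBall (x := (0 : ℝ × ℝ)) (r := k)).subset fun q hq => ?_
    rw [mem_closedBall_zero_iff, Prod.norm_def, Real.norm_eq_abs, Real.norm_eq_abs, sup_le_iff]
    exact ⟨(abs_fst_le_len q).trans hq.2, (abs_snd_le_len q).trans hq.2⟩

/-- Functions of bounded support that vanish on the vacuum extend to the compactification, by zero
outside of the open half-plane. -/
theorem exists_extension {φ : ℝ × ℝ → ℝ} (hφ : ContinuousOn φ closedHalfPlane)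
    (h0 : ∀ u, φ (0, u) = 0) {k : ℝ} (hk : ∀ q, k ≤ len q → φ q = 0) :
    ∃ f : C(BarH, ℝ), (∀ q ∈ closedHalfPlane, f (embed q) = φ q) ∧ ∀ y ∉ openPart, f y = 0 := by
  have hmem : φ ∈ barC := by
    refine ⟨hφ, ⟨0, h0⟩, fun _ => 0, continuousOn_const, ?_⟩
    rw [Metric.tendstoUniformlyOn_iff]
    intro e he
    filter_upwards [eventually_ge_atTop (max k 0)] with s hs d hd
    rw [hk, dist_self]
    · exact he
    · have : len (s * d.1, s * d.2) = s := by
        unfold len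
        rw [show (s * d.1) ^ 2 + (s * d.2) ^ 2 = s ^ 2 by
          rw [mul_pow, mul_pow, ← mul_add, hd.2, mul_one]]
        exact Real.sqrt_sq ((le_max_right _ _).trans hs)
      rw [this]
      exact (le_max_left _ _).trans hs
  obtain ⟨f, hf⟩ := (mem_barC_iff φ).1 hmem
  refine ⟨f, hf, fun y hy => ?_⟩
  by_contra hne
  -- By density, a point where f does not vanish is a limit of images of states of length at most k.
  -- These images form a compact set, so the point is itself the image of a state; vacuum states are
  -- excluded because φ vanishes there.
  have hopen : IsOpen {y | f y ≠ 0} := isOpen_ne_fun f.continuous continuous_const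
  have h1 : y ∈ closure ({y | f y ≠ 0} ∩ embed '' closedHalfPlane) :=
    hopen.inter_closure ⟨hne, by rw [denseRange_embed]; exact mem_univ y⟩
  have h2 : {y | f y ≠ 0} ∩ embed '' closedHalfPlane
      ⊆ embed '' (closedHalfPlane ∩ {q | len q ≤ k}) := by
    rintro _ ⟨hne, q, hq, rfl⟩
    refine ⟨q, ⟨hq, ?_⟩, rfl⟩
    by_contra hlt
    exact hne (by rw [hf q hq]; exact hk q (not_le.1 hlt).le)
  have h3 := closure_minimal h2 ((isCompact_len_le k).image continuous_embed).isClosed h1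
  obtain ⟨q, ⟨hq, -⟩, rfl⟩ := h3
  have hq0 : (0 : ℝ) ≤ q.1 := hq
  refine hy ⟨q, show (0 : ℝ) < q.1 from lt_of_le_of_ne hq0 fun h => hne ?_, rfl⟩
  rw [hf q hq, show q = (0, q.2) from Prod.ext h.symm rfl, h0]

theorem halfPlane_subset : halfPlane ⊆ closedHalfPlane :=
  fun q hq => (show (0 : ℝ) < q.1 from hq).le

/-- A cutoff in the open half-plane, increasing to `1`. -/
def cutoff (k : ℕ) (q : ℝ × ℝ) : ℝ := clip (k * q.1 - 1) * clip (k + 1 - len q)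

theorem continuous_cutoff (k : ℕ) : Continuous (cutoff k) := by
  have h1 := continuous_clip
  have h2 := continuous_len
  unfold cutoff
  fun_prop

theorem cutoff_nonneg (k : ℕ) (q : ℝ × ℝ) : 0 ≤ cutoff k q :=
  mul_nonneg (clip_nonneg _) (clip_nonneg _)

theorem cutoff_le_one (k : ℕ) (q : ℝ × ℝ) : cutoff k q ≤ 1 :=
  mul_le_one₀ (clip_le_one _) (clip_nonneg _) (clip_le_one _)

theorem cutoff_vacuum (k : ℕ) (u : ℝ) : cutoff k (0, u) = 0 := by
  unfold cutoff
  rw [clip_eq_zero (by simp), zero_mul]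

theorem cutoff_eq_zero (k : ℕ) {q : ℝ × ℝ} (h : k + 1 ≤ len q) : cutoff k q = 0 := by
  unfold cutoff
  rw [clip_eq_zero (x := k + 1 - len q) (by linarith), mul_zero]

theorem cutoff_eq_one {k : ℕ} {q : ℝ × ℝ} (h1 : 2 ≤ k * q.1) (h2 : len q ≤ k) :
    cutoff k q = 1 := by
  unfold cutoff
  rw [clip_eq_one (by linarith), clip_eq_one (by linarith), mul_one]

theorem cutoff_mono {q : ℝ × ℝ} (hq : 0 ≤ q.1) : Monotone fun k => cutoff k q := by
  intro k l hkl
  have h : (k : ℝ) ≤ l := by exact_mod_cast hkl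
  exact mul_le_mul (clip_mono (by nlinarith)) (clip_mono (by linarith)) (clip_nonneg _)
    (clip_nonneg _)

theorem eventually_cutoff_eq_one {q : ℝ × ℝ} (hq : 0 < q.1) :
    ∀ᶠ k : ℕ in atTop, cutoff k q = 1 := by
  filter_upwards [(tendsto_natCast_atTop_atTop (R := ℝ)).eventually_ge_atTop (2 / q.1),
    (tendsto_natCast_atTop_atTop (R := ℝ)).eventually_ge_atTop (len q)] with k h1 h2
  exact cutoff_eq_one (by rwa [div_le_iff₀ hq] at h1) h2

theorem exists_extension_mul_cutoff {φ : ℝ × ℝ → ℝ} (hφ : ContinuousOn φ closedHalfPlane) (k : ℕ) :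
    ∃ f : C(BarH, ℝ), (∀ q ∈ closedHalfPlane, f (embed q) = φ q * cutoff k q) ∧
      ∀ y ∉ openPart, f y = 0 :=
  exists_extension (hφ.mul (continuous_cutoff k).continuousOn)
    (fun u => by rw [cutoff_vacuum, mul_zero]) (k := k + 1)
    (fun q hq => by rw [cutoff_eq_zero k hq, mul_zero])

theorem range_embed_restrict : range (fun q : halfPlane => embed q) = openPart := by
  ext y
  constructor
  · rintro ⟨q, rfl⟩
    exact ⟨q, q.2, rfl⟩
  · rintro ⟨q, hq, rfl⟩
    exact ⟨⟨q, hq⟩, rfl⟩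

theorem restrictH_univ_le (μ : Measure BarH) [IsProbabilityMeasure μ] : restrictH μ univ ≤ 1 := by
  unfold restrictH
  rw [measurableEmbedding_embed.comap_apply]
  exact prob_le_one

instance (μ : Measure BarH) [IsProbabilityMeasure μ] : IsFiniteMeasure (restrictH μ) :=
  ⟨(restrictH_univ_le μ).trans_lt ENNReal.one_lt_top⟩

theorem integral_restrictH (μ : Measure BarH) {f : BarH → ℝ} (hf : ∀ y ∉ openPart, f y = 0) :
    ∫ q : halfPlane, f (embed q) ∂(restrictH μ) = ∫ y, f y ∂μ := by
  rw [← setIntegral_eq_integral_of_forall_compl_eq_zero hf, ← range_embed_restrict,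
    ← measurableEmbedding_embed.map_comap, measurableEmbedding_embed.integral_map]
  rfl

/-- A nonnegative continuous function on the open half-plane is the limit of its truncations, in the
integrals with respect to all measures. -/
theorem lintegral_eq_iSup (μ : Measure BarH) [IsProbabilityMeasure μ] {φ : ℝ × ℝ → ℝ}
    (h0 : ∀ q ∈ closedHalfPlane, 0 ≤ φ q) {f : ℕ → C(BarH, ℝ)}
    (hf : ∀ k, ∀ q ∈ closedHalfPlane, f k (embed q) = φ q * cutoff k q)
    (hf0 : ∀ k, ∀ y ∉ openPart, f k y = 0) :
    ∫⁻ q : halfPlane, ENNReal.ofReal (φ q) ∂(restrictH μ)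
      = ⨆ k, ENNReal.ofReal (∫ y, f k y ∂μ) := by
  have hH : ∀ q : halfPlane, (q : ℝ × ℝ) ∈ closedHalfPlane := fun q => (halfPlane_subset q.2)
  have cont : ∀ k, Continuous fun q : halfPlane => f k (embed q) := fun k =>
    (f k).continuous.comp (continuous_embed.comp continuous_subtype_val)
  have h1 : ∀ k, ENNReal.ofReal (∫ y, f k y ∂μ)
      = ∫⁻ q : halfPlane, ENNReal.ofReal (f k (embed q)) ∂(restrictH μ) := by
    intro k
    rw [← integral_restrictH μ (hf0 k), ofReal_integral_eq_lintegral_ofReal]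
    · obtain ⟨C, hC⟩ := isCompact_univ.exists_bound_of_continuousOn (f k).continuous.continuousOn
      exact Integrable.of_bound (cont k).aestronglyMeasurable C
        (Eventually.of_forall fun q => hC _ (mem_univ _))
    · exact Eventually.of_forall fun q => by
        change 0 ≤ f k (embed q)
        rw [hf k q (hH q)]; exact mul_nonneg (h0 q (hH q)) (cutoff_nonneg k q)
  simp only [h1]
  rw [← lintegral_iSup (fun k => (cont k).measurable.ennreal_ofReal) ?_]
  · refine lintegral_congr fun q => le_antisymm ?_ (iSup_le fun k => ?_)
    · obtain ⟨k, hk⟩ := (eventually_cutoff_eq_one q.2).exists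
      refine le_iSup_of_le k ?_
      rw [hf k q (hH q), hk, mul_one]
    · rw [hf k q (hH q)]
      exact ENNReal.ofReal_le_ofReal (mul_le_of_le_one_right (h0 q (hH q)) (cutoff_le_one k q))
  · intro k l hkl q
    beta_reduce
    rw [hf k q (hH q), hf l q (hH q)]
    exact ENNReal.ofReal_le_ofReal (mul_le_mul_of_nonneg_left (cutoff_mono (hH q) hkl) (h0 q (hH q)))

/-! ## Sequences with bounded moments -/

/-- The states of a solution. -/
def state (rho u : ℝ → ℝ → ℝ) (p : ℝ × ℝ) : ℝ × ℝ := (rho p.1 p.2, u p.1 p.2)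

/-- The box `[0, K] × [-K, K]`. -/
def box (K : ℝ) : Set (ℝ × ℝ) := Icc 0 K ×ˢ Icc (-K) K

theorem box_subset (K : ℝ) : box K ⊆ spaceTime := fun _ hp => ⟨hp.1.1, mem_univ _⟩

theorem isCompact_box (K : ℝ) : IsCompact (box K) := isCompact_Icc.prod isCompact_Icc

theorem measurableSet_box (K : ℝ) : MeasurableSet (box K) :=
  measurableSet_Icc.prod measurableSet_Icc

theorem exists_subset_box {S : Set (ℝ × ℝ)} (hS : Bornology.IsBounded S) (h : S ⊆ spaceTime) :
    ∃ K : ℝ, 1 ≤ K ∧ S ⊆ box K := by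
  obtain ⟨R, hR⟩ := hS.subset_closedBall 0
  refine ⟨max 1 R, le_max_left _ _, fun p hp => ?_⟩
  have h1 := hR hp
  rw [mem_closedBall_zero_iff, Prod.norm_def, Real.norm_eq_abs, Real.norm_eq_abs, sup_le_iff] at h1
  have h2 := le_max_right 1 R
  exact ⟨⟨(h hp).1, (le_abs_self _).trans (h1.1.trans h2)⟩, abs_le.1 (h1.2.trans h2)⟩

theorem ae_spaceTime_of_box {P : ℝ × ℝ → Prop}
    (h : ∀ K : ℝ, 1 ≤ K → ∀ᵐ p ∂(volume.restrict (box K)), P p) :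
    ∀ᵐ p ∂(volume.restrict spaceTime), P p := by
  have hsub : spaceTime ⊆ ⋃ n : ℕ, box (n + 1) := by
    intro p hp
    obtain ⟨K, -, hK⟩ := exists_subset_box (S := {p}) Bornology.isBounded_singleton
      (singleton_subset_iff.2 hp)
    obtain ⟨n, hn⟩ := exists_nat_ge K
    have h1 := hK (mem_singleton p)
    exact mem_iUnion.2 ⟨n, ⟨h1.1.1, by linarith [h1.1.2]⟩, by linarith [h1.2.1], by linarith [h1.2.2]⟩
  refine ae_mono (Measure.restrict_mono hsub le_rfl) ?_
  exact ae_restrict_iUnion_iff _ _ |>.2 fun n => h _ (by linarith [n.cast_nonneg (α := ℝ)])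

/-- A sequence of continuous states with locally bounded moments, and its Young measure. -/
structure BoundedMoments (γ : ℝ) (rho u : ℕ → ℝ → ℝ → ℝ) (ν : ℝ × ℝ → ProbabilityMeasure BarH) :
    Prop where
  young : IsYoungMeasure rho u ν
  cont : ∀ n, ContinuousOn (state (rho n) (u n)) spaceTime
  pos : ∀ n, ∀ p ∈ spaceTime, 0 < (state (rho n) (u n) p).1
  bound : ∀ K : ℝ, 1 ≤ K → ∃ C : ℝ, ∀ n, ∫ p in box K, moment γ (state (rho n) (u n) p) ≤ C

namespace BoundedMoments

variable {γ : ℝ} {rho u : ℕ → ℝ → ℝ → ℝ} {ν : ℝ × ℝ → ProbabilityMeasure BarH}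
  (h : BoundedMoments γ rho u ν) (hγ : 1 < γ)
include h

theorem mem_closedHalfPlane (n : ℕ) {p : ℝ × ℝ} (hp : p ∈ spaceTime) :
    state (rho n) (u n) p ∈ closedHalfPlane := (h.pos n p hp).le

theorem continuousOn_comp {φ : ℝ × ℝ → ℝ} (hφ : ContinuousOn φ closedHalfPlane) (n : ℕ) :
    ContinuousOn (fun p => φ (state (rho n) (u n) p)) spaceTime :=
  hφ.comp (h.cont n) fun _ hp => h.mem_closedHalfPlane n hp

/-- Extension of g by zero makes it an admissible test function on the whole domain. -/
theorem tendsto_integral (f : C(BarH, ℝ)) {Q : Set (ℝ × ℝ)} (hQ : Q ⊆ spaceTime)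
    (hQm : MeasurableSet Q) {g : ℝ × ℝ → ℝ} (hg : IntegrableOn g Q) :
    Tendsto (fun n => ∫ p in Q, f (embed (state (rho n) (u n) p)) * g p) atTop
      (𝓝 (∫ p in Q, (∫ z, f z ∂(ν p : Measure BarH)) * g p)) := by
  have key : ∀ F : ℝ × ℝ → ℝ, ∫ p in spaceTime, F p * Q.indicator g p = ∫ p in Q, F p * g p := by
    intro F
    have e : (fun p => F p * Q.indicator g p) = Q.indicator fun p => F p * g p := by
      funext p
      by_cases hp : p ∈ Q
      · rw [indicator_of_mem hp, indicator_of_mem hp]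
      · rw [indicator_of_notMem hp, indicator_of_notMem hp, mul_zero]
    rw [e, setIntegral_indicator hQm, inter_eq_self_of_subset_right hQ]
  have := h.young.tendsto f (Q.indicator g) (hg.integrable_indicator hQm).integrableOn
  rw [key] at this
  simp only [key] at this
  exact this

theorem aestronglyMeasurable_integral (f : C(BarH, ℝ)) (Q : Set (ℝ × ℝ)) (hQ : Q ⊆ spaceTime) :
    AEStronglyMeasurable (fun p => ∫ z, f z ∂(ν p : Measure BarH)) (volume.restrict Q) :=
  (h.young.weakly_measurable f).mono_measure (Measure.restrict_mono hQ le_rfl)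

omit h in
theorem exists_abs_integral_le (f : C(BarH, ℝ)) :
    ∃ C : ℝ, ∀ p, |∫ z, f z ∂(ν p : Measure BarH)| ≤ C := by
  obtain ⟨C, hC⟩ := isCompact_univ.exists_bound_of_continuousOn f.continuous.continuousOn
  refine ⟨C, fun p => ?_⟩
  have := norm_integral_le_of_norm_le_const (μ := (ν p : Measure BarH))
    (Eventually.of_forall fun y => hC y (mem_univ y))
  simpa using this

include hγ

theorem integrableOn_moment (n : ℕ) (K : ℝ) :
    IntegrableOn (fun p => moment γ (state (rho n) (u n) p)) (box K) :=
  ((h.continuousOn_comp (continuous_moment hγ).continuousOn n).mono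
    (box_subset K)).integrableOn_compact (isCompact_box K)

/-- The bound of the moments passes to the Young measure. -/
theorem lintegral_box_le {K C : ℝ}
    (hC : ∀ n, ∫ p in box K, moment γ (state (rho n) (u n) p) ≤ C)
    {f : C(BarH, ℝ)} (hf0 : ∀ y, 0 ≤ f y) {c : ℝ} (hc : 0 ≤ c)
    (hf : ∀ q ∈ halfPlane, f (embed q) ≤ c * moment γ q) :
    ∫⁻ p in box K, ENNReal.ofReal (∫ z, f z ∂(ν p : Measure BarH)) ≤ ENNReal.ofReal (c * C) := by
  have hfin : volume (box K) ≠ ⊤ := (isCompact_box K).measure_lt_top.ne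
  obtain ⟨B, hB⟩ := exists_abs_integral_le (ν := ν) f
  have hint : IntegrableOn (fun p => ∫ z, f z ∂(ν p : Measure BarH)) (box K) :=
    IntegrableOn.of_bound hfin.lt_top (h.aestronglyMeasurable_integral f _ (box_subset K)) B
      (Eventually.of_forall hB)
  rw [← ofReal_integral_eq_lintegral_ofReal hint
    (Eventually.of_forall fun p => integral_nonneg hf0)]
  refine ENNReal.ofReal_le_ofReal ?_
  -- The box has finite volume, so the constant 1 is integrable on it and may be tested against; the
  -- uniform bound then passes to the limit.
  have ht := h.tendsto_integral f (box_subset K) (measurableSet_box K) (g := fun _ => 1)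
    (integrableOn_const hfin)
  simp only [mul_one] at ht
  refine le_of_tendsto' ht fun n => ?_
  refine (setIntegral_mono_on ?_ ((h.integrableOn_moment hγ n K).const_mul c)
    (measurableSet_box K) fun p hp => hf _ (h.pos n p (box_subset K hp))).trans ?_
  · exact (((f.continuous.comp continuous_embed).comp_continuousOn (h.cont n)).mono
      (box_subset K)).integrableOn_compact (isCompact_box K)
  · rw [integral_const_mul]
    exact mul_le_mul_of_nonneg_left (hC n) hc

/-- The integral of the moment with respect to the Young measure. -/
theorem moment_lintegral : AEMeasurable (fun p => ∫⁻ q : halfPlane, ENNReal.ofReal (moment γ q)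
      ∂(restrictH (ν p))) (volume.restrict spaceTime) ∧
    ∀ K : ℝ, 1 ≤ K → ∫⁻ p in box K, ∫⁻ q : halfPlane, ENNReal.ofReal (moment γ q)
      ∂(restrictH (ν p)) ≠ ⊤ := by
  -- The truncations of the moment extend continuously to the compactification and increase with k.
  -- Monotone convergence is used twice: under ν for fixed (t, x), and then in (t, x).
  choose f hf hf0 using fun k : ℕ =>
    exists_extension_mul_cutoff (continuous_moment hγ).continuousOn k
  have hm0 : ∀ q ∈ closedHalfPlane, 0 ≤ moment γ q := fun q hq => moment_nonneg γ hq
  have e : ∀ p, ∫⁻ q : halfPlane, ENNReal.ofReal (moment γ q) ∂(restrictH (ν p))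
      = ⨆ k, ENNReal.ofReal (∫ y, f k y ∂(ν p : Measure BarH)) := fun p =>
    lintegral_eq_iSup _ hm0 hf hf0
  have hfn : ∀ k y, 0 ≤ f k y := by
    intro k y
    by_cases hy : y ∈ openPart
    · obtain ⟨q, hq, rfl⟩ := hy
      rw [hf k q (halfPlane_subset hq)]
      exact mul_nonneg (hm0 q (halfPlane_subset hq)) (cutoff_nonneg k q)
    · rw [hf0 k y hy]
  have hm : ∀ k, AEMeasurable (fun p => ENNReal.ofReal (∫ y, f k y ∂(ν p : Measure BarH)))
      (volume.restrict spaceTime) := fun k =>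
    (h.young.weakly_measurable (f k)).aemeasurable.ennreal_ofReal
  simp only [e]
  refine ⟨AEMeasurable.iSup hm, fun K hK => ?_⟩
  obtain ⟨C, hC⟩ := h.bound K hK
  rw [lintegral_iSup' (fun k => (hm k).mono_measure (Measure.restrict_mono (box_subset K) le_rfl))]
  · refine ne_top_of_le_ne_top ENNReal.ofReal_ne_top (iSup_le fun k =>
      h.lintegral_box_le hγ hC (hfn k) zero_le_one fun q hq => ?_)
    rw [hf k q (halfPlane_subset hq), one_mul]
    exact mul_le_of_le_one_right (hm0 q (halfPlane_subset hq)) (cutoff_le_one k q)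
  · refine Eventually.of_forall fun p k l hkl => ENNReal.ofReal_le_ofReal ?_
    have hi : ∀ k, Integrable (f k) (ν p : Measure BarH) := fun k =>
      (f k).continuous.integrable_of_hasCompactSupport (HasCompactSupport.of_compactSpace _)
    refine integral_mono (hi k) (hi l) fun y => ?_
    by_cases hy : y ∈ openPart
    · obtain ⟨q, hq, rfl⟩ := hy
      have hq' : q ∈ closedHalfPlane := (halfPlane_subset hq)
      rw [hf k q hq', hf l q hq']
      exact mul_le_mul_of_nonneg_left (cutoff_mono hq' hkl) (hm0 q hq')
    · rw [hf0 k y hy, hf0 l y hy]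

theorem ae_integrable_moment : ∀ᵐ p ∂(volume.restrict spaceTime),
    Integrable (fun q : halfPlane => moment γ q) (restrictH (ν p)) := by
  obtain ⟨hm, hfin⟩ := h.moment_lintegral hγ
  refine ae_spaceTime_of_box fun K hK => ?_
  filter_upwards [ae_lt_top' (hm.mono_measure (Measure.restrict_mono (box_subset K) le_rfl))
    (hfin K hK)] with p hp
  refine ⟨((continuous_moment hγ).comp continuous_subtype_val).aestronglyMeasurable, ?_⟩
  rwa [hasFiniteIntegral_iff_ofReal (Eventually.of_forall fun q : halfPlane =>
    moment_nonneg γ (halfPlane_subset q.2))]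

theorem integrableOn_integral_moment {Q : Set (ℝ × ℝ)} (hQ : Q ⊆ spaceTime)
    (hb : Bornology.IsBounded Q) :
    IntegrableOn (fun p => ∫ q : halfPlane, moment γ q ∂(restrictH (ν p))) Q := by
  obtain ⟨K, hK, hsub⟩ := exists_subset_box hb hQ
  obtain ⟨hm, hfin⟩ := h.moment_lintegral hγ
  refine IntegrableOn.mono_set ?_ hsub
  have e : (fun p => ∫ q : halfPlane, moment γ q ∂(restrictH (ν p)))
      = fun p => (∫⁻ q : halfPlane, ENNReal.ofReal (moment γ q) ∂(restrictH (ν p))).toReal := by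
    funext p
    rw [integral_eq_lintegral_of_nonneg_ae
      (Eventually.of_forall fun q : halfPlane => moment_nonneg γ (halfPlane_subset q.2))
      ((continuous_moment hγ).comp continuous_subtype_val).aestronglyMeasurable]
  rw [e]
  exact integrable_toReal_of_lintegral_ne_top
    (hm.mono_measure (Measure.restrict_mono (box_subset K) le_rfl)) (hfin K hK)

end BoundedMoments

theorem tendsto_of_approx {a : ℕ → ℝ} {a₀ : ℝ} (h : ∀ δ > 0, ∃ b : ℕ → ℝ, ∃ b₀ : ℝ,
    Tendsto b atTop (𝓝 b₀) ∧ (∀ n, |a n - b n| ≤ δ) ∧ |a₀ - b₀| ≤ δ) :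
    Tendsto a atTop (𝓝 a₀) := by
  rw [Metric.tendsto_atTop]
  intro e he
  obtain ⟨b, b₀, hb, h1, h2⟩ := h (e / 4) (by positivity)
  obtain ⟨N, hN⟩ := Metric.tendsto_atTop.1 hb (e / 4) (by positivity)
  refine ⟨N, fun n hn => ?_⟩
  have h3 := hN n hn
  rw [Real.dist_eq] at h3 ⊢
  have h4 := abs_sub_le (a n) (b n) a₀
  have h5 := abs_sub_le (b n) b₀ a₀
  rw [abs_sub_comm b₀] at h5
  linarith [h1 n]

/-- The truncations of a test function converge, relative to the moment. -/
theorem IsTestFunction.exists_cutoff {γ : ℝ} (hγ : 1 < γ) {φ : ℝ × ℝ → ℝ}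
    (h : IsTestFunction γ φ) {δ : ℝ} (hδ : 0 < δ) :
    ∃ k : ℕ, ∀ q ∈ halfPlane, |φ q - φ q * cutoff k q| ≤ δ * (1 + moment γ q) := by
  obtain ⟨c, hc, hsupp⟩ := h.support
  obtain ⟨β, hβ, R, hgrowth⟩ := h.growth
  have hθ := theta_pos hγ
  obtain ⟨C, hC0, hC⟩ := exists_rpow_le_mul_rpow_add (a := β * (γ + 1)) (b := γ + 1) (δ := δ / 2)
    (mul_nonneg hβ.1.le (by linarith)) (mul_lt_of_lt_one_left (by linarith) hβ.2) (by positivity)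
  -- Beyond R₂ the growth bound holds, and the additive constant satisfies C ≤ (δ/2)ρ ≤
  -- (δ/2)ρ^(γ+1).
  obtain ⟨R₂, hR₂⟩ : ∃ R₂, R₂ = max (max R 1) (2 * C / δ) := ⟨_, rfl⟩
  have hRR : R ≤ R₂ := hR₂ ▸ (le_max_left R 1).trans (le_max_left _ _)
  have hR1 : 1 ≤ R₂ := hR₂ ▸ (le_max_right R 1).trans (le_max_left _ _)
  have hRC : 2 * C / δ ≤ R₂ := hR₂ ▸ le_max_right _ _
  have hlarge : ∀ q ∈ halfPlane, R₂ ≤ q.1 → |φ q| ≤ δ * q.1 ^ (γ + 1) := by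
    intro q hq hqR
    have hq1 : 0 < q.1 := hq
    refine (hgrowth q (halfPlane_subset hq) (hRR.trans hqR)).trans ((hC q.1 hq1).trans ?_)
    have h1 : q.1 ≤ q.1 ^ (γ + 1) := by
      have := Real.rpow_le_rpow_of_exponent_le (hR1.trans hqR) (by linarith : 1 ≤ γ + 1)
      rwa [Real.rpow_one] at this
    have h2 : 2 * C ≤ q.1 * δ := (div_le_iff₀ hδ).1 (hRC.trans hqR)
    nlinarith
  -- For ρ ≤ R₂ the support condition gives |u| ≤ ρ^θ + c, so the relevant states have length at
  -- most k₁ and form a bounded set.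
  obtain ⟨k₁, hk₁⟩ : ∃ k₁, k₁ = R₂ + R₂ ^ theta γ + c := ⟨_, rfl⟩
  have hcomp := isCompact_len_le k₁
  obtain ⟨η, hη, huc⟩ := Metric.uniformContinuousOn_iff.1
    (hcomp.uniformContinuousOn_of_continuous (h.continuousOn.mono inter_subset_left)) δ hδ
  obtain ⟨k, hk⟩ := exists_nat_ge (max k₁ (2 / η))
  have hkk₁ : k₁ ≤ k := (le_max_left _ _).trans hk
  have hkη : 2 ≤ k * η := (div_le_iff₀ hη).1 ((le_max_right _ _).trans hk)
  refine ⟨k, fun q hq => ?_⟩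
  have hq1 : 0 < q.1 := hq
  have hm := moment_nonneg γ hq1.le
  have hle : |φ q - φ q * cutoff k q| ≤ |φ q| := by
    rw [show φ q - φ q * cutoff k q = φ q * (1 - cutoff k q) by ring, abs_mul]
    refine mul_le_of_le_one_right (abs_nonneg _) ?_
    rw [abs_of_nonneg (by linarith [cutoff_le_one k q])]
    linarith [cutoff_nonneg k q]
  by_cases hφ : φ q = 0
  · rw [hφ, zero_mul, sub_zero, abs_zero]
    positivity
  obtain ⟨s1, s2⟩ := hsupp q (halfPlane_subset hq) hφ
  rcases le_total R₂ q.1 with hR | hR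
  · refine hle.trans ((hlarge q hq hR).trans (mul_le_mul_of_nonneg_left ?_ hδ.le))
    unfold moment
    have : 0 ≤ q.1 * |q.2| ^ 3 := by positivity
    linarith
  · have hlen : len q ≤ k₁ := by
      have h1 : |q.2| ≤ q.1 ^ theta γ + c := abs_le.2 ⟨by linarith, by linarith⟩
      have h2 := Real.rpow_le_rpow hq1.le hR hθ.le
      have h3 := len_le q
      rw [abs_of_pos hq1] at h3
      linarith
    by_cases h2 : 2 ≤ k * q.1
    · rw [cutoff_eq_one h2 (hlen.trans hkk₁), mul_one, sub_self, abs_zero]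
      positivity
    -- Here the cutoff may be below 1, but only because kρ < 2. The state is then within η of the
    -- vacuum, and uniform continuity makes φ smaller than δ.
    · have hqη : q.1 < η := by
        by_contra hge
        exact h2 (hkη.trans (mul_le_mul_of_nonneg_left (not_lt.1 hge) k.cast_nonneg))
      have h0 : ((0, q.2) : ℝ × ℝ) ∈ closedHalfPlane ∩ {q | len q ≤ k₁} := by
        refine ⟨le_refl (0 : ℝ), le_trans (Real.sqrt_le_sqrt ?_) hlen⟩
        simp only
        nlinarith [sq_nonneg q.1]
      have h3 := huc q ⟨halfPlane_subset hq, hlen⟩ (0, q.2) h0 (by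
        rw [Prod.dist_eq]
        simpa [abs_of_pos hq1] using ⟨hqη, hη⟩)
      rw [h.zero_boundary, Real.dist_eq, sub_zero] at h3
      have : 0 ≤ δ * moment γ q := by positivity
      linarith

/-! ### Passage to the limit in unbounded test functions. -/

namespace BoundedMoments

variable {γ : ℝ} {rho u : ℕ → ℝ → ℝ → ℝ} {ν : ℝ × ℝ → ProbabilityMeasure BarH}
  (h : BoundedMoments γ rho u ν) (hγ : 1 < γ) {φ : ℝ × ℝ → ℝ}
  (hφ : ContinuousOn φ closedHalfPlane)

omit h in
theorem continuous_restrict (hφ : ContinuousOn φ closedHalfPlane) :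
    Continuous fun q : halfPlane => φ q :=
  hφ.comp_continuous continuous_subtype_val fun q => halfPlane_subset q.2

include hφ in
omit h in
theorem integrable_of_approx (ha : ∀ δ > 0, ∃ k : ℕ, ∀ q ∈ halfPlane,
      |φ q - φ q * cutoff k q| ≤ δ * (1 + moment γ q)) {p : ℝ × ℝ}
    (hp : Integrable (fun q : halfPlane => moment γ q) (restrictH (ν p))) :
    Integrable (fun q : halfPlane => φ q) (restrictH (ν p)) := by
  obtain ⟨k, hk⟩ := ha 1 one_pos
  obtain ⟨f, hf, -⟩ := exists_extension_mul_cutoff hφ k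
  obtain ⟨B, hB⟩ := isCompact_univ.exists_bound_of_continuousOn f.continuous.continuousOn
  refine Integrable.mono' (((integrable_const (1 : ℝ)).add hp).add (integrable_const B))
    (continuous_restrict hφ).aestronglyMeasurable (Eventually.of_forall fun q => ?_)
  have h1 := hk q q.2
  have h2 := hB (embed q) (mem_univ _)
  rw [hf q (halfPlane_subset q.2), Real.norm_eq_abs] at h2
  have h3 := abs_sub_abs_le_abs_sub (φ q) (φ q * cutoff k q)
  simp only [Pi.add_apply, Real.norm_eq_abs]
  linarith

omit h in
theorem abs_integral_sub_le {k : ℕ} {δ : ℝ} (hδ : 0 ≤ δ)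
    (hk : ∀ q ∈ halfPlane, |φ q - φ q * cutoff k q| ≤ δ * (1 + moment γ q)) {f : C(BarH, ℝ)}
    (hf : ∀ q ∈ closedHalfPlane, f (embed q) = φ q * cutoff k q) (hf0 : ∀ y ∉ openPart, f y = 0)
    {p : ℝ × ℝ} (hp : Integrable (fun q : halfPlane => moment γ q) (restrictH (ν p)))
    (hφp : Integrable (fun q : halfPlane => φ q) (restrictH (ν p))) :
    |(∫ q : halfPlane, φ q ∂(restrictH (ν p))) - ∫ y, f y ∂(ν p : Measure BarH)|
      ≤ δ * (1 + ∫ q : halfPlane, moment γ q ∂(restrictH (ν p))) := by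
  rw [← integral_restrictH _ hf0]
  have e : ∀ q : halfPlane, f (embed q) = φ q * cutoff k q := fun q => hf q (halfPlane_subset q.2)
  simp only [e]
  have hi : Integrable (fun q : halfPlane => φ q * cutoff k q) (restrictH (ν p)) :=
    hφp.mul_bdd (c := 1) ((continuous_cutoff k).comp continuous_subtype_val).aestronglyMeasurable
      (Eventually.of_forall fun q => by
        rw [Real.norm_eq_abs, abs_of_nonneg (cutoff_nonneg _ _)]; exact cutoff_le_one _ _)
  rw [← integral_sub hφp hi]
  refine (abs_integral_le_integral_abs).trans ?_
  have hr : (restrictH (ν p : Measure BarH)).real univ ≤ 1 :=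
    ENNReal.toReal_le_of_le_ofReal zero_le_one
      ((restrictH_univ_le _).trans (by rw [ENNReal.ofReal_one]))
  calc ∫ q : halfPlane, |φ q - φ q * cutoff k q| ∂(restrictH (ν p))
      ≤ ∫ q : halfPlane, δ * (1 + moment γ q) ∂(restrictH (ν p)) :=
        integral_mono (hφp.sub hi).abs (((integrable_const (1 : ℝ)).add hp).const_mul δ)
          fun q => hk q q.2
    _ = δ * ((restrictH (ν p : Measure BarH)).real univ
          + ∫ q : halfPlane, moment γ q ∂(restrictH (ν p))) := by
        rw [integral_const_mul, integral_add (integrable_const _) hp, integral_const, smul_eq_mul,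
          mul_one]
    _ ≤ _ := mul_le_mul_of_nonneg_left (by linarith) hδ

include h hγ hφ

/-- The integral is an almost everywhere limit of integrals of continuous functions on the
compactification, for which measurability is part of the definition of a Young measure. -/
theorem aestronglyMeasurable_of_approx (ha : ∀ δ > 0, ∃ k : ℕ, ∀ q ∈ halfPlane,
      |φ q - φ q * cutoff k q| ≤ δ * (1 + moment γ q)) :
    AEStronglyMeasurable (fun p => ∫ q : halfPlane, φ q ∂(restrictH (ν p)))
      (volume.restrict spaceTime) := by
  choose k hk using fun m : ℕ => ha (1 / ((m : ℝ) + 1)) Nat.one_div_pos_of_nat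
  choose f hf hf0 using fun m : ℕ => exists_extension_mul_cutoff hφ (k m)
  refine aestronglyMeasurable_of_tendsto_ae atTop
    (f := fun m p => ∫ y, f m y ∂(ν p : Measure BarH))
    (fun m => h.young.weakly_measurable (f m)) ?_
  filter_upwards [h.ae_integrable_moment hγ] with p hp
  have hφp := integrable_of_approx hφ ha hp
  rw [tendsto_iff_dist_tendsto_zero]
  have hlim := (tendsto_one_div_add_atTop_nhds_zero_nat (𝕜 := ℝ)).mul_const
    (1 + ∫ q : halfPlane, moment γ q ∂(restrictH (ν p)))
  rw [zero_mul] at hlim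
  refine squeeze_zero (fun _ => dist_nonneg) (fun m => ?_) hlim
  rw [dist_comm, Real.dist_eq]
  exact abs_integral_sub_le Nat.one_div_pos_of_nat.le (hk m) (hf m) (hf0 m) hp hφp

theorem integrableOn_of_approx (ha : ∀ δ > 0, ∃ k : ℕ, ∀ q ∈ halfPlane,
      |φ q - φ q * cutoff k q| ≤ δ * (1 + moment γ q)) {K : Set (ℝ × ℝ)} (hK : K ⊆ spaceTime)
    (hKc : IsCompact K) :
    IntegrableOn (fun p => ∫ q : halfPlane, φ q ∂(restrictH (ν p))) K := by
  obtain ⟨k, hk⟩ := ha 1 one_pos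
  obtain ⟨f, hf, hf0⟩ := exists_extension_mul_cutoff hφ k
  obtain ⟨B, hB⟩ := exists_abs_integral_le (ν := ν) f
  have hfin : volume K ≠ ⊤ := hKc.measure_lt_top.ne
  refine Integrable.mono' (((integrableOn_const (C := (1 : ℝ)) hfin).add
    (h.integrableOn_integral_moment hγ hK hKc.isBounded)).add (integrableOn_const (C := B) hfin))
    ((h.aestronglyMeasurable_of_approx hγ hφ ha).mono_measure (Measure.restrict_mono hK le_rfl)) ?_
  filter_upwards [ae_mono (Measure.restrict_mono hK le_rfl) (h.ae_integrable_moment hγ)] with p hp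
  have h1 := abs_integral_sub_le zero_le_one hk hf hf0 hp (integrable_of_approx hφ ha hp)
  have h2 := hB p
  have h3 := abs_sub_abs_le_abs_sub (∫ q : halfPlane, φ q ∂(restrictH (ν p)))
    (∫ y, f y ∂(ν p : Measure BarH))
  simp only [Pi.add_apply, Real.norm_eq_abs]
  linarith

/-- The truncation error is at most δ times an integral of 1 + moment, uniformly in n and also in
the limit, while the truncated function converges by the Young measure property. The moment thus
provides the equi-integrability. -/
theorem tendsto_of_approx (ha : ∀ δ > 0, ∃ k : ℕ, ∀ q ∈ halfPlane,
      |φ q - φ q * cutoff k q| ≤ δ * (1 + moment γ q)) {K : Set (ℝ × ℝ)} (hK : K ⊆ spaceTime)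
    (hKc : IsCompact K) {g : ℝ × ℝ → ℝ} (hg : MemLp g ⊤ (volume.restrict K)) :
    Tendsto (fun n => ∫ p in K, φ (state (rho n) (u n) p) * g p) atTop
      (𝓝 (∫ p in K, (∫ q : halfPlane, φ q ∂(restrictH (ν p))) * g p)) := by
  have hKm := hKc.measurableSet
  have hfin : volume K ≠ ⊤ := hKc.measure_lt_top.ne
  have : IsFiniteMeasure (volume.restrict K) := ⟨by simpa using hfin.lt_top⟩
  obtain ⟨G, hG0, hG⟩ : ∃ G : ℝ, 0 ≤ G ∧ ∀ᵐ p ∂(volume.restrict K), |g p| ≤ G := by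
    refine ⟨(eLpNormEssSup g (volume.restrict K)).toReal, ENNReal.toReal_nonneg, ?_⟩
    have h1 : eLpNormEssSup g (volume.restrict K) ≠ ⊤ := by
      rw [← eLpNorm_exponent_top]; exact hg.2.ne
    filter_upwards [ae_le_eLpNormEssSup (f := g) (μ := volume.restrict K)] with p hp
    have := ENNReal.toReal_mono h1 hp
    simpa using this
  have hgi : IntegrableOn g K := hg.integrable le_top
  obtain ⟨L, hL, hKL⟩ := exists_subset_box hKc.isBounded hK
  obtain ⟨C, hC⟩ := h.bound L hL
  have hC0 : 0 ≤ C := (integral_nonneg_of_ae ((ae_restrict_iff' (measurableSet_box L)).2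
    (Eventually.of_forall fun p hp => moment_nonneg γ (h.mem_closedHalfPlane 0
      (box_subset L hp))))).trans (hC 0)
  obtain ⟨F, hF⟩ : ∃ F : ℝ × ℝ → ℝ, F = fun p => ∫ q : halfPlane, φ q ∂(restrictH (ν p)) := ⟨_, rfl⟩
  have hFi : IntegrableOn F K := hF ▸ h.integrableOn_of_approx hγ hφ ha hK hKc
  obtain ⟨mo, hmo⟩ : ∃ mo : ℝ × ℝ → ℝ, mo = fun p =>
    ∫ q : halfPlane, moment γ q ∂(restrictH (ν p)) := ⟨_, rfl⟩
  have hmoi : IntegrableOn mo K := hmo ▸ h.integrableOn_integral_moment hγ hK hKc.isBounded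
  have hmo0 : ∀ p, 0 ≤ mo p := fun p => by
    rw [hmo]; exact integral_nonneg fun q => moment_nonneg γ (halfPlane_subset q.2)
  have hmoI : 0 ≤ ∫ p in K, mo p := integral_nonneg hmo0
  -- A dominates both error factors, that of the sequence (with C) and that of the limit; the
  -- summand 1 makes division by A legitimate.
  obtain ⟨A, hA⟩ : ∃ A, A = G * (volume.real K + C + ∫ p in K, mo p) + 1 := ⟨_, rfl⟩
  have hA0 : 0 < A := hA ▸ by positivity
  -- the error of a truncation
  have key : ∀ (F₁ F₂ M : ℝ × ℝ → ℝ) (δ I : ℝ), 0 ≤ δ → IntegrableOn F₁ K → IntegrableOn F₂ K →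
      IntegrableOn M K → (∀ᵐ p ∂(volume.restrict K), |F₁ p - F₂ p| ≤ δ * (1 + M p)) →
      ∫ p in K, M p ≤ I →
      |(∫ p in K, F₁ p * g p) - ∫ p in K, F₂ p * g p| ≤ δ * (G * (volume.real K + I)) := by
    intro F₁ F₂ M δ I hδ h1 h2 hM hle hI
    have i1 : ∀ {f : ℝ × ℝ → ℝ}, IntegrableOn f K → IntegrableOn (fun p => f p * g p) K :=
      fun hf => Integrable.mul_bdd (c := G) hf hg.1 hG
    rw [← integral_sub (i1 h1) (i1 h2)]
    refine abs_integral_le_integral_abs.trans ?_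
    calc ∫ p in K, |F₁ p * g p - F₂ p * g p|
        ≤ ∫ p in K, δ * G * (1 + M p) := by
          refine integral_mono_ae ((i1 h1).sub (i1 h2)).abs
            (((integrableOn_const hfin).add hM).const_mul _) ?_
          filter_upwards [hle, hG] with p hp hgp
          rw [← sub_mul, abs_mul]
          have := mul_le_mul hp hgp (abs_nonneg _) ((abs_nonneg _).trans hp)
          linarith
      _ = δ * (G * (volume.real K + ∫ p in K, M p)) := by
          rw [integral_const_mul, integral_add (f := fun _ => (1 : ℝ)) (integrable_const _) hM, setIntegral_const,
            smul_eq_mul, mul_one]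
          ring
      _ ≤ _ := by gcongr
  refine IsentropicLimit.tendsto_of_approx fun e he => ?_
  obtain ⟨k, hk⟩ := ha (e / A) (by positivity)
  obtain ⟨f, hf, hf0⟩ := exists_extension_mul_cutoff hφ k
  refine ⟨_, _, h.tendsto_integral f hK hKm hgi, fun n => ?_, ?_⟩
  · refine (key (fun p => φ (state (rho n) (u n) p)) (fun p => f (embed (state (rho n) (u n) p)))
      (fun p => moment γ (state (rho n) (u n) p)) (e / A) C (by positivity)
      (((h.continuousOn_comp hφ n).mono hK).integrableOn_compact hKc)
      ((((f.continuous.comp continuous_embed).comp_continuousOn (h.cont n)).mono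
        hK).integrableOn_compact hKc)
      ((h.integrableOn_moment hγ n L).mono_set hKL) ?_ ?_).trans ?_
    · refine (ae_restrict_iff' hKm).2 (Eventually.of_forall fun p hp => ?_)
      rw [hf _ (h.mem_closedHalfPlane n (hK hp))]
      exact hk _ (h.pos n p (hK hp))
    · refine (setIntegral_mono_set (h.integrableOn_moment hγ n L)
        ((ae_restrict_iff' (measurableSet_box L)).2 (Eventually.of_forall fun p hp =>
          moment_nonneg γ (h.mem_closedHalfPlane n (box_subset L hp))))
        (Eventually.of_forall hKL)).trans (hC n)
    · rw [div_mul_eq_mul_div, div_le_iff₀ hA0]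
      refine mul_le_mul_of_nonneg_left ?_ he.le
      have : 0 ≤ G * ∫ p in K, mo p := by positivity
      rw [hA]; linarith
  · obtain ⟨B, hB⟩ := exists_abs_integral_le (ν := ν) f
    refine (key F (fun p => ∫ y, f y ∂(ν p : Measure BarH)) mo (e / A) _ (by positivity) hFi
      (IntegrableOn.of_bound hfin.lt_top (h.aestronglyMeasurable_integral f _ hK) B
        (Eventually.of_forall hB)) hmoi ?_ le_rfl).trans ?_ |> fun z => by rw [hF] at z; exact z
    · filter_upwards [ae_mono (Measure.restrict_mono hK le_rfl) (h.ae_integrable_moment hγ)]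
        with p hp
      rw [hF, hmo]
      exact abs_integral_sub_le (by positivity) hk hf hf0 hp (integrable_of_approx hφ ha hp)
    · rw [div_mul_eq_mul_div, div_le_iff₀ hA0]
      refine mul_le_mul_of_nonneg_left ?_ he.le
      have : 0 ≤ G * C := by positivity
      rw [hA]; linarith

end BoundedMoments

/-! ## Absence of mass at infinity -/

theorem embed_vacuum (u : ℝ) : ((embed (0, u) : BarH) : ℝ × ℝ) = (0, 0) := by
  simp [embed, pinch, compress]

theorem fst_embed {q : ℝ × ℝ} (hq : q ∈ closedHalfPlane) :
    (embed q : ℝ × ℝ).1 = q.1 / (1 + len q) := by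
  rw [embed_eq hq]
  rfl

theorem mem_vacuum_of_fst_eq_zero {y : BarH} (hy : (y : ℝ × ℝ).1 = 0) : y ∈ vacuum := by
  refine subset_closure ⟨(0, 0), rfl, Subtype.ext ?_⟩
  rw [embed_vacuum]
  obtain ⟨_, z, hz, rfl⟩ := y
  simp only [pinch] at hy ⊢
  rw [hy, zero_mul]

theorem fst_nonneg (y : BarH) : 0 ≤ (y : ℝ × ℝ).1 := by
  obtain ⟨_, z, hz, rfl⟩ := y
  exact hz.1

/-- A function on the compactification that equals `1` outside of the half-plane, away from the
vacuum, and is small in the mean. -/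
theorem exists_far_function {γ : ℝ} (hγ : 1 < γ) (j k : ℕ) (hk : 0 < k) :
    ∃ f : C(BarH, ℝ), (∀ y, 0 ≤ f y) ∧
      (∀ y ∉ openPart, 2 ≤ j * (y : ℝ × ℝ).1 → f y = 1) ∧
      ∀ q ∈ halfPlane, f (embed q) ≤ ((j : ℝ) / k) ^ (γ + 1) * moment γ q := by
  obtain ⟨f₁, hf₁⟩ : ∃ f₁ : C(BarH, ℝ), ∀ y, f₁ y = clip (j * (y : ℝ × ℝ).1 - 1) :=
    ⟨⟨fun y => clip (j * (y : ℝ × ℝ).1 - 1), continuous_clip.comp (by fun_prop)⟩, fun _ => rfl⟩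
  have c1 : Continuous fun q => f₁ (embed q) * clip (k + 1 - len q) := by
    have h1 := continuous_clip
    have h2 := continuous_len
    have h3 := f₁.continuous.comp continuous_embed
    exact h3.mul (by fun_prop)
  -- f₁ separates from the vacuum; f₂ is its truncation to bounded states and vanishes off the open
  -- half-plane. The difference f₁ - f₂ keeps the values of f₁ at infinity and is supported on long
  -- states.
  obtain ⟨f₂, hf₂, hf₂0⟩ := exists_extension c1.continuousOn (k := k + 1)
    (fun u => by rw [hf₁, embed_vacuum, clip_eq_zero (by simp), zero_mul])
    (fun q hq => by rw [clip_eq_zero (x := k + 1 - len q) (by linarith), mul_zero])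
  have h01 : ∀ y, 0 ≤ f₁ y ∧ f₁ y ≤ 1 := fun y => by
    rw [hf₁]; exact ⟨clip_nonneg _, clip_le_one _⟩
  have e : ∀ q ∈ closedHalfPlane, (f₁ - f₂) (embed q)
      = f₁ (embed q) * (1 - clip (k + 1 - len q)) := fun q hq => by
    rw [ContinuousMap.sub_apply, hf₂ q hq]; ring
  refine ⟨f₁ - f₂, fun y => ?_, fun y hy hj => ?_, fun q hq => ?_⟩
  · by_cases hy : y ∈ openPart
    · obtain ⟨q, hq, rfl⟩ := hy
      rw [e q (halfPlane_subset hq)]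
      exact mul_nonneg (h01 _).1 (by linarith [clip_le_one (k + 1 - len q)])
    · rw [ContinuousMap.sub_apply, hf₂0 y hy, sub_zero]
      exact (h01 y).1
  · rw [ContinuousMap.sub_apply, hf₂0 y hy, sub_zero, hf₁]
    exact clip_eq_one (by linarith)
  · have hq1 : 0 < q.1 := hq
    have hk0 : (0 : ℝ) < k := by exact_mod_cast hk
    rw [e q (halfPlane_subset hq)]
    have hm := moment_nonneg γ hq1.le
    have hrhs : 0 ≤ ((j : ℝ) / k) ^ (γ + 1) * moment γ q := by positivity
    by_cases hlen : len q ≤ k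
    · rw [clip_eq_one (by linarith), sub_self, mul_zero]
      exact hrhs
    by_cases hj : (j : ℝ) * (embed q : ℝ × ℝ).1 ≤ 1
    · rw [hf₁, clip_eq_zero (by linarith), zero_mul]
      exact hrhs
    -- On the support jρ > 1 + |q| and |q| > k, which forces ρ > k/j: remote states away from the
    -- vacuum have large density.
    have h1 : 1 ≤ (j : ℝ) / k * q.1 := by
      rw [fst_embed (halfPlane_subset hq), not_le, ← mul_div_assoc,
        lt_div_iff₀ (by linarith), one_mul] at hj
      rw [div_mul_eq_mul_div, le_div_iff₀ hk0]
      linarith [not_le.1 hlen]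
    calc f₁ (embed q) * (1 - clip (k + 1 - len q)) ≤ 1 :=
          mul_le_one₀ (h01 _).2 (by linarith [clip_le_one (k + 1 - len q)])
            (by linarith [clip_nonneg (k + 1 - len q)])
      _ ≤ ((j : ℝ) / k * q.1) ^ (γ + 1) := Real.one_le_rpow h1 (by linarith)
      _ = ((j : ℝ) / k) ^ (γ + 1) * q.1 ^ (γ + 1) := Real.mul_rpow (by positivity) hq1.le
      _ ≤ _ := by
        refine mul_le_mul_of_nonneg_left ?_ (by positivity)
        unfold moment
        have : 0 ≤ q.1 * |q.2| ^ 3 := by positivity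
        linarith

namespace BoundedMoments

variable {γ : ℝ} {rho u : ℕ → ℝ → ℝ → ℝ} {ν : ℝ × ℝ → ProbabilityMeasure BarH}
  (h : BoundedMoments γ rho u ν) (hγ : 1 < γ)
include h hγ

/-- The mean of the k-th far function over a box is of order k^(-(γ+1)), so the infimum over k of
its ν-integrals vanishes almost everywhere; each of these integrals dominates the measure of the
set. -/
theorem ae_measure_far_eq_zero (j : ℕ) : ∀ᵐ p ∂(volume.restrict spaceTime),
    (ν p : Measure BarH) {y | y ∉ openPart ∧ 2 ≤ j * (y : ℝ × ℝ).1} = 0 := by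
  refine ae_spaceTime_of_box fun K hK => ?_
  obtain ⟨C, hC⟩ := h.bound K hK
  choose f hf0 hf1 hf using fun k : ℕ => exists_far_function hγ j (k + 1) k.succ_pos
  have hm : ∀ k, AEMeasurable (fun p => ENNReal.ofReal (∫ y, f k y ∂(ν p : Measure BarH)))
      (volume.restrict (box K)) := fun k =>
    (h.aestronglyMeasurable_integral (f k) _ (box_subset K)).aemeasurable.ennreal_ofReal
  have hle : ∀ k : ℕ, ∫⁻ p in box K, ⨅ k, ENNReal.ofReal (∫ y, f k y ∂(ν p : Measure BarH))
      ≤ ENNReal.ofReal (((j : ℝ) / ((k + 1 : ℕ) : ℝ)) ^ (γ + 1) * C) := fun k =>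
    (lintegral_mono fun p => iInf_le _ k).trans
      (h.lintegral_box_le hγ hC (hf0 k) (by positivity) (hf k))
  have hlim : Tendsto (fun k : ℕ => ENNReal.ofReal (((j : ℝ) / ((k + 1 : ℕ) : ℝ)) ^ (γ + 1) * C))
      atTop (𝓝 0) := by
    have h1 : Tendsto (fun k : ℕ => (j : ℝ) / ((k + 1 : ℕ) : ℝ)) atTop (𝓝 0) :=
      (tendsto_add_atTop_iff_nat 1).2 (tendsto_const_div_atTop_nhds_zero_nat (j : ℝ))
    have h2 := (h1.rpow_const (p := γ + 1) (Or.inr (by linarith))).mul_const C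
    rw [Real.zero_rpow (by linarith), zero_mul] at h2
    simpa using ENNReal.tendsto_ofReal h2
  have hzero := le_antisymm (ge_of_tendsto' hlim hle) zero_le
  rw [lintegral_eq_zero_iff' (AEMeasurable.iInf hm)] at hzero
  filter_upwards [hzero] with p hp
  refine le_antisymm (le_of_le_of_eq (le_iInf fun k => ?_) hp) zero_le
  have hi : Integrable (f k) (ν p : Measure BarH) :=
    (f k).continuous.integrable_of_hasCompactSupport (HasCompactSupport.of_compactSpace _)
  rw [ofReal_integral_eq_lintegral_ofReal hi (Eventually.of_forall (hf0 k))]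
  have h1 := mul_meas_ge_le_lintegral (μ := (ν p : Measure BarH))
    (f k).continuous.measurable.ennreal_ofReal 1
  rw [one_mul] at h1
  refine (measure_mono fun y hy => ?_).trans h1
  change 1 ≤ ENNReal.ofReal (f k y)
  rw [hf1 k y hy.1 hy.2, ENNReal.ofReal_one]

/-- A point off the vacuum has a positive first coordinate, so the complement is exhausted by the
countably many sets of `ae_measure_far_eq_zero`. -/
theorem ae_measure_compl_eq_zero : ∀ᵐ p ∂(volume.restrict spaceTime),
    (ν p : Measure BarH) (openPart ∪ vacuum)ᶜ = 0 := by
  filter_upwards [ae_all_iff.2 (h.ae_measure_far_eq_zero hγ)] with p hp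
  refine measure_mono_null (fun y hy => ?_) (measure_iUnion_null hp)
  have hy1 : y ∉ openPart := fun hyo => hy (Or.inl hyo)
  have hy2 : 0 < (y : ℝ × ℝ).1 := lt_of_le_of_ne (fst_nonneg y)
    fun h0 => hy (Or.inr (mem_vacuum_of_fst_eq_zero h0.symm))
  obtain ⟨j, hj⟩ := exists_nat_ge (2 / (y : ℝ × ℝ).1)
  exact mem_iUnion.2 ⟨j, hy1, (div_le_iff₀ hy2).1 hj⟩

end BoundedMoments

end IsentropicLimit

end


/-! ### The proposition. -/

open IsentropicLimit

theorem proposition5p1 (γ : ℝ) (hγ : 1 < γ)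
    -- end states and reference profile
    (s : EndStates) (hL : 0 < s.rhoL) (hR : 0 < s.rhoR)
    (rhobar ubar : ℝ → ℝ) (hbar : IsReferenceProfile s rhobar ubar)
    -- viscosities tending to zero
    (ε : ℕ → ℝ) (hε : ∀ n, 0 < ε n) (hε₀ : Tendsto ε atTop (𝓝 0))
    -- initial data, bounded uniformly in the viscosity
    (rho0 u0 : ℕ → ℝ → ℝ) (E₀ E₁ M₀ : ℝ≥0)
    (hdata : ∀ n, InitialBounds γ (ε n) rhobar ubar E₀ E₁ M₀ (rho0 n) (u0 n))
    -- the solutions and their Young measure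
    (rho u : ℕ → ℝ → ℝ → ℝ)
    (hsol : ∀ n, IsNSSolution γ (ε n) s (rho0 n) (u0 n) (rho n) (u n))
    (ν : ℝ × ℝ → ProbabilityMeasure BarH) (hν : IsYoungMeasure rho u ν) :
    -- integrability of the Young measure
    ((∀ᵐ p ∂(volume.restrict spaceTime),
        Integrable (fun q : halfPlane => q.1.1 ^ (γ + 1) + q.1.1 * |q.1.2| ^ 3)
          (restrictH (ν p))) ∧
      ∀ (T : ℝ) (K : Set ℝ), IsCompact K →
        IntegrableOn (fun p => ∫ q : halfPlane, (q.1.1 ^ (γ + 1) + q.1.1 * |q.1.2| ^ 3)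
          ∂(restrictH (ν p))) (Icc 0 T ×ˢ K)) ∧
    -- test functions: integrability and weak convergence
    (∀ φ : ℝ × ℝ → ℝ, IsTestFunction γ φ →
      (∀ᵐ p ∂(volume.restrict spaceTime),
        Integrable (fun q : halfPlane => φ q) (restrictH (ν p))) ∧
      TendstoWeaklyL1Loc (fun n p => φ (rho n p.1 p.2, u n p.1 p.2))
        (fun p => ∫ q : halfPlane, φ q ∂(restrictH (ν p)))) ∧
    -- no mass at infinity
    (∀ᵐ p ∂(volume.restrict spaceTime),
      (ν p : Measure BarH) (openPart ∪ vacuum)ᶜ = 0) := by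
  have h : BoundedMoments γ rho u ν :=
    { young := hν
      cont := fun n => (hsol n).smooth_rho.continuousOn.prodMk (hsol n).smooth_u.continuousOn
      pos := fun n p hp => by
        obtain ⟨c, hc⟩ := (hsol n).lower_bound
        exact (hc p.1 hp.1).1.trans_le ((hc p.1 hp.1).2 p.2)
      bound := fun K hK => exists_integral_moment_le hγ hL hR hbar hε hε₀ hdata hsol hK }
  refine ⟨⟨h.ae_integrable_moment hγ, fun T K hK => h.integrableOn_integral_moment hγ
    (fun p hp => ⟨hp.1.1, mem_univ _⟩) (isCompact_Icc.prod hK).isBounded⟩, fun φ hφ => ?_,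
    h.ae_measure_compl_eq_zero hγ⟩
  have ha : ∀ δ > 0, ∃ k : ℕ, ∀ q ∈ halfPlane,
      |φ q - φ q * cutoff k q| ≤ δ * (1 + moment γ q) := fun δ hδ => hφ.exists_cutoff hγ hδ
  refine ⟨?_, ?_, ?_, ?_⟩
  · filter_upwards [h.ae_integrable_moment hγ] with p hp
    exact BoundedMoments.integrable_of_approx hφ.continuousOn ha hp
  · exact fun n K hK hKc =>
      ((h.continuousOn_comp hφ.continuousOn n).mono hK).integrableOn_compact hKc
  · exact fun K hK hKc => h.integrableOn_of_approx hγ hφ.continuousOn ha hK hKc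
  · exact fun K hK hKc g hg => h.tendsto_of_approx hγ hφ.continuousOn ha hK hKc hg
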